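/- Consider the system $$\dot x=Ax,\qquad \dot\theta=-k_p f(\theta,\omega,x)+\omega,\qquad \dot\omega=-k_i f(\theta,\omega,x),\qquad f(\theta,\omega,x)=\frac{g(\theta,\omega)-h(\omega)^Tx}{\mu-\nu^Tx},$$ with $(\theta,\omega,x)\in\mathbb R\times\mathbb R\times\mathbb R^4$, where $k_p,k_i>0$, $A\in\mathbb R^{4\times4}$ is Hurwitz, $0\ne\mu\in\mathbb R$, $\nu\in\mathbb R^4$, and $g:\mathbb R^2\to\mathbb R$, $h:\mathbb R\to\mathbb R^4$ are $C^1$ with $g(0,0)=0$. Assume that the eigenvalues of the Jacobian at the origin of $(\theta,\omega)\mapsto(-k_pf(\theta,\omega,0)+\omega,\,-k_if(\theta,\omega,0))$ are non-real with negative real parts. The lock-in domain of the origin is the set of initial conditions from which the solution exists for all $t\ge0$ and converges to the origin without crossing the lines $\theta=\pm\pi$ (that is, with $|\theta(t)|\le\pi$ for all $t\ge0$). Let $V^{CC}(x)=x^TPx$, where $P$ is symmetric positive definite and $A^TP+PA+\gamma P$ is negative definite for some $\gamma>0$. Let $\bar V\ge0$ be such that $\nu^Tx\ne\mu$ whenever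 $V^{CC}(x)\le\bar V$. For $0\le V\le\bar V$ the $V$-comparison system is $$\dot\theta=-k_pf_*(\theta,\omega)+\omega,\qquad \dot\omega=-k_if_*(\theta,\omega),$$ where $f_*(\theta,\omega)$ is $\min_{V^{CC}(x)\le V}f(\theta,\omega,x)$ if $\omega\ge0$ and $\max_{V^{CC}(x)\le V}f(\theta,\omega,x)$ if $\omega<0$; its solutions are understood in the sense of Carathéodory. Let $C_0=\{(0,0)\}$ and, for each $V\in(0,\bar V]$, let $C_V$ be a closed orbit (for instance a limit cycle) of the $V$-comparison system that goes once clockwise around the origin; assume that $C_V$ depends continuously, in the Hausdorff distance, on $V\in[0,\bar V]$. Let $\Lambda(V)$ be the closed region bounded by $C_V$, and let $V^{PLL}$ be the function with $V^{PLL}=V$ on $C_V=\partial\Lambda(V)$ for $0\le V\le\bar V$ (and $V^{PLL}=+\infty$ at points that lie on no $C_V$). **Theorem.** Suppose that $\Lambda(\bar V)$ is contained between the lines $\theta=\pm\pi$, i.e. in $\{|\theta|\le\pi\}$. Then the set $$\{(\theta,\omega,x):\ V^{PLL}(\theta,\omega)\le\bar V,\ V^{CC}(x)\le\bar V\}$$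 is forward invariant for the system and is contained in the lock-in domain of the origin. -/

import Mathlib

open Set Filter Topology
open scoped Matrix

noncomputable section

/-- The data of the closed-loop error dynamics
`x' = A x`, `θ' = -kp f(θ, ω, x) + ω`, `ω' = -ki f(θ, ω, x)`, where
`f(θ, ω, x) = (g(θ, ω) - h(ω)ᵀ x) / (μ - νᵀ x)`.
Here `θ`, `ω` stand for the phase and frequency errors. -/
structure InverterSystem where
  kp : ℝ
  ki : ℝ
  A : Matrix (Fin 4) (Fin 4) ℝ
  μ : ℝ
  ν : Fin 4 → ℝ
  g : ℝ × ℝ → ℝ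
  h : ℝ → Fin 4 → ℝ

namespace InverterSystem

/-- States `(θ, ω, x)`. -/
abbrev State : Type := ℝ × ℝ × (Fin 4 → ℝ)

variable (S : InverterSystem)

/-- The nonlinearity `f(θ, ω, x)`; it is meaningful where `νᵀ x ≠ μ`. -/
def f (θ ω : ℝ) (x : Fin 4 → ℝ) : ℝ :=
  (S.g (θ, ω) - S.h ω ⬝ᵥ x) / (S.μ - S.ν ⬝ᵥ x)

/-- The right-hand side of the closed-loop system. -/
def field (z : State) : State :=
  (-S.kp * S.f z.1 z.2.1 z.2.2 + z.2.1,
    -S.ki * S.f z.1 z.2.1 z.2.2,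
    S.A *ᵥ z.2.2)

/-- The Jacobian at the origin of the PLL subsystem with `x = 0`. -/
def jacobian : Matrix (Fin 2) (Fin 2) ℝ :=
  !![-S.kp * deriv (fun s => S.f s 0 0) 0, 1 - S.kp * deriv (fun s => S.f 0 s 0) 0;
     -S.ki * deriv (fun s => S.f s 0 0) 0, -S.ki * deriv (fun s => S.f 0 s 0) 0]

/-- The standing assumptions: positive gains, `A` Hurwitz, `μ ≠ 0`, `g` and `h` continuously
differentiable, the origin is an equilibrium, and the eigenvalues of the Jacobian of the PLL
at the origin are non-real with negative real parts. -/
structure StandingAssumptions : Prop where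
  kp_pos : 0 < S.kp
  ki_pos : 0 < S.ki
  hurwitz : ∀ z ∈ spectrum ℂ (S.A.map (fun a : ℝ => (a : ℂ))), z.re < 0
  mu_ne : S.μ ≠ 0
  g_contDiff : ContDiff ℝ 1 S.g
  h_contDiff : ContDiff ℝ 1 S.h
  g_zero : S.g (0, 0) = 0
  oscillatory : ∀ z ∈ spectrum ℂ (S.jacobian.map (fun a : ℝ => (a : ℂ))), z.re < 0 ∧ z.im ≠ 0

/-- `z` is a solution of the closed-loop system on the time interval `I`. -/
def IsSolutionOn (I : Set ℝ) (z : ℝ → State) : Prop :=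
  ∀ t ∈ I, S.ν ⬝ᵥ (z t).2.2 ≠ S.μ ∧ HasDerivWithinAt z (S.field (z t)) I t

/-- Solutions that start in `E` remain in `E` for as long as they exist. -/
def ForwardInvariant (E : Set State) : Prop :=
  ∀ (τ : ℝ) (z : ℝ → State), S.IsSolutionOn (Icc 0 τ) z → z 0 ∈ E → ∀ t ∈ Icc 0 τ, z t ∈ E

/-- The lock-in domain of the origin: the initial conditions from which the solution exists for
all `t ≥ 0` and converges to the origin without crossing the lines `θ = π` and `θ = -π`. -/
def lockInDomain : Set State :=
  {z₀ | (∃ z : ℝ → State, S.IsSolutionOn (Ici 0) z ∧ z 0 = z₀) ∧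
    ∀ z : ℝ → State, S.IsSolutionOn (Ici 0) z → z 0 = z₀ →
      (∀ t, 0 ≤ t → |(z t).1| ≤ Real.pi) ∧ Tendsto z atTop (𝓝 0)}

/-- An estimation of the lock-in domain: a forward-invariant set contained in it. -/
def IsLockInEstimation (E : Set State) : Prop :=
  S.ForwardInvariant E ∧ E ⊆ S.lockInDomain

/-- The quadratic Lyapunov function `xᵀ P x` of the current controller. -/
def VCC (P : Matrix (Fin 4) (Fin 4) ℝ) (x : Fin 4 → ℝ) : ℝ :=
  x ⬝ᵥ (P *ᵥ x)

/-- The extremal value `f_*` of `f` over `VCC x ≤ V`: the minimum where `ω ≥ 0`, the maximum where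
`ω < 0`. (The set `VCC x ≤ V` is compact for positive definite `P`, so the infimum and the supremum
are attained as soon as the set contains no point with `νᵀ x = μ`.) -/
def fStar (P : Matrix (Fin 4) (Fin 4) ℝ) (V θ ω : ℝ) : ℝ :=
  if 0 ≤ ω then sInf (S.f θ ω '' {x | VCC P x ≤ V}) else sSup (S.f θ ω '' {x | VCC P x ≤ V})

/-- The right-hand side of the `V`-comparison system. -/
def comparisonField (P : Matrix (Fin 4) (Fin 4) ℝ) (V : ℝ) (p : ℝ × ℝ) : ℝ × ℝ :=
  (-S.kp * S.fStar P V p.1 p.2 + p.2, -S.ki * S.fStar P V p.1 p.2)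

/-- `C` is a closed orbit of the `V`-comparison system that goes once around the origin clockwise.
The right-hand side jumps across the line `ω = 0`, so solutions are understood in the sense of
Carathéodory, through the integral equation. The functions `r`, `φ` are polar coordinates
along the orbit. -/
def IsClockwiseCycle (P : Matrix (Fin 4) (Fin 4) ℝ) (V : ℝ) (C : Set (ℝ × ℝ)) : Prop :=
  ∃ (T : ℝ) (c : ℝ → ℝ × ℝ), 0 < T ∧ Continuous c ∧ Function.Periodic c T ∧
    InjOn c (Ico 0 T) ∧ range c = C ∧
    (∀ t, c t = c 0 + ∫ s in (0 : ℝ)..t, S.comparisonField P V (c s)) ∧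
    ∃ r φ : ℝ → ℝ, Continuous r ∧ Continuous φ ∧ (∀ t, 0 < r t) ∧
      (∀ t, c t = (r t * Real.cos (φ t), r t * Real.sin (φ t))) ∧
      ∀ t, φ (t + T) = φ t - 2 * Real.pi

/-- A family of cycles `C V`, `0 ≤ V ≤ Vbar`, of the `V`-comparison systems: it reduces to the zero
equilibrium for `V = 0`, consists of clockwise cycles for `V > 0`, and changes continuously
with `V` (in the Hausdorff distance). -/
structure IsCycleFamily (P : Matrix (Fin 4) (Fin 4) ℝ) (Vbar : ℝ) (C : ℝ → Set (ℝ × ℝ)) :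
    Prop where
  zero : C 0 = {((0 : ℝ), (0 : ℝ))}
  cycle : ∀ V ∈ Ioc 0 Vbar, S.IsClockwiseCycle P V (C V)
  continuous : ∀ V₀ ∈ Icc 0 Vbar,
    Tendsto (fun V => Metric.hausdorffDist (C V) (C V₀)) (𝓝[Icc 0 Vbar] V₀) (𝓝 0)

end InverterSystem

/-- The closed region bounded by the curve `C`: the curve together with the bounded components of
its complement. -/
def enclosedRegion (C : Set (ℝ × ℝ)) : Set (ℝ × ℝ) :=
  C ∪ {p | p ∉ C ∧ Bornology.IsBounded (connectedComponentIn Cᶜ p)}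

/-- The Lyapunov function of the PLL: it has the value `V` on the cycle `C V`, for `0 ≤ V ≤ Vbar`,
and the value `⊤` at the points that lie on none of these cycles. -/
def VPLL (Vbar : ℝ) (C : ℝ → Set (ℝ × ℝ)) (p : ℝ × ℝ) : EReal :=
  sInf ((fun V : ℝ => (V : EReal)) '' {V | V ∈ Icc 0 Vbar ∧ p ∈ C V})

/-- The set `VPLL (θ, ω) ≤ Vbar`, `VCC x ≤ Vbar`. -/
def invariantSquare (P : Matrix (Fin 4) (Fin 4) ℝ) (Vbar : ℝ) (C : ℝ → Set (ℝ × ℝ)) :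
    Set InverterSystem.State :=
  {z | VPLL Vbar C (z.1, z.2.1) ≤ (Vbar : EReal) ∧ InverterSystem.VCC P z.2.2 ≤ Vbar}

end

/-! Put `y = θ - (kp / ki) ω`. The system becomes `y' = ω`, `ω' = -F` with `F = ki f`, and the
comparison system becomes `ω' = -m` above the axis `ω = 0` and `ω' = -M` below it, where `m` and `M`
are the extrema of `F` over the ellipsoid `VCC x ≤ V`. In the upper half-plane `y` increases, so a
comparison orbit is a graph `ω ^ 2 / 2 = e y` with `e' = -m`. A trajectory with an admissible input
has `F ≥ m`, so it cannot cross this graph from below (`UpperArc.le_of_le`). The lower half-plane is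
the same picture after the central reflection.

A closed orbit crosses the axis transversally and cannot spiral, so it consists of one upper and one
lower arc (`CycleData.exists_oval`). Hence its vertical hull is forward invariant under all inputs
from the ellipsoid (`Oval.mem_hull_of_trajectory`).

Raising `V` lowers `m` and raises `M`, so the ovals are nested as soon as their right ends `b V` are
ordered. The function `b` is continuous, and it is injective: equal right ends force equal fields
along both ovals, an extremum of `F` over the smaller ellipsoid is then a local one, and `F` does
not depend on `x` anywhere on the cycle (`Degenerate`). That is impossible. If `ν ≠ 0`, then `F` at
`x = 0` would take the same value at both corners, where its signs are opposite. If `ν = 0`, then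
`h` vanishes near `0`, and the small cycles are closed orbits of the system with `x = 0`, which its
linear damping excludes. So the cycles fill the largest hull (`OvalFamily.mem_hull_iff_exists`), and
the set `VPLL ≤ Vbar` is that hull; invariance follows because `VCC` decays.

For convergence, take the infimum of the levels `V` whose hulls eventually contain the trajectory.
Were it positive, limits of translates would give an orbit of the system with `x = 0`. This orbit
lies on the cycle of that level, since otherwise a smaller hull would capture the trajectory. Such
an orbit again makes the cycle degenerate (`OvalFamily.not_isOrbit`). So the infimum is `0`, and the
hulls shrink to the origin. -/

noncomputable section

/-! ### Scalar differential inequalities. -/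

section ScalarInequalities

/-- The inequality `D' ≤ K |D|` preserves the sign condition `D ≤ 0`. -/
theorem nonpos_of_deriv_le_mul_abs {D D' : ℝ → ℝ} {s₀ s₁ K : ℝ} (hs : s₀ ≤ s₁)
    (hc : ContinuousOn D (Icc s₀ s₁)) (hd : ∀ t ∈ Ioo s₀ s₁, HasDerivAt D (D' t) t)
    (hb : ∀ t ∈ Ioo s₀ s₁, D' t ≤ K * |D t|) (h0 : D s₀ ≤ 0) : D s₁ ≤ 0 := by
  by_contra! hcon
  have hcl : IsCompact {t | t ∈ Icc s₀ s₁ ∧ D t ≤ 0} := by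
    have := hc.preimage_isClosed_of_isClosed isClosed_Icc (isClosed_Iic (a := (0 : ℝ)))
    exact isCompact_Icc.of_isClosed_subset this inter_subset_left
  -- After the last time `σ` with `D ≤ 0` one has `|D| = D`, so `D t * exp (-K t)` is nonincreasing
  -- there, although it would have to rise from a nonpositive to a positive value.
  obtain ⟨σ, ⟨hσ, hDσ⟩, hmax⟩ := hcl.exists_isGreatest ⟨s₀, left_mem_Icc.2 hs, h0⟩
  have hpos : ∀ t ∈ Ioc σ s₁, 0 < D t := by
    intro t ht
    by_contra! h
    exact absurd (hmax ⟨⟨hσ.1.trans ht.1.le, ht.2⟩, h⟩) (not_le.2 ht.1)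
  have hanti : AntitoneOn (fun t => D t * Real.exp (-K * t)) (Icc σ s₁) := by
    refine antitoneOn_of_hasDerivWithinAt_nonpos
      (f' := fun t => D' t * Real.exp (-K * t) + D t * (Real.exp (-K * t) * -K))
      (convex_Icc _ _) ?_ ?_ ?_
    · exact (hc.mono (Icc_subset_Icc_left hσ.1)).mul (by fun_prop)
    · intro t ht
      rw [interior_Icc] at ht
      have h1 := hd t ⟨hσ.1.trans_lt ht.1, ht.2⟩
      have h2 : HasDerivAt (fun t => Real.exp (-K * t)) (Real.exp (-K * t) * -K) t := by
        simpa using ((hasDerivAt_id t).const_mul (-K)).exp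
      exact (h1.mul h2).hasDerivWithinAt
    · intro t ht
      rw [interior_Icc] at ht
      have h1 := hb t ⟨hσ.1.trans_lt ht.1, ht.2⟩
      rw [abs_of_pos (hpos t ⟨ht.1, ht.2.le⟩)] at h1
      nlinarith [Real.exp_pos (-K * t)]
  have h := hanti (left_mem_Icc.2 hσ.2) (right_mem_Icc.2 hσ.2) hσ.2
  simp only at h
  have h1 : 0 < D s₁ * Real.exp (-K * s₁) := by positivity
  have h2 : D σ * Real.exp (-K * σ) ≤ 0 := mul_nonpos_of_nonpos_of_nonneg hDσ (Real.exp_pos _).le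
  linarith

/-- The inequality `D' ≤ K |D|` preserves the sign condition `D < 0`. -/
theorem neg_of_deriv_le_mul_abs {D D' : ℝ → ℝ} {s₀ s₁ K : ℝ} (hs : s₀ ≤ s₁)
    (hc : ContinuousOn D (Icc s₀ s₁)) (hd : ∀ t ∈ Ioo s₀ s₁, HasDerivAt D (D' t) t)
    (hb : ∀ t ∈ Ioo s₀ s₁, D' t ≤ K * |D t|) (h0 : D s₀ < 0) : D s₁ < 0 := by
  by_contra! hcon
  -- Time reversal: `-D (s₀ + s₁ - t)` satisfies the same inequality, so `0 ≤ D s₁` would give `0 ≤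
  -- D s₀`.
  have h := nonpos_of_deriv_le_mul_abs (D := fun t => -D (s₀ + s₁ - t))
    (D' := fun t => D' (s₀ + s₁ - t)) (K := K) hs
    (hc.comp (by fun_prop) fun t ht => ⟨by linarith [ht.2], by linarith [ht.1]⟩).neg
    (fun t ht => by
      have h1 := hd (s₀ + s₁ - t) ⟨by linarith [ht.2], by linarith [ht.1]⟩
      have h2 : HasDerivAt (fun t => s₀ + s₁ - t) (-1) t := by
        simpa using (hasDerivAt_id t).const_sub (s₀ + s₁)
      exact ((h1.comp t h2).neg).congr_deriv (by ring))
    (fun t ht => by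
      simpa using hb (s₀ + s₁ - t) ⟨by linarith [ht.2], by linarith [ht.1]⟩)
    (by simpa using hcon)
  simp at h
  linarith

/-- A function whose derivative tends to a nonzero limit does not converge. -/
theorem eq_zero_of_tendsto_deriv {u u' : ℝ → ℝ} {τ l L : ℝ}
    (hd : ∀ t, τ ≤ t → HasDerivWithinAt u (u' t) (Ici τ) t)
    (hu : Tendsto u atTop (𝓝 l)) (hu' : Tendsto u' atTop (𝓝 L)) : L = 0 := by
  have hshift : Tendsto (fun t => u (t + 1) - u t) atTop (𝓝 0) := by
    simpa using (hu.comp (tendsto_atTop_add_const_right atTop (1 : ℝ) tendsto_id)).sub hu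
  -- By the mean value theorem the increments over unit intervals, which tend to `0`, are values of
  -- `u'` at points that tend to infinity.
  have hex : ∀ t, τ < t → ∃ c, c ∈ Ioo t (t + 1) ∧ u' c = u (t + 1) - u t := by
    intro t ht
    obtain ⟨c, hc, h⟩ := exists_hasDerivAt_eq_slope u u' (show t < t + 1 by linarith)
      (fun s hs => ((hd s (ht.le.trans hs.1)).hasDerivAt
        (Ici_mem_nhds (ht.trans_le hs.1))).continuousAt.continuousWithinAt)
      (fun s hs => (hd s (ht.le.trans hs.1.le)).hasDerivAt (Ici_mem_nhds (ht.trans hs.1)))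
    exact ⟨c, hc, by simpa using h⟩
  choose! c hc hc' using hex
  have hct : Tendsto c atTop atTop :=
    tendsto_atTop_mono' atTop ((eventually_gt_atTop τ).mono fun t ht => (hc t ht).1.le) tendsto_id
  have h1 : Tendsto (fun t => u' (c t)) atTop (𝓝 L) := hu'.comp hct
  refine tendsto_nhds_unique h1 (hshift.congr' ?_)
  filter_upwards [eventually_gt_atTop τ] with t ht using (hc' t ht).symm

end ScalarInequalities

/-! ### Arcs in the upper half-plane and comparison with them. -/

section Arcs

/-- Lipschitz on every bounded set. -/
def LipschitzOnBounded (m : ℝ × ℝ → ℝ) : Prop :=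
  ∀ R : ℝ, ∃ L : ℝ, 0 ≤ L ∧ ∀ p q : ℝ × ℝ, ‖p‖ ≤ R → ‖q‖ ≤ R → |m p - m q| ≤ L * ‖p - q‖

theorem LipschitzOnBounded.continuous {m : ℝ × ℝ → ℝ} (hm : LipschitzOnBounded m) :
    Continuous m := by
  rw [continuous_iff_continuousAt]
  intro p
  obtain ⟨L, hL, h⟩ := hm (‖p‖ + 1)
  rw [ContinuousAt, tendsto_iff_norm_sub_tendsto_zero]
  have h0 : Tendsto (fun q => L * ‖q - p‖) (𝓝 p) (𝓝 0) := by
    have : Continuous fun q : ℝ × ℝ => L * ‖q - p‖ := by fun_prop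
    simpa using this.tendsto p
  refine squeeze_zero' (Eventually.of_forall fun _ => norm_nonneg _) ?_ h0
  filter_upwards [Metric.ball_mem_nhds p one_pos] with q hq
  rw [Metric.mem_ball, dist_eq_norm] at hq
  refine h q p ?_ (by linarith)
  calc ‖q‖ = ‖(q - p) + p‖ := by simp
    _ ≤ ‖q - p‖ + ‖p‖ := norm_add_le _ _
    _ ≤ _ := by linarith

/-- The central reflection of a field, which exchanges the two half-planes. -/
def reflect (m : ℝ × ℝ → ℝ) (p : ℝ × ℝ) : ℝ := -m (-p)

@[simp] theorem reflect_reflect (m : ℝ × ℝ → ℝ) : reflect (reflect m) = m := by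
  funext p; simp [reflect]

theorem LipschitzOnBounded.reflect {m : ℝ × ℝ → ℝ} (hm : LipschitzOnBounded m) :
    LipschitzOnBounded (reflect m) := by
  intro R
  obtain ⟨L, hL, h⟩ := hm R
  refine ⟨L, hL, fun p q hp hq => ?_⟩
  have := h (-q) (-p) (by simpa using hq) (by simpa using hp)
  rw [_root_.reflect, _root_.reflect]
  convert this using 2
  · ring
  · congr 1; abel

/-- An orbit of `y' = ω`, `ω' = -m (y, ω)` in the upper half-plane which goes from the point
`(a, 0)` to the point `(b, 0)`, and which is the graph of `ω ^ 2 / 2 = e y`. -/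
structure UpperArc (m : ℝ × ℝ → ℝ) (a b : ℝ) (e : ℝ → ℝ) : Prop where
  lt : a < b
  cont : ContinuousOn e (Icc a b)
  left : e a = 0
  right : e b = 0
  pos : ∀ y ∈ Ioo a b, 0 < e y
  hasDerivAt : ∀ y ∈ Ioo a b, HasDerivAt e (-m (y, √(2 * e y))) y
  -- Both descriptions are needed: to compare two arcs, one is run as a trajectory in time beneath
  -- the other, which is a graph over `y`.
  param : ∃ (s₀ s₁ : ℝ) (Y W : ℝ → ℝ), s₀ < s₁ ∧ ContinuousOn Y (Icc s₀ s₁) ∧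
    ContinuousOn W (Icc s₀ s₁) ∧ Y s₀ = a ∧ Y s₁ = b ∧
    (∀ t ∈ Icc s₀ s₁, W t ^ 2 / 2 = e (Y t)) ∧
    ∀ t ∈ Ioo s₀ s₁, 0 < W t ∧ Y t ∈ Ioo a b ∧ HasDerivAt Y (W t) t ∧
      HasDerivAt W (-m (Y t, W t)) t

theorem UpperArc.nonneg {m : ℝ × ℝ → ℝ} {a b : ℝ} {e : ℝ → ℝ} (A : UpperArc m a b e)
    {y : ℝ} (hy : y ∈ Icc a b) : 0 ≤ e y := by
  rcases eq_or_lt_of_le hy.1 with h | h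
  · rw [← h, A.left]
  rcases eq_or_lt_of_le hy.2 with h' | h'
  · rw [h', A.right]
  exact (A.pos y ⟨h, h'⟩).le

/-- The function `ω ^ 2 / 2 - e y` along a trajectory which moves below the field of the arc. -/
theorem UpperArc.exists_deriv_bound {m : ℝ × ℝ → ℝ} {a b : ℝ} {e : ℝ → ℝ} (A : UpperArc m a b e)
    (hm : LipschitzOnBounded m) {s₀ s₁ : ℝ} {Y W F : ℝ → ℝ}
    (hW : ContinuousOn W (Icc s₀ s₁))
    (hYd : ∀ t ∈ Ioo s₀ s₁, HasDerivAt Y (W t) t)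
    (hWd : ∀ t ∈ Ioo s₀ s₁, HasDerivAt W (-F t) t)
    (hF : ∀ t ∈ Ioo s₀ s₁, m (Y t, W t) ≤ F t)
    (hpos : ∀ t ∈ Ioo s₀ s₁, 0 ≤ W t) (hab : ∀ t ∈ Ioo s₀ s₁, Y t ∈ Ioo a b) :
    ∃ (K : ℝ) (D' : ℝ → ℝ), ∀ t ∈ Ioo s₀ s₁,
      HasDerivAt (fun t => W t ^ 2 / 2 - e (Y t)) (D' t) t ∧
      D' t ≤ K * |W t ^ 2 / 2 - e (Y t)| := by
  obtain ⟨B, hB⟩ := isCompact_Icc.exists_bound_of_continuousOn hW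
  obtain ⟨E, hE⟩ := isCompact_Icc.exists_bound_of_continuousOn A.cont
  obtain ⟨L, hL, hlip⟩ := hm (|a| + |b| + |B| + √(2 * |E|))
  -- With `u = √(2 e)` the derivative is `W (m (Y, u) - F) ≤ L W |u - W| ≤ L (W + u) |u - W|`, which
  -- is `2 L |W ^ 2 / 2 - e|`. The factor `W` compensates the failure of the square root to be
  -- Lipschitz at the axis.
  refine ⟨2 * L, fun t => W t * (m (Y t, √(2 * e (Y t))) - F t), fun t ht => ⟨?_, ?_⟩⟩
  · have h1 := ((hWd t ht).pow 2).div_const 2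
    have h2 := (A.hasDerivAt _ (hab t ht)).comp t (hYd t ht)
    refine (h1.sub h2).congr_deriv ?_
    push_cast
    ring
  · have hy := hab t ht
    have hYa : |Y t| ≤ |a| + |b| := by
      rw [abs_le]
      constructor
      · linarith [neg_abs_le a, abs_nonneg b, hy.1]
      · linarith [le_abs_self b, abs_nonneg a, hy.2]
    have he := A.pos _ hy
    have hB' : |W t| ≤ |B| := (hB t (Ioo_subset_Icc_self ht)).trans (le_abs_self B)
    have hE' : √(2 * e (Y t)) ≤ √(2 * |E|) := by
      apply Real.sqrt_le_sqrt
      have := hE (Y t) (Ioo_subset_Icc_self hy)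
      rw [Real.norm_eq_abs] at this
      linarith [le_abs_self (e (Y t)), le_abs_self E]
    set u := √(2 * e (Y t)) with hu
    have hu0 : 0 ≤ u := Real.sqrt_nonneg _
    have husq : u ^ 2 = 2 * e (Y t) := Real.sq_sqrt (by linarith)
    have h1 : |m (Y t, u) - m (Y t, W t)| ≤ L * |u - W t| := by
      have := hlip (Y t, u) (Y t, W t) ?_ ?_
      · simpa [Prod.norm_def] using this
      · rw [Prod.norm_def]
        refine max_le ?_ ?_ <;> simp only [Real.norm_eq_abs]
        · linarith [abs_nonneg B, Real.sqrt_nonneg (2 * |E|)]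
        · rw [abs_of_nonneg hu0]
          linarith [abs_nonneg B, abs_nonneg a, abs_nonneg b]
      · rw [Prod.norm_def]
        refine max_le ?_ ?_ <;> simp only [Real.norm_eq_abs]
        · linarith [abs_nonneg B, Real.sqrt_nonneg (2 * |E|)]
        · linarith [abs_nonneg a, abs_nonneg b, Real.sqrt_nonneg (2 * |E|)]
    have hD : |W t ^ 2 / 2 - e (Y t)| = |u - W t| * (W t + u) / 2 := by
      have : W t ^ 2 / 2 - e (Y t) = (-(u - W t)) * ((W t + u) / 2) := by
        linear_combination (1 / 2) * husq
      rw [this, abs_mul, abs_neg, abs_of_nonneg (by linarith [hpos t ht] : 0 ≤ (W t + u) / 2)]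
      ring
    have h2 := hF t ht
    have h3 := (abs_le.1 h1).2
    calc W t * (m (Y t, u) - F t) ≤ W t * (L * |u - W t|) := by
          gcongr
          · exact hpos t ht
          · linarith
      _ ≤ (W t + u) * (L * |u - W t|) := by gcongr; linarith
      _ = 2 * L * |W t ^ 2 / 2 - e (Y t)| := by rw [hD]; ring

theorem UpperArc.continuousOn_comp {m : ℝ × ℝ → ℝ} {a b : ℝ} {e : ℝ → ℝ} (A : UpperArc m a b e)
    {s₀ s₁ : ℝ} {Y W : ℝ → ℝ} (hs : s₀ < s₁)
    (hY : ContinuousOn Y (Icc s₀ s₁)) (hW : ContinuousOn W (Icc s₀ s₁))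
    (hab : ∀ t ∈ Ioo s₀ s₁, Y t ∈ Ioo a b) :
    ContinuousOn (fun t => W t ^ 2 / 2 - e (Y t)) (Icc s₀ s₁) := by
  have hmaps : MapsTo Y (Icc s₀ s₁) (Icc a b) := by
    rw [← closure_Ioo hs.ne, ← closure_Ioo A.lt.ne]
    rw [← closure_Ioo hs.ne] at hY
    exact MapsTo.closure_of_continuousOn (fun t ht => hab t ht) hY
  exact ((hW.pow 2).div_const 2).sub (A.cont.comp hY hmaps)

/-- A trajectory in the upper half-plane that starts below an arc, and moves below its field,
stays below it. -/
theorem UpperArc.le_of_le {m : ℝ × ℝ → ℝ} {a b : ℝ} {e : ℝ → ℝ} (A : UpperArc m a b e)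
    (hm : LipschitzOnBounded m) {s₀ s₁ : ℝ} {Y W F : ℝ → ℝ} (hs : s₀ < s₁)
    (hY : ContinuousOn Y (Icc s₀ s₁)) (hW : ContinuousOn W (Icc s₀ s₁))
    (hYd : ∀ t ∈ Ioo s₀ s₁, HasDerivAt Y (W t) t)
    (hWd : ∀ t ∈ Ioo s₀ s₁, HasDerivAt W (-F t) t)
    (hF : ∀ t ∈ Ioo s₀ s₁, m (Y t, W t) ≤ F t)
    (hpos : ∀ t ∈ Ioo s₀ s₁, 0 ≤ W t) (hab : ∀ t ∈ Ioo s₀ s₁, Y t ∈ Ioo a b)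
    (h0 : W s₀ ^ 2 / 2 ≤ e (Y s₀)) : W s₁ ^ 2 / 2 ≤ e (Y s₁) := by
  obtain ⟨K, D', h⟩ := A.exists_deriv_bound hm hW hYd hWd hF hpos hab
  have := nonpos_of_deriv_le_mul_abs hs.le (A.continuousOn_comp hs hY hW hab)
    (fun t ht => (h t ht).1) (fun t ht => (h t ht).2) (by linarith)
  linarith

/-- The strict version of `UpperArc.le_of_le`. -/
theorem UpperArc.lt_of_lt {m : ℝ × ℝ → ℝ} {a b : ℝ} {e : ℝ → ℝ} (A : UpperArc m a b e)
    (hm : LipschitzOnBounded m) {s₀ s₁ : ℝ} {Y W F : ℝ → ℝ} (hs : s₀ < s₁)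
    (hY : ContinuousOn Y (Icc s₀ s₁)) (hW : ContinuousOn W (Icc s₀ s₁))
    (hYd : ∀ t ∈ Ioo s₀ s₁, HasDerivAt Y (W t) t)
    (hWd : ∀ t ∈ Ioo s₀ s₁, HasDerivAt W (-F t) t)
    (hF : ∀ t ∈ Ioo s₀ s₁, m (Y t, W t) ≤ F t)
    (hpos : ∀ t ∈ Ioo s₀ s₁, 0 ≤ W t) (hab : ∀ t ∈ Ioo s₀ s₁, Y t ∈ Ioo a b)
    (h0 : W s₀ ^ 2 / 2 < e (Y s₀)) : W s₁ ^ 2 / 2 < e (Y s₁) := by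
  obtain ⟨K, D', h⟩ := A.exists_deriv_bound hm hW hYd hWd hF hpos hab
  have := neg_of_deriv_le_mul_abs hs.le (A.continuousOn_comp hs hY hW hab)
    (fun t ht => (h t ht).1) (fun t ht => (h t ht).2) (by linarith)
  linarith

end Arcs

/-! ### Excursions above the axis as graphs. -/

section Arcs

/-- An excursion of `y' = ω`, `ω' = -m (y, ω)` into the upper half-plane is an upper arc. -/
theorem exists_upperArc {m : ℝ × ℝ → ℝ} {y ω : ℝ → ℝ} {t₀ t₁ : ℝ} (ht : t₀ < t₁)
    (hω : Continuous ω) (hy : ∀ t, HasDerivAt y (ω t) t) (h0 : ω t₀ = 0) (h1 : ω t₁ = 0)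
    (hpos : ∀ t ∈ Ioo t₀ t₁, 0 < ω t) (hd : ∀ t ∈ Ioo t₀ t₁, HasDerivAt ω (-m (y t, ω t)) t) :
    ∃ e : ℝ → ℝ, UpperArc m (y t₀) (y t₁) e ∧ ∀ t ∈ Icc t₀ t₁, ω t ^ 2 / 2 = e (y t) := by
  have hyc : Continuous y := continuous_iff_continuousAt.2 fun t => (hy t).continuousAt
  have hmono : StrictMonoOn y (Icc t₀ t₁) := by
    refine strictMonoOn_of_hasDerivWithinAt_pos (convex_Icc _ _) hyc.continuousOn
      (fun t _ => (hy t).hasDerivWithinAt) fun t ht => ?_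
    rw [interior_Icc] at ht
    exact hpos t ht
  have himg : y '' Icc t₀ t₁ = Icc (y t₀) (y t₁) := by
    refine Subset.antisymm ?_ (intermediate_value_Icc ht.le hyc.continuousOn)
    rintro _ ⟨t, h, rfl⟩
    exact ⟨hmono.monotoneOn (left_mem_Icc.2 ht.le) h h.1,
      hmono.monotoneOn h (right_mem_Icc.2 ht.le) h.2⟩
  -- Time as a function of position. As `τ' = 1 / ω`, the energy `ω (τ v) ^ 2 / 2` has derivative `ω
  -- · (-m) / ω = -m`.
  set τ := Function.invFunOn y (Icc t₀ t₁) with hτ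
  have hτy : ∀ t ∈ Icc t₀ t₁, τ (y t) = t := fun t h => hmono.injOn.leftInvOn_invFunOn h
  have hτmem : ∀ v ∈ Icc (y t₀) (y t₁), τ v ∈ Icc t₀ t₁ ∧ y (τ v) = v := by
    intro v hv
    rw [← himg] at hv
    exact ⟨Function.invFunOn_mem hv, Function.invFunOn_eq hv⟩
  have hτc : ContinuousOn τ (Icc (y t₀) (y t₁)) := by
    rw [continuousOn_iff_isClosed]
    intro K hK
    refine ⟨y '' (K ∩ Icc t₀ t₁), ((isCompact_Icc.inter_left hK).image hyc).isClosed, ?_⟩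
    ext v
    constructor
    · rintro ⟨h, hv⟩
      exact ⟨⟨τ v, ⟨h, (hτmem v hv).1⟩, (hτmem v hv).2⟩, hv⟩
    · rintro ⟨⟨t, ⟨hK', ht'⟩, rfl⟩, hv⟩
      exact ⟨by rw [mem_preimage, hτy t ht']; exact hK', hv⟩
  have hτIoo : ∀ v ∈ Ioo (y t₀) (y t₁), τ v ∈ Ioo t₀ t₁ := by
    intro v hv
    obtain ⟨h, h'⟩ := hτmem v (Ioo_subset_Icc_self hv)
    refine ⟨lt_of_le_of_ne h.1 ?_, lt_of_le_of_ne h.2 ?_⟩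
    · rintro h2; rw [← h'] at hv; rw [← h2] at hv; exact lt_irrefl _ hv.1
    · rintro h2; rw [← h', h2] at hv; exact lt_irrefl _ hv.2
  refine ⟨fun v => ω (τ v) ^ 2 / 2,
    ⟨hmono (left_mem_Icc.2 ht.le) (right_mem_Icc.2 ht.le) ht, ?_, ?_, ?_, ?_, ?_, ?_⟩, ?_⟩
  · exact ((hω.comp_continuousOn hτc).pow 2).div_const 2
  · simp [hτy t₀ (left_mem_Icc.2 ht.le), h0]
  · simp [hτy t₁ (right_mem_Icc.2 ht.le), h1]
  · intro v hv
    have := hpos _ (hτIoo v hv)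
    positivity
  · intro v hv
    have hp := hpos _ (hτIoo v hv)
    have hsq : √(2 * (ω (τ v) ^ 2 / 2)) = ω (τ v) := by
      rw [mul_div_cancel₀ _ two_ne_zero, Real.sqrt_sq hp.le]
    have hn : Icc (y t₀) (y t₁) ∈ 𝓝 v := Icc_mem_nhds hv.1 hv.2
    have hτd : HasDerivAt τ (ω (τ v))⁻¹ v := by
      refine HasDerivAt.of_local_left_inverse (hτc.continuousAt hn) (hy _) hp.ne' ?_
      filter_upwards [hn] with w hw using (hτmem w hw).2
    have h2 := ((hd _ (hτIoo v hv)).comp v hτd).pow 2 |>.div_const 2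
    refine h2.congr_deriv ?_
    simp only [Function.comp_apply]
    rw [hsq, (hτmem v (Ioo_subset_Icc_self hv)).2]
    field_simp
    push_cast
    ring
  · refine ⟨t₀, t₁, y, ω, ht, hyc.continuousOn, hω.continuousOn, rfl, rfl, ?_, ?_⟩
    · intro t h; simp [hτy t h]
    · intro t h
      refine ⟨hpos t h, ⟨hmono (left_mem_Icc.2 ht.le) (Ioo_subset_Icc_self h) h.1,
        hmono (Ioo_subset_Icc_self h) (right_mem_Icc.2 ht.le) h.2⟩, hy t, hd t h⟩
  · intro t h; simp [hτy t h]

theorem exists_forall_abs_sub_lt_pos {f : ℝ → ℝ} (hf : Continuous f) {t : ℝ} (ht : 0 < f t) :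
    ∃ ε > 0, ∀ s, |s - t| < ε → 0 < f s :=
  Metric.eventually_nhds_iff.1 (continuousAt_const.eventually_lt hf.continuousAt ht)

theorem exists_first_zero {ω : ℝ → ℝ} (hω : Continuous ω) {s t : ℝ} (hst : s ≤ t) (hs : 0 < ω s)
    (ht : ω t ≤ 0) : ∃ e ∈ Ioc s t, ω e = 0 ∧ ∀ r ∈ Ico s e, 0 < ω r := by
  have hcl : IsCompact (Icc s t ∩ {r | ω r ≤ 0}) :=
    isCompact_Icc.inter_right (isClosed_le hω continuous_const)
  obtain ⟨e, ⟨he, hωe⟩, hmin⟩ := hcl.exists_isLeast ⟨t, right_mem_Icc.2 hst, ht⟩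
  have hpos : ∀ r ∈ Ico s e, 0 < ω r := by
    intro r hr
    by_contra! h
    exact absurd (hmin ⟨⟨hr.1, hr.2.le.trans he.2⟩, h⟩) (not_le.2 hr.2)
  have hse : s < e := lt_of_le_of_ne he.1 (by rintro rfl; exact absurd hs (not_lt.2 hωe))
  refine ⟨e, ⟨hse, he.2⟩, le_antisymm hωe ?_, hpos⟩
  have : e ∈ closure (Ico s e) := by rw [closure_Ico hse.ne]; exact right_mem_Icc.2 hse.le
  exact closure_minimal (fun r hr => (hpos r hr).le) (isClosed_le continuous_const hω) this

end Arcs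

/-! ### Closed orbits of the discontinuous planar system. -/

section Cycles

open MeasureTheory

/-- A closed orbit of the system `y' = ω`, `ω' = -G`, where `G` equals `m (y, ω)` in the upper and
`M (y, ω)` in the lower half-plane. -/
structure CycleData (m M : ℝ × ℝ → ℝ) (T : ℝ) (y ω G : ℝ → ℝ) : Prop where
  period_pos : 0 < T
  continuous_ω : Continuous ω
  periodic_y : Function.Periodic y T
  periodic_ω : Function.Periodic ω T
  inj : ∀ s t, y s = y t → ω s = ω t → ∃ n : ℤ, t = s + n * T
  hasDerivAt_y : ∀ t, HasDerivAt y (ω t) t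
  locallyIntegrable : LocallyIntegrable G volume
  ω_sub : ∀ s t, ω t - ω s = -∫ r in s..t, G r
  G_pos : ∀ t, 0 < ω t → G t = m (y t, ω t)
  G_neg : ∀ t, ω t < 0 → G t = M (y t, ω t)
  -- A two-sided bound, not a value: this keeps the structure symmetric under the central
  -- reflection, which exchanges `m` and `M`.
  G_zero : ∀ t, ω t = 0 → m (y t, ω t) ≤ G t ∧ G t ≤ M (y t, ω t)
  lipschitz_m : LipschitzOnBounded m
  lipschitz_M : LipschitzOnBounded M
  le : ∀ p, m p ≤ M p

namespace CycleData

variable {m M : ℝ × ℝ → ℝ} {T : ℝ} {y ω G : ℝ → ℝ}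

/-- By this symmetry every fact about the lower half-plane is a case of its counterpart in the upper
one. -/
theorem reflect (D : CycleData m M T y ω G) :
    CycleData (reflect M) (reflect m) T (-y) (-ω) (-G) where
  period_pos := D.period_pos
  continuous_ω := D.continuous_ω.neg
  periodic_y t := by simp [D.periodic_y t]
  periodic_ω t := by simp [D.periodic_ω t]
  inj s t h h' := D.inj s t (by simpa using h) (by simpa using h')
  hasDerivAt_y t := (D.hasDerivAt_y t).neg
  locallyIntegrable := D.locallyIntegrable.neg
  ω_sub s t := by
    have := D.ω_sub s t
    simp only [Pi.neg_apply, intervalIntegral.integral_neg]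
    linarith
  G_pos t h := by simp [_root_.reflect, D.G_neg t (by simpa using h)]
  G_neg t h := by simp [_root_.reflect, D.G_pos t (by simpa using h)]
  G_zero t h := by
    have := D.G_zero t (by simpa using h)
    simpa [_root_.reflect] using this.symm
  lipschitz_m := D.lipschitz_M.reflect
  lipschitz_M := D.lipschitz_m.reflect
  le p := neg_le_neg (D.le _)

theorem continuous_y (D : CycleData m M T y ω G) : Continuous y :=
  continuous_iff_continuousAt.2 fun t => (D.hasDerivAt_y t).continuousAt

theorem intervalIntegrable (D : CycleData m M T y ω G) (s t : ℝ) :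
    IntervalIntegrable G volume s t :=
  intervalIntegrable_iff.mpr <|
    (D.locallyIntegrable.integrableOn_isCompact isCompact_uIcc).mono_set uIoc_subset_uIcc

theorem le_G (D : CycleData m M T y ω G) (t : ℝ) : m (y t, ω t) ≤ G t := by
  rcases lt_trichotomy (ω t) 0 with h | h | h
  · rw [D.G_neg t h]; exact D.le _
  · exact (D.G_zero t h).1
  · rw [D.G_pos t h]

theorem ω_lt (D : CycleData m M T y ω G) {s t : ℝ} (hst : s < t) (h : ∀ r ∈ Ioo s t, 0 < G r) :
    ω t < ω s := by
  have := intervalIntegral.intervalIntegral_pos_of_pos_on (D.intervalIntegrable s t) h hst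
  linarith [D.ω_sub s t]

/-- In general `ω` is only an integral of `G`; strictly above the axis `G` is continuous, and the
integral equation can be differentiated everywhere. -/
theorem hasDerivAt_ω (D : CycleData m M T y ω G) {t : ℝ} (ht : 0 < ω t) :
    HasDerivAt ω (-m (y t, ω t)) t := by
  have hc : Continuous fun t => m (y t, ω t) :=
    D.lipschitz_m.continuous.comp (D.continuous_y.prodMk D.continuous_ω)
  obtain ⟨ε, hε, hb⟩ := exists_forall_abs_sub_lt_pos D.continuous_ω ht
  have h1 := (intervalIntegral.integral_hasDerivAt_right (hc.intervalIntegrable t t)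
    (hc.stronglyMeasurableAtFilter _ _) hc.continuousAt).neg.const_add (ω t)
  refine h1.congr_of_eventuallyEq ?_
  filter_upwards [Metric.ball_mem_nhds t hε] with s hs
  have h2 := D.ω_sub t s
  have h3 : ∫ r in t..s, G r = ∫ r in t..s, m (y r, ω r) := by
    refine intervalIntegral.integral_congr fun r hr => D.G_pos r (hb r ?_)
    rw [← Real.dist_eq, ← Metric.mem_ball]
    have := (convex_ball t ε).ordConnected.uIcc_subset (Metric.mem_ball_self hε) hs
    exact this hr
  simp only [Pi.neg_apply]
  linarith

/-- Almost everywhere `ω' = -G`. A zero of `ω` at which this derivative is nonzero is isolated from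
the right in the zero set, and there are only countably many such points. -/
theorem ae_G_eq_zero (D : CycleData m M T y ω G) : ∀ᵐ t, ω t = 0 → G t = 0 := by
  have hcount : {t ∈ {t | ω t = 0} | 𝓝[{t | ω t = 0} ∩ Ioi t] t = ⊥}.Countable :=
    countable_setOfPred_isolated_right_within
  filter_upwards [_root_.LocallyIntegrable.ae_hasDerivAt_integral D.locallyIntegrable,
    (hcount.ae_notMem volume)] with t ht hiso h0
  by_contra hG
  apply hiso
  refine ⟨h0, ?_⟩
  have hd : HasDerivAt ω (-G t) t := by
    refine (((ht t).neg).const_add (ω t)).congr_of_eventuallyEq (Eventually.of_forall fun s => ?_)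
    simp only [Pi.neg_apply]
    linarith [D.ω_sub t s]
  have hne := hd.eventually_ne (c := 0) (neg_ne_zero.2 hG)
  rw [eventually_nhdsWithin_iff] at hne
  rw [← empty_mem_iff_bot, mem_nhdsWithin_iff_exists_mem_nhds_inter]
  exact ⟨_, hne, fun s hs => hs.1 (ne_of_gt hs.2.2) hs.2.1⟩

/-- If `m` were negative at the axis point, `ω` would increase near it as long as it is positive, so
the orbit could not come down to the axis by time `t₀`. -/
theorem m_eq_zero_of_pos_left (D : CycleData m M T y ω G) {t₀ : ℝ} (h0 : ω t₀ = 0)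
    (hm : m (y t₀, 0) ≤ 0) :
    ∃ ε > 0, ∀ s ∈ Ioo (t₀ - ε) t₀, 0 < ω s → m (y t₀, 0) = 0 := by
  rcases eq_or_lt_of_le hm with hm | hm
  · exact ⟨1, one_pos, fun _ _ _ => hm⟩
  have hc : Continuous fun t => m (y t, ω t) :=
    D.lipschitz_m.continuous.comp (D.continuous_y.prodMk D.continuous_ω)
  obtain ⟨ε, hε, hb⟩ := exists_forall_abs_sub_lt_pos hc.neg (t := t₀) (by simpa [h0] using hm)
  refine ⟨ε, hε, fun s hs hpos => ?_⟩
  obtain ⟨e, he, hωe, hp⟩ := exists_first_zero D.continuous_ω hs.2.le hpos h0.le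
  have hint : 0 < ∫ r in s..e, -G r := by
    refine intervalIntegral.intervalIntegral_pos_of_pos_on (D.intervalIntegrable s e).neg
      (fun r hr => ?_) he.1
    rw [D.G_pos r (hp r ⟨hr.1.le, hr.2⟩)]
    apply hb
    rw [abs_lt]
    constructor <;> linarith [hs.1, hr.1, hr.2, he.2]
  rw [intervalIntegral.integral_neg, ← D.ω_sub, hωe] at hint
  linarith

/-- A cycle meets the axis `ω = 0` only at points where both fields have the same sign. -/
theorem transversal (D : CycleData m M T y ω G) {t₀ : ℝ} (h0 : ω t₀ = 0) :
    0 < m (y t₀, 0) ∨ M (y t₀, 0) < 0 := by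
  -- Otherwise the axis point behaves like an equilibrium: each field that acts just before `t₀`
  -- vanishes at it. Backward uniqueness then makes the orbit rest there for a while, which a closed
  -- orbit without self-intersections cannot do.
  by_contra! hcon
  obtain ⟨hm, hM⟩ := hcon
  obtain ⟨ε₁, hε₁, hU⟩ := D.m_eq_zero_of_pos_left h0 hm
  obtain ⟨ε₂, hε₂, hL⟩ := D.reflect.m_eq_zero_of_pos_left (t₀ := t₀) (by simp [h0])
    (by simpa [_root_.reflect] using hM)
  obtain ⟨L₁, hL₁, hlip₁⟩ := D.lipschitz_m (|y t₀| + 1)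
  obtain ⟨L₂, hL₂, hlip₂⟩ := D.lipschitz_M (|y t₀| + 1)
  have hcc : Continuous fun t => (y t, ω t) := D.continuous_y.prodMk D.continuous_ω
  obtain ⟨ε₃, hε₃, hb⟩ := Metric.continuous_iff.1 hcc t₀ 1 one_pos
  have hT := D.period_pos
  -- The bound `1 / 2` makes the integral equation a contraction on `[t₀ - δ, t₀]`; `δ < T` leaves
  -- no room for a full period.
  obtain ⟨δ, hδ, h1, h2, h3, h4, h5⟩ : ∃ δ > 0, δ < ε₁ ∧ δ < ε₂ ∧ δ < ε₃ ∧ δ < T ∧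
      δ * (1 + L₁ + L₂) ≤ 1 / 2 := by
    have hq : 0 < 1 / (2 * (1 + L₁ + L₂)) := by positivity
    refine ⟨min (min (min ε₁ ε₂) (min ε₃ T) / 2) (1 / (2 * (1 + L₁ + L₂))), ?_, ?_, ?_, ?_, ?_, ?_⟩
    · positivity
    · have h1 := min_le_left (min (min ε₁ ε₂) (min ε₃ T) / 2) (1 / (2 * (1 + L₁ + L₂)))
      have h2 := min_le_left (min ε₁ ε₂) (min ε₃ T)
      have h3 := min_le_left ε₁ ε₂
      linarith
    · have h1 := min_le_left (min (min ε₁ ε₂) (min ε₃ T) / 2) (1 / (2 * (1 + L₁ + L₂)))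
      have h2 := min_le_left (min ε₁ ε₂) (min ε₃ T)
      have h3 := min_le_right ε₁ ε₂
      linarith
    · have h1 := min_le_left (min (min ε₁ ε₂) (min ε₃ T) / 2) (1 / (2 * (1 + L₁ + L₂)))
      have h2 := min_le_right (min ε₁ ε₂) (min ε₃ T)
      have h3 := min_le_left ε₃ T
      linarith
    · have h1 := min_le_left (min (min ε₁ ε₂) (min ε₃ T) / 2) (1 / (2 * (1 + L₁ + L₂)))
      have h2 := min_le_right (min ε₁ ε₂) (min ε₃ T)
      have h3 := min_le_right ε₃ T
      linarith
    · have h1 := min_le_right (min (min ε₁ ε₂) (min ε₃ T) / 2) (1 / (2 * (1 + L₁ + L₂)))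
      rw [le_div_iff₀ (by positivity)] at h1
      linarith
  have hr : Continuous fun s => ‖(y s, ω s) - (y t₀, 0)‖ := by fun_prop
  obtain ⟨σ, hσ, hmax⟩ := (isCompact_Icc (a := t₀ - δ) (b := t₀)).exists_isMaxOn
    ⟨t₀, by constructor <;> linarith⟩ hr.continuousOn
  set S := ‖(y σ, ω σ) - (y t₀, 0)‖ with hS
  have hle : ∀ s ∈ Icc (t₀ - δ) t₀, |y s - y t₀| ≤ S ∧ |ω s| ≤ S := by
    intro s hs
    have h := hmax hs
    simp only [mem_ofPred_eq, Prod.norm_def, Prod.fst_sub, Prod.snd_sub, sub_zero,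
      Real.norm_eq_abs, max_le_iff] at h
    have e : S = max |y σ - y t₀| |ω σ| := by simp [hS, Prod.norm_def]
    rw [e]
    exact h
  have hnorm : ∀ s ∈ Icc (t₀ - δ) t₀, ‖(y s, ω s)‖ ≤ |y t₀| + 1 := by
    intro s hs
    have h := hb s (by rw [Real.dist_eq, abs_lt]; constructor <;> linarith [hs.1, hs.2])
    rw [dist_eq_norm, h0] at h
    calc ‖(y s, ω s)‖ = ‖((y s, ω s) - (y t₀, 0)) + (y t₀, 0)‖ := by simp
      _ ≤ ‖(y s, ω s) - (y t₀, 0)‖ + ‖(y t₀, (0 : ℝ))‖ := norm_add_le _ _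
      _ ≤ 1 + |y t₀| := by
        gcongr
        simp [Prod.norm_def]
      _ = _ := add_comm _ _
  have hnorm0 : ‖(y t₀, (0 : ℝ))‖ ≤ |y t₀| + 1 := by
    simp [Prod.norm_def]
  have hsub : ∀ s ∈ Icc (t₀ - δ) t₀, ‖(y s, ω s) - (y t₀, 0)‖ ≤ S := fun s hs => hmax hs
  -- Off the axis the acting field vanishes at `(y t₀, 0)` and is Lipschitz; on the axis `G` is zero
  -- for almost every time.
  have hG : ∀ᵐ s, s ∈ Ioo (t₀ - δ) t₀ → |G s| ≤ (L₁ + L₂) * S := by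
    filter_upwards [D.ae_G_eq_zero] with s hs hmem
    have hmem' := Ioo_subset_Icc_self hmem
    have hS0 : 0 ≤ S := norm_nonneg _
    rcases lt_trichotomy (ω s) 0 with h | h | h
    · have hz : M (y t₀, 0) = 0 := by
        have := hL s ⟨by linarith [hmem.1], hmem.2⟩ (by simpa using h)
        simpa [_root_.reflect] using this
      rw [D.G_neg s h]
      have := hlip₂ (y s, ω s) (y t₀, 0) (hnorm s hmem') hnorm0
      rw [hz, sub_zero] at this
      nlinarith [hsub s hmem']
    · rw [hs h, abs_zero]; positivity
    · have hz : m (y t₀, 0) = 0 := hU s ⟨by linarith [hmem.1], hmem.2⟩ h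
      rw [D.G_pos s h]
      have := hlip₁ (y s, ω s) (y t₀, 0) (hnorm s hmem') hnorm0
      rw [hz, sub_zero] at this
      nlinarith [hsub s hmem']
  have hS0 : S = 0 := by
    have hSn : 0 ≤ S := norm_nonneg _
    have hωσ : |ω σ| ≤ (L₁ + L₂) * S * δ := by
      have h6 := intervalIntegral.norm_integral_le_of_norm_le_const_ae
        (f := G) (a := σ) (b := t₀) (C := (L₁ + L₂) * S) (by
          have hne : ∀ᵐ s : ℝ, s ≠ t₀ := by simp [ae_iff, measure_singleton]
          filter_upwards [hG, hne] with s hs hs' hmem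
          rw [uIoc_of_le hσ.2] at hmem
          exact hs ⟨hσ.1.trans_lt hmem.1, lt_of_le_of_ne hmem.2 hs'⟩)
      have h7 := D.ω_sub σ t₀
      rw [h0, zero_sub, neg_inj] at h7
      rw [← h7, Real.norm_eq_abs] at h6
      refine h6.trans ?_
      gcongr
      rw [abs_le]; constructor <;> linarith [hσ.1, hσ.2]
    have hyσ : |y σ - y t₀| ≤ S * δ := by
      have := (convex_Icc (t₀ - δ) t₀).norm_image_sub_le_of_norm_hasDerivWithin_le
        (f := y) (f' := ω) (C := S) (fun s _ => (D.hasDerivAt_y s).hasDerivWithinAt)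
        (fun s hs => (hle s hs).2) (right_mem_Icc.2 (by linarith)) hσ
      rw [Real.norm_eq_abs, Real.norm_eq_abs] at this
      refine this.trans ?_
      gcongr
      rw [abs_le]; constructor <;> linarith [hσ.1, hσ.2]
    have hSe : S = max |y σ - y t₀| |ω σ| := by simp [hS, Prod.norm_def]
    have : S ≤ δ * (1 + L₁ + L₂) * S := by
      rw [hSe] at hωσ hyσ ⊢
      rw [← hSe] at hωσ hyσ ⊢
      have p1 : 0 ≤ L₁ * (S * δ) := by positivity
      have p2 : 0 ≤ L₂ * (S * δ) := by positivity
      have p3 : 0 ≤ S * δ := by positivity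
      rw [hSe]
      rw [← hSe]
      calc S = max |y σ - y t₀| |ω σ| := hSe
        _ ≤ _ := max_le (by linarith) (by linarith)
    nlinarith
  -- The orbit is at the same point at times `t₀ - δ` and `t₀`, so `δ` would be a positive integer
  -- multiple of `T`.
  obtain ⟨hy', hω'⟩ := hle (t₀ - δ) (left_mem_Icc.2 (by linarith))
  rw [hS0] at hy' hω'
  obtain ⟨n, hn⟩ := D.inj (t₀ - δ) t₀ (by linarith [abs_nonpos_iff.1 hy'])
    (by rw [h0]; exact abs_nonpos_iff.1 hω')
  have hnT : (n : ℝ) * T = δ := by linarith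
  have hn0 : 0 < (n : ℝ) := by
    by_contra! h
    nlinarith
  have hn1 : (1 : ℝ) ≤ n := by exact_mod_cast (by exact_mod_cast hn0 : 0 < n)
  nlinarith

/-- At a zero of `ω` with `m > 0` the orbit goes down through the axis. -/
theorem crossing (D : CycleData m M T y ω G) {t₀ : ℝ} (h0 : ω t₀ = 0) (hm : 0 < m (y t₀, 0)) :
    ∃ ε > 0, (∀ t ∈ Ioo (t₀ - ε) t₀, 0 < ω t) ∧ ∀ t ∈ Ioo t₀ (t₀ + ε), ω t < 0 := by
  have hc : Continuous fun t => m (y t, ω t) :=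
    D.lipschitz_m.continuous.comp (D.continuous_y.prodMk D.continuous_ω)
  obtain ⟨ε, hε, hb⟩ := exists_forall_abs_sub_lt_pos hc (t := t₀) (by simpa [h0] using hm)
  refine ⟨ε, hε, fun t ht => ?_, fun t ht => ?_⟩
  · rw [← h0]
    refine D.ω_lt ht.2 fun r hr => lt_of_lt_of_le (hb r ?_) (D.le_G r)
    rw [abs_lt]
    constructor <;> linarith [hr.1, hr.2, ht.1, ht.2]
  · rw [← h0]
    refine D.ω_lt ht.1 fun r hr => lt_of_lt_of_le (hb r ?_) (D.le_G r)
    rw [abs_lt]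
    constructor <;> linarith [hr.1, hr.2, ht.1, ht.2]

theorem crossing_up (D : CycleData m M T y ω G) {t₀ : ℝ} (h0 : ω t₀ = 0) (hM : M (y t₀, 0) < 0) :
    ∃ ε > 0, (∀ t ∈ Ioo (t₀ - ε) t₀, ω t < 0) ∧ ∀ t ∈ Ioo t₀ (t₀ + ε), 0 < ω t := by
  obtain ⟨ε, hε, h1, h2⟩ := D.reflect.crossing (t₀ := t₀) (by simp [h0])
    (by simpa [_root_.reflect] using hM)
  exact ⟨ε, hε, fun t ht => by simpa using h1 t ht, fun t ht => by simpa using h2 t ht⟩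

theorem strictMonoOn (D : CycleData m M T y ω G) {s t : ℝ} (h : ∀ r ∈ Ioo s t, 0 < ω r) :
    StrictMonoOn y (Icc s t) := by
  refine strictMonoOn_of_hasDerivWithinAt_pos (convex_Icc _ _) D.continuous_y.continuousOn
    (fun t _ => (D.hasDerivAt_y t).hasDerivWithinAt) fun t ht => ?_
  rw [interior_Icc] at ht
  exact h t ht

/-- After an upward crossing of the axis the orbit returns to the axis. -/
theorem exists_next_zero (D : CycleData m M T y ω G) {t₀ : ℝ} (h0 : ω t₀ = 0)
    (hM : M (y t₀, 0) < 0) :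
    ∃ t₁ > t₀, ω t₁ = 0 ∧ (∀ t ∈ Ioo t₀ t₁, 0 < ω t) ∧ 0 < m (y t₁, 0) := by
  obtain ⟨ε, hε, -, hup⟩ := D.crossing_up h0 hM
  have hT := D.period_pos
  have hs : 0 < min ε T / 2 := by positivity
  have hs1 := min_le_left ε T
  have hs2 := min_le_right ε T
  set s := t₀ + min ε T / 2 with hsdef
  -- If `ω` stayed positive during a whole period, `y` would be strictly increasing, contrary to its
  -- periodicity.
  have hex : ∃ t ∈ Icc s (t₀ + T), ω t ≤ 0 := by
    by_contra! hcon
    have := D.strictMonoOn (s := t₀) (t := t₀ + T) fun r hr => by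
      rcases lt_or_ge r s with h | h
      · exact hup r ⟨hr.1, by linarith⟩
      · exact hcon r ⟨h, hr.2.le⟩
    have h := this (left_mem_Icc.2 (by linarith)) (right_mem_Icc.2 (by linarith)) (by linarith)
    rw [D.periodic_y] at h
    exact lt_irrefl _ h
  obtain ⟨t, ht, hωt⟩ := hex
  obtain ⟨e, he, hωe, hp⟩ := exists_first_zero D.continuous_ω ht.1
    (hup s ⟨by linarith, by linarith⟩) hωt
  have hpos : ∀ t ∈ Ioo t₀ e, 0 < ω t := by
    intro r hr
    rcases lt_or_ge r s with h | h
    · exact hup r ⟨hr.1, by linarith⟩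
    · exact hp r ⟨h, hr.2⟩
  have ht0e : t₀ < e := by linarith [he.1]
  -- An upward crossing at `e` is excluded because the orbit arrives from above.
  refine ⟨e, ht0e, hωe, hpos, (D.transversal hωe).resolve_right fun hneg => ?_⟩
  obtain ⟨ε', hε', h1, -⟩ := D.crossing_up hωe hneg
  have hmax1 := le_max_left t₀ (e - ε')
  have hmax2 := le_max_right t₀ (e - ε')
  have hmax3 : max t₀ (e - ε') < e := max_lt ht0e (by linarith)
  have h2 := h1 ((max t₀ (e - ε') + e) / 2) ⟨by linarith, by linarith⟩
  have h3 := hpos ((max t₀ (e - ε') + e) / 2) ⟨by linarith, by linarith⟩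
  linarith

/-- An excursion that starts below an upper arc ends below it. -/
theorem lt_of_excursion (D : CycleData m M T y ω G) {a b : ℝ} {e : ℝ → ℝ} (A : UpperArc m a b e)
    {z s : ℝ} (hzs : z < s) (hz : ω z = 0) (hpos : ∀ t ∈ Ioo z s, 0 < ω t)
    (hyz : y z ∈ Ioo a b) : y z < y s ∧ y s < b := by
  have hmono := D.strictMonoOn hpos
  refine ⟨hmono (left_mem_Icc.2 hzs.le) (right_mem_Icc.2 hzs.le) hzs, ?_⟩
  -- On reaching `b` the orbit would still be strictly below the arc, whose energy at `b` is zero.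
  by_contra! hcon
  obtain ⟨σ, hσ, hyσ⟩ := intermediate_value_Icc hzs.le D.continuous_y.continuousOn
    ⟨hyz.2.le, hcon⟩
  have hzσ : z < σ := by
    rcases eq_or_lt_of_le hσ.1 with h | h
    · rw [h, hyσ] at hyz; exact (lt_irrefl _ hyz.2).elim
    · exact h
  have := A.lt_of_lt D.lipschitz_m (F := fun t => m (y t, ω t)) hzσ D.continuous_y.continuousOn
    D.continuous_ω.continuousOn (fun t _ => D.hasDerivAt_y t)
    (fun t ht => D.hasDerivAt_ω (hpos t ⟨ht.1, ht.2.trans_le hσ.2⟩)) (fun t _ => le_rfl)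
    (fun t ht => (hpos t ⟨ht.1, ht.2.trans_le hσ.2⟩).le)
    (fun t ht => ⟨hyz.1.trans (hmono (left_mem_Icc.2 hzs.le) ⟨ht.1.le, ht.2.le.trans hσ.2⟩ ht.1),
      hyσ ▸ hmono ⟨ht.1.le, ht.2.le.trans hσ.2⟩ hσ ht.2⟩)
    (by rw [hz]; simpa using A.pos _ hyz)
  rw [hyσ, A.right] at this
  nlinarith [sq_nonneg (ω σ)]

end CycleData

end Cycles

/-! ### Every cycle is an oval: one upper and one lower arc. -/

section Ovals

/-- A closed curve which consists of an upper arc of the field `m` and a lower arc of the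
field `M`, over the same interval `[a, b]`. -/
structure Oval (m M : ℝ × ℝ → ℝ) (a b : ℝ) (eu el : ℝ → ℝ) (C : Set (ℝ × ℝ)) : Prop where
  upper : UpperArc m a b eu
  lower : UpperArc (reflect M) (-b) (-a) (fun y => el (-y))
  right_pos : 0 < m (b, 0)
  left_neg : M (a, 0) < 0
  mem_iff : ∀ p : ℝ × ℝ, p ∈ C ↔
    p.1 ∈ Icc a b ∧ (0 ≤ p.2 ∧ p.2 ^ 2 / 2 = eu p.1 ∨ p.2 ≤ 0 ∧ p.2 ^ 2 / 2 = el p.1)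

namespace CycleData

open MeasureTheory

variable {m M : ℝ × ℝ → ℝ} {T : ℝ} {y ω G : ℝ → ℝ}

theorem exists_arc (D : CycleData m M T y ω G) {t₀ t₁ : ℝ} (h : t₀ < t₁) (h0 : ω t₀ = 0)
    (h1 : ω t₁ = 0) (hpos : ∀ t ∈ Ioo t₀ t₁, 0 < ω t) :
    ∃ e : ℝ → ℝ, UpperArc m (y t₀) (y t₁) e ∧ ∀ t ∈ Icc t₀ t₁, ω t ^ 2 / 2 = e (y t) :=
  exists_upperArc h D.continuous_ω D.hasDerivAt_y h0 h1 hpos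
    fun t ht => D.hasDerivAt_ω (hpos t ht)

/-- A leftmost point of a cycle is an upward crossing of the axis. -/
theorem exists_leftmost (D : CycleData m M T y ω G) :
    ∃ t₀, ω t₀ = 0 ∧ M (y t₀, 0) < 0 ∧ ∀ t, y t₀ ≤ y t := by
  obtain ⟨t₀, -, hmin⟩ := (isCompact_Icc (a := (0 : ℝ)) (b := T)).exists_isMinOn
    ⟨0, left_mem_Icc.2 D.period_pos.le⟩ D.continuous_y.continuousOn
  have hmin' : ∀ t, y t₀ ≤ y t := by
    intro t
    obtain ⟨s, hs, hts⟩ := D.periodic_y.exists_mem_Ico₀ D.period_pos t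
    rw [hts]
    exact hmin (Ico_subset_Icc_self hs)
  have h0 : ω t₀ = 0 :=
    IsLocalMin.hasDerivAt_eq_zero (Eventually.of_forall hmin') (D.hasDerivAt_y t₀)
  -- Before a downward crossing the orbit is in the upper half-plane, where `y` increases; so
  -- earlier points would lie further left.
  refine ⟨t₀, h0, (D.transversal h0).resolve_left fun hpos => ?_, hmin'⟩
  obtain ⟨ε, hε, h1, -⟩ := D.crossing h0 hpos
  have := D.strictMonoOn (s := t₀ - ε) (t := t₀) h1 (left_mem_Icc.2 (by linarith))
    (right_mem_Icc.2 (by linarith)) (by linarith)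
  exact absurd (hmin' (t₀ - ε)) (not_le.2 this)

/-- Once the orbit has entered the inner side of the first turn, it never leaves it. -/
theorem trapped (D : CycleData m M T y ω G) {a a₁ b t₂ : ℝ} {e e' : ℝ → ℝ}
    (A : UpperArc m a b e) (B : UpperArc (_root_.reflect M) (-b) (-a₁) e') (ha : a < a₁)
    (hM : M (a₁, 0) < 0) (h2 : ω t₂ = 0) (hy2 : y t₂ = a₁) {t : ℝ} (ht : t₂ ≤ t)
    (hωt : ω t = 0) : a₁ ≤ y t := by
  have hab : a₁ < b := by linarith [B.lt]
  by_contra! hcon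
  -- `Q` is the set of later axis times outside `[a₁, b)`. Axis times are isolated, so `Q` has a
  -- first element `s`, preceded by a last axis time `z` with `y z` in `[a₁, b)`. Exactly one
  -- excursion joins them, and the arcs `A` and `B` confine it to `[a₁, b)`.
  set Q : Set ℝ := {t | t₂ ≤ t ∧ ω t = 0 ∧ ¬(a₁ ≤ y t ∧ y t < b)} with hQ
  have hQne : Q.Nonempty := ⟨t, ht, hωt, fun h => absurd h.1 (not_le.2 hcon)⟩
  have hQb : BddBelow Q := ⟨t₂, fun s hs => hs.1⟩
  set s := sInf Q with hs
  have hs2 : t₂ ≤ s := le_csInf hQne fun r hr => hr.1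
  have hscl : s ∈ closure Q := csInf_mem_closure hQne hQb
  have hωs : ω s = 0 := by
    have : Q ⊆ {t | ω t = 0} := fun r hr => hr.2.1
    exact closure_minimal this (isClosed_eq D.continuous_ω continuous_const) hscl
  obtain ⟨ε, hε, hne1, hne2⟩ : ∃ ε > 0, (∀ r ∈ Ioo (s - ε) s, ω r ≠ 0) ∧
      ∀ r ∈ Ioo s (s + ε), ω r ≠ 0 := by
    rcases D.transversal hωs with h | h
    · obtain ⟨ε, hε, h1, h2⟩ := D.crossing hωs h
      exact ⟨ε, hε, fun r hr => (h1 r hr).ne', fun r hr => (h2 r hr).ne⟩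
    · obtain ⟨ε, hε, h1, h2⟩ := D.crossing_up hωs h
      exact ⟨ε, hε, fun r hr => (h1 r hr).ne, fun r hr => (h2 r hr).ne'⟩
  have hsQ : s ∈ Q := by
    obtain ⟨r, hr, hrs⟩ := Metric.mem_closure_iff.1 hscl ε hε
    have hle : s ≤ r := csInf_le hQb hr
    rcases eq_or_lt_of_le hle with h | h
    · rw [h]; exact hr
    · rw [Real.dist_eq, abs_lt] at hrs
      exact absurd hr.2.1 (hne2 r ⟨h, by linarith [hrs.1]⟩)
  have hs2' : t₂ < s := by
    refine lt_of_le_of_ne hs2 fun h => hsQ.2.2 ?_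
    rw [← h, hy2]
    exact ⟨le_rfl, hab⟩
  have hcl : IsCompact (Icc t₂ (s - ε / 2) ∩ {r | ω r = 0}) :=
    isCompact_Icc.inter_right (isClosed_eq D.continuous_ω continuous_const)
  have ht2mem : t₂ ≤ s - ε / 2 := by
    by_contra! h
    exact hne1 t₂ ⟨by linarith, hs2'⟩ h2
  obtain ⟨z, ⟨hz, hωz⟩, hmax⟩ := hcl.exists_isGreatest ⟨t₂, left_mem_Icc.2 ht2mem, h2⟩
  have hzs : z < s := by linarith [hz.2]
  have hnz : ∀ r ∈ Ioo z s, ω r ≠ 0 := by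
    intro r hr h0
    rcases le_or_gt r (s - ε / 2) with h | h
    · exact absurd (hmax ⟨⟨hz.1.trans hr.1.le, h⟩, h0⟩) (not_le.2 hr.1)
    · exact hne1 r ⟨by linarith, hr.2⟩ h0
  have hyz : a₁ ≤ y z ∧ y z < b := by
    by_contra h
    exact absurd (csInf_le hQb (⟨hz.1, hωz, h⟩ : z ∈ Q)) (not_le.2 hzs)
  rcases D.transversal hωz with h | h
  -- The start of a downward excursion has to be strictly inside the lower arc; at `a₁` itself the
  -- orbit can only go up.
  · have hne : a₁ ≠ y z := by
      intro h'
      rw [← h'] at h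
      linarith [D.le (a₁, 0)]
    obtain ⟨r, hzr, hωr, hp, -⟩ := D.reflect.exists_next_zero (t₀ := z) (by simpa using hωz)
      (by simpa [_root_.reflect] using h)
    have hrs : r = s := by
      rcases lt_trichotomy r s with h' | h' | h'
      · exact absurd (by simpa using hωr) (hnz r ⟨hzr, h'⟩)
      · exact h'
      · have := hp s ⟨hzs, h'⟩
        simp [hωs] at this
    subst hrs
    have := D.reflect.lt_of_excursion B hzr (by simpa using hωz) hp
      ⟨neg_lt_neg hyz.2, neg_lt_neg (lt_of_le_of_ne hyz.1 hne)⟩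
    simp only [Pi.neg_apply, neg_lt_neg_iff] at this
    exact hsQ.2.2 ⟨this.2.le, this.1.trans hyz.2⟩
  · obtain ⟨r, hzr, hωr, hp, -⟩ := D.exists_next_zero hωz h
    have hrs : r = s := by
      rcases lt_trichotomy r s with h' | h' | h'
      · exact absurd hωr (hnz r ⟨hzr, h'⟩)
      · exact h'
      · have := hp s ⟨hzs, h'⟩
        simp [hωs] at this
    subst hrs
    have := D.lt_of_excursion A hzr hωz hp ⟨ha.trans_le hyz.1, hyz.2⟩
    exact hsQ.2.2 ⟨hyz.1.trans this.1.le, this.2⟩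

/-- A cycle consists of one upper and one lower arc. -/
theorem exists_oval (D : CycleData m M T y ω G) :
    ∃ (a b : ℝ) (eu el : ℝ → ℝ), Oval m M a b eu el (range fun t => (y t, ω t)) := by
  obtain ⟨t₀, h0, hM0, hmin⟩ := D.exists_leftmost
  obtain ⟨t₁, h01, h1, hp1, hm1⟩ := D.exists_next_zero h0 hM0
  obtain ⟨t₂, h12, h2, hp2, hM2⟩ := D.reflect.exists_next_zero (t₀ := t₁) (by simpa using h1)
    (by simpa [_root_.reflect] using hm1)
  replace h2 : ω t₂ = 0 := by simpa using h2
  replace hp2 : ∀ t ∈ Ioo t₁ t₂, ω t < 0 := fun t ht => by simpa using hp2 t ht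
  replace hM2 : M (y t₂, 0) < 0 := by simpa [_root_.reflect] using hM2
  obtain ⟨eu, A, hA⟩ := D.exists_arc h01 h0 h1 hp1
  obtain ⟨e', B, hB⟩ := D.reflect.exists_arc h12 (by simpa using h1) (by simpa using h2)
    (fun t ht => by simpa using hp2 t ht)
  simp only [Pi.neg_apply] at B hB
  -- If the first turn ended to the right of its start, `trapped` would keep the orbit from
  -- returning to `y t₀` at the times `t₀ + n T`.
  have hclose : y t₂ = y t₀ := by
    by_contra hne
    have hlt : y t₀ < y t₂ := lt_of_le_of_ne (hmin t₂) (Ne.symm hne)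
    obtain ⟨n, hn⟩ := exists_nat_gt ((t₂ - t₀) / T)
    rw [div_lt_iff₀ D.period_pos] at hn
    have hy : y (t₀ + n * T) = y t₀ := D.periodic_y.nat_mul n t₀
    have hω : ω (t₀ + n * T) = ω t₀ := D.periodic_ω.nat_mul n t₀
    have := D.trapped A B hlt hM2 h2 rfl (t := t₀ + n * T) (by linarith) (by rw [hω, h0])
    rw [hy] at this
    exact absurd this (not_le.2 hlt)
  obtain ⟨n, hn⟩ := D.inj t₀ t₂ hclose.symm (by rw [h0, h2])
  have hnT : 0 < (n : ℝ) * T := by linarith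
  have hper : Function.Periodic (fun t => (y t, ω t)) (n * T) := fun t => by
    simp only [D.periodic_y.int_mul n t, D.periodic_ω.int_mul n t]
  have hrange : (range fun t => (y t, ω t)) = (fun t => (y t, ω t)) '' Icc t₀ t₂ := by
    rw [hn, hper.image_Icc hnT]
  refine ⟨y t₀, y t₁, eu, fun v => e' (-v), A, ?_, hm1, by rwa [← hclose], ?_⟩
  · simp only [neg_neg]
    rwa [← hclose]
  have hmono1 := (D.strictMonoOn hp1).monotoneOn
  have hmono2 := (D.reflect.strictMonoOn (s := t₁) (t := t₂)
    fun t ht => by simpa using hp2 t ht).monotoneOn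
  have hω1 : ∀ t ∈ Icc t₀ t₁, 0 ≤ ω t := by
    intro t ht
    rcases eq_or_lt_of_le ht.1 with h | h
    · rw [← h, h0]
    rcases eq_or_lt_of_le ht.2 with h' | h'
    · rw [h', h1]
    exact (hp1 t ⟨h, h'⟩).le
  have hω2 : ∀ t ∈ Icc t₁ t₂, ω t ≤ 0 := by
    intro t ht
    rcases eq_or_lt_of_le ht.1 with h | h
    · rw [← h, h1]
    rcases eq_or_lt_of_le ht.2 with h' | h'
    · rw [h', h2]
    exact (hp2 t ⟨h, h'⟩).le
  rintro ⟨v, w⟩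
  rw [hrange]
  constructor
  · rintro ⟨t, ht, hvw⟩
    simp only [Prod.mk.injEq] at hvw
    obtain ⟨rfl, rfl⟩ := hvw
    rcases le_total t t₁ with h | h
    · refine ⟨⟨hmin t, hmono1 ⟨ht.1, h⟩ (right_mem_Icc.2 h01.le) h⟩,
        Or.inl ⟨hω1 t ⟨ht.1, h⟩, hA t ⟨ht.1, h⟩⟩⟩
    · have h3 := hmono2 (left_mem_Icc.2 h12.le) ⟨h, ht.2⟩ h
      simp only [Pi.neg_apply, neg_le_neg_iff] at h3
      refine ⟨⟨hmin t, h3⟩, Or.inr ⟨hω2 t ⟨h, ht.2⟩, ?_⟩⟩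
      have := hB t ⟨h, ht.2⟩
      simpa using this
  · rintro ⟨hv, ⟨hw, he⟩ | ⟨hw, he⟩⟩ <;> simp only at hv hw he
    · obtain ⟨t, ht, rfl⟩ := intermediate_value_Icc h01.le D.continuous_y.continuousOn hv
      refine ⟨t, ⟨ht.1, ht.2.trans h12.le⟩, ?_⟩
      have h3 := hA t ht
      rw [Prod.mk.injEq]
      refine ⟨rfl, ?_⟩
      have : ω t ^ 2 = w ^ 2 := by linarith
      exact (sq_eq_sq₀ (hω1 t ht) hw).1 this
    · obtain ⟨t, ht, rfl⟩ := intermediate_value_Icc' h12.le D.continuous_y.continuousOn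
        (by rwa [hclose])
      refine ⟨t, ⟨h01.le.trans ht.1, ht.2⟩, ?_⟩
      have h3 := hB t ht
      rw [Prod.mk.injEq]
      refine ⟨rfl, ?_⟩
      have : (-ω t) ^ 2 = (-w) ^ 2 := by simp only [neg_sq] at h3 ⊢; linarith
      have := (sq_eq_sq₀ (by simpa using hω2 t ht) (by simpa using hw)).1 this
      linarith

end CycleData

end Ovals

/-! ### The differential inclusion generated by all admissible inputs. -/

section Trajectories

/-- A solution of the differential inclusion `y' = ω`, `-ω' ∈ [m (y, ω), M (y, ω)]`. -/
structure IsTrajectory (m M : ℝ × ℝ → ℝ) (s t : ℝ) (Y W F : ℝ → ℝ) : Prop where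
  contY : ContinuousOn Y (Icc s t)
  contW : ContinuousOn W (Icc s t)
  derivY : ∀ r ∈ Ioo s t, HasDerivAt Y (W r) r
  derivW : ∀ r ∈ Ioo s t, HasDerivAt W (-F r) r
  le_F : ∀ r ∈ Ioo s t, m (Y r, W r) ≤ F r
  F_le : ∀ r ∈ Ioo s t, F r ≤ M (Y r, W r)

variable {m M : ℝ × ℝ → ℝ} {s t : ℝ} {Y W F : ℝ → ℝ}

theorem IsTrajectory.reflect (h : IsTrajectory m M s t Y W F) :
    IsTrajectory (reflect M) (reflect m) s t (-Y) (-W) (-F) where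
  contY := h.contY.neg
  contW := h.contW.neg
  derivY r hr := (h.derivY r hr).neg
  derivW r hr := (h.derivW r hr).neg
  le_F r hr := by simpa [_root_.reflect] using h.F_le r hr
  F_le r hr := by simpa [_root_.reflect] using h.le_F r hr

theorem IsTrajectory.mono (h : IsTrajectory m M s t Y W F) {s' t' : ℝ} (hs : s ≤ s')
    (ht : t' ≤ t) : IsTrajectory m M s' t' Y W F where
  contY := h.contY.mono (Icc_subset_Icc hs ht)
  contW := h.contW.mono (Icc_subset_Icc hs ht)
  derivY r hr := h.derivY r (Ioo_subset_Ioo hs ht hr)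
  derivW r hr := h.derivW r (Ioo_subset_Ioo hs ht hr)
  le_F r hr := h.le_F r (Ioo_subset_Ioo hs ht hr)
  F_le r hr := h.F_le r (Ioo_subset_Ioo hs ht hr)

end Trajectories

/-! ### Vertical hulls, which stand for the regions bounded by the cycles. -/

section Hull

/-- The vertical hull of a set in the plane. -/
def verticalHull (C : Set (ℝ × ℝ)) : Set (ℝ × ℝ) :=
  {p | (∃ w, w ≤ p.2 ∧ (p.1, w) ∈ C) ∧ ∃ w, p.2 ≤ w ∧ (p.1, w) ∈ C}

theorem subset_verticalHull (C : Set (ℝ × ℝ)) : C ⊆ verticalHull C :=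
  fun p hp => ⟨⟨p.2, le_rfl, hp⟩, ⟨p.2, le_rfl, hp⟩⟩

theorem verticalHull_mono {C C' : Set (ℝ × ℝ)} (h : C ⊆ verticalHull C') :
    verticalHull C ⊆ verticalHull C' := by
  rintro p ⟨⟨w, hw, hC⟩, ⟨w', hw', hC'⟩⟩
  obtain ⟨⟨u, hu, huC⟩, -⟩ := h hC
  obtain ⟨-, ⟨u', hu', huC'⟩⟩ := h hC'
  exact ⟨⟨u, hu.trans hw, huC⟩, ⟨u', hw'.trans hu', huC'⟩⟩

end Hull

/-! ### Geometry of the hull of an oval. -/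

namespace Oval

variable {m M : ℝ × ℝ → ℝ} {a b : ℝ} {eu el : ℝ → ℝ} {C : Set (ℝ × ℝ)}

theorem reflect (O : Oval m M a b eu el C) :
    Oval (reflect M) (reflect m) (-b) (-a) (fun y => el (-y)) (fun y => eu (-y)) {p | -p ∈ C} where
  upper := O.lower
  lower := by simpa using O.upper
  right_pos := by simpa [_root_.reflect] using O.left_neg
  left_neg := by simpa [_root_.reflect] using O.right_pos
  mem_iff p := by
    rw [mem_ofPred_eq, O.mem_iff]
    simp only [Prod.fst_neg, Prod.snd_neg, mem_Icc, neg_sq, Left.nonneg_neg_iff,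
      Left.neg_nonpos_iff]
    rw [le_neg, neg_le, or_comm]
    tauto

theorem el_nonneg (O : Oval m M a b eu el C) {y : ℝ} (hy : y ∈ Icc a b) : 0 ≤ el y := by
  have := O.lower.nonneg (y := -y) ⟨neg_le_neg hy.2, neg_le_neg hy.1⟩
  simpa using this

theorem el_pos (O : Oval m M a b eu el C) {y : ℝ} (hy : y ∈ Ioo a b) : 0 < el y := by
  have := O.lower.pos (-y) ⟨neg_lt_neg hy.2, neg_lt_neg hy.1⟩
  simpa using this

theorem el_left (O : Oval m M a b eu el C) : el a = 0 := by simpa using O.lower.right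

theorem el_right (O : Oval m M a b eu el C) : el b = 0 := by simpa using O.lower.left

theorem el_cont (O : Oval m M a b eu el C) : ContinuousOn el (Icc a b) := by
  have := O.lower.cont.comp (s := Icc a b) (f := fun y => -y) continuousOn_neg
    fun y hy => ⟨neg_le_neg hy.2, neg_le_neg hy.1⟩
  simpa [Function.comp_def] using this

theorem left_mem (O : Oval m M a b eu el C) : (a, (0 : ℝ)) ∈ C :=
  (O.mem_iff _).2 ⟨left_mem_Icc.2 O.upper.lt.le, Or.inl ⟨le_rfl, by simp [O.upper.left]⟩⟩

theorem right_mem (O : Oval m M a b eu el C) : (b, (0 : ℝ)) ∈ C :=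
  (O.mem_iff _).2 ⟨right_mem_Icc.2 O.upper.lt.le, Or.inl ⟨le_rfl, by simp [O.upper.right]⟩⟩

theorem upper_mem (O : Oval m M a b eu el C) {y : ℝ} (hy : y ∈ Icc a b) :
    (y, √(2 * eu y)) ∈ C := by
  refine (O.mem_iff _).2 ⟨hy, Or.inl ⟨Real.sqrt_nonneg _, ?_⟩⟩
  have := O.upper.nonneg hy
  rw [Real.sq_sqrt (by linarith)]; ring

theorem lower_mem (O : Oval m M a b eu el C) {y : ℝ} (hy : y ∈ Icc a b) :
    (y, -√(2 * el y)) ∈ C := by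
  refine (O.mem_iff _).2 ⟨hy, Or.inr ⟨neg_nonpos.2 (Real.sqrt_nonneg _), ?_⟩⟩
  have := O.el_nonneg hy
  rw [neg_sq, Real.sq_sqrt (by linarith)]; ring

/-- In energy form, membership is a pair of inequalities of the kind that the comparison with arcs
preserves. On the axis both are automatic. -/
theorem mem_hull_iff (O : Oval m M a b eu el C) (p : ℝ × ℝ) :
    p ∈ verticalHull C ↔ p.1 ∈ Icc a b ∧ (0 ≤ p.2 → p.2 ^ 2 / 2 ≤ eu p.1) ∧
      (p.2 ≤ 0 → p.2 ^ 2 / 2 ≤ el p.1) := by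
  obtain ⟨y, ω⟩ := p
  simp only [verticalHull, mem_ofPred_eq]
  constructor
  · rintro ⟨⟨w, hw, hC⟩, ⟨w', hw', hC'⟩⟩
    rw [O.mem_iff] at hC hC'
    simp only at hC hC'
    have h1 := O.upper.nonneg hC.1
    have h2 := O.el_nonneg hC.1
    refine ⟨hC.1, fun h => ?_, fun h => ?_⟩
    · rcases hC'.2 with ⟨h3, h4⟩ | ⟨h3, h4⟩
      · nlinarith
      · have : ω = 0 := by linarith
        rw [this]; simpa using h1
    · rcases hC.2 with ⟨h3, h4⟩ | ⟨h3, h4⟩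
      · have : ω = 0 := by linarith
        rw [this]; simpa using h2
      · nlinarith
  · rintro ⟨hy, hu, hl⟩
    have h1 := O.upper.nonneg hy
    have h2 := O.el_nonneg hy
    refine ⟨⟨-√(2 * el y), ?_, O.lower_mem hy⟩, ⟨√(2 * eu y), ?_, O.upper_mem hy⟩⟩
    · rcases le_total ω 0 with h | h
      · have : -ω ≤ √(2 * el y) := Real.le_sqrt_of_sq_le (by have := hl h; nlinarith)
        linarith
      · linarith [Real.sqrt_nonneg (2 * el y)]
    · rcases le_total 0 ω with h | h
      · exact Real.le_sqrt_of_sq_le (by have := hu h; nlinarith)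
      · linarith [Real.sqrt_nonneg (2 * eu y)]

theorem mem_hull_reflect (p : ℝ × ℝ) :
    p ∈ verticalHull {p | -p ∈ C} ↔ -p ∈ verticalHull C := by
  simp only [verticalHull, mem_ofPred_eq, Prod.fst_neg, Prod.snd_neg, Prod.neg_mk]
  constructor
  · rintro ⟨⟨w, hw, h⟩, ⟨w', hw', h'⟩⟩
    exact ⟨⟨-w', by linarith, h'⟩, ⟨-w, by linarith, h⟩⟩
  · rintro ⟨⟨w, hw, h⟩, ⟨w', hw', h'⟩⟩
    exact ⟨⟨-w', by linarith, by simpa using h'⟩, ⟨-w, by linarith, by simpa using h⟩⟩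

theorem isCompact (O : Oval m M a b eu el C) : IsCompact C := by
  have h : C = (fun y => (y, √(2 * eu y))) '' Icc a b ∪
      (fun y => (y, -√(2 * el y))) '' Icc a b := by
    ext ⟨y, w⟩
    rw [O.mem_iff]
    simp only [mem_union, mem_image, Prod.mk.injEq]
    constructor
    · rintro ⟨hy, ⟨h, h'⟩ | ⟨h, h'⟩⟩
      · exact Or.inl ⟨y, hy, rfl, by rw [← h', mul_div_cancel₀ _ two_ne_zero, Real.sqrt_sq h]⟩
      · refine Or.inr ⟨y, hy, rfl, ?_⟩
        rw [← h', mul_div_cancel₀ _ two_ne_zero, Real.sqrt_sq_eq_abs, abs_of_nonpos h, neg_neg]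
    · rintro (⟨v, hv, rfl, rfl⟩ | ⟨v, hv, rfl, rfl⟩)
      · exact (O.mem_iff _).1 (O.upper_mem hv)
      · exact (O.mem_iff _).1 (O.lower_mem hv)
  rw [h]
  have h1 := O.upper.cont
  have h2 := O.el_cont
  exact (isCompact_Icc.image_of_continuousOn (by fun_prop)).union
    (isCompact_Icc.image_of_continuousOn (by fun_prop))

theorem isClosed_hull (O : Oval m M a b eu el C) : IsClosed (verticalHull C) := by
  have h : verticalHull C = {p | p.1 ∈ Icc a b ∧ p.2 ∈ Iic (√(2 * eu p.1)) } ∩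
      {p | p.1 ∈ Icc a b ∧ p.2 ∈ Ici (-√(2 * el p.1))} := by
    ext ⟨y, w⟩
    constructor
    · intro hp
      obtain ⟨hy, hu, hl⟩ := (O.mem_hull_iff _).1 hp
      simp only at hy hu hl
      have h1 := O.upper.nonneg hy
      have h2 := O.el_nonneg hy
      refine ⟨⟨hy, ?_⟩, ⟨hy, ?_⟩⟩
      · rcases le_total 0 w with h | h
        · exact Real.le_sqrt_of_sq_le (by have := hu h; linarith)
        · exact h.trans (Real.sqrt_nonneg _)
      · rcases le_total w 0 with h | h
        · have : -w ≤ √(2 * el y) := Real.le_sqrt_of_sq_le (by have := hl h; linarith [neg_sq w])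
          simp only [mem_Ici]; linarith
        · exact (neg_nonpos.2 (Real.sqrt_nonneg _)).trans h
    · rintro ⟨⟨hy, h1⟩, ⟨-, h2⟩⟩
      exact ⟨⟨_, h2, O.lower_mem hy⟩, ⟨_, h1, O.upper_mem hy⟩⟩
  have hs : IsClosed {p : ℝ × ℝ | p.1 ∈ Icc a b} := isClosed_Icc.preimage continuous_fst
  have hmaps : MapsTo Prod.fst {p : ℝ × ℝ | p.1 ∈ Icc a b} (Icc a b) := fun p hp => hp
  have h1 : ContinuousOn (fun p : ℝ × ℝ => eu p.1) {p : ℝ × ℝ | p.1 ∈ Icc a b} :=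
    O.upper.cont.comp continuousOn_fst hmaps
  have h2 : ContinuousOn (fun p : ℝ × ℝ => el p.1) {p : ℝ × ℝ | p.1 ∈ Icc a b} :=
    O.el_cont.comp continuousOn_fst hmaps
  rw [h]
  refine IsClosed.inter ?_ ?_
  · have := ContinuousOn.preimage_isClosed_of_isClosed
      (f := fun p : ℝ × ℝ => √(2 * eu p.1) - p.2)
      ((continuousOn_const.mul h1).sqrt.sub continuousOn_snd) hs (isClosed_Ici (a := (0 : ℝ)))
    convert this using 1
    ext p; simp
  · have := ContinuousOn.preimage_isClosed_of_isClosed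
      (f := fun p : ℝ × ℝ => √(2 * el p.1) + p.2)
      ((continuousOn_const.mul h2).sqrt.add continuousOn_snd) hs (isClosed_Ici (a := (0 : ℝ)))
    convert this using 1
    ext p; simp [neg_le_iff_add_nonneg']

/-- The points of the hull that are not on the curve are interior. -/
theorem hull_mem_nhds (O : Oval m M a b eu el C) {p : ℝ × ℝ} (hp : p ∈ verticalHull C)
    (hpC : p ∉ C) : verticalHull C ∈ 𝓝 p := by
  obtain ⟨y, ω⟩ := p
  obtain ⟨hy, hu, hl⟩ := (O.mem_hull_iff _).1 hp
  simp only at hy hu hl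
  have hu' : 0 ≤ ω → ω ^ 2 / 2 < eu y := fun h =>
    lt_of_le_of_ne (hu h) fun h' => hpC ((O.mem_iff _).2 ⟨hy, Or.inl ⟨h, h'⟩⟩)
  have hl' : ω ≤ 0 → ω ^ 2 / 2 < el y := fun h =>
    lt_of_le_of_ne (hl h) fun h' => hpC ((O.mem_iff _).2 ⟨hy, Or.inr ⟨h, h'⟩⟩)
  have hya : y ≠ a := by
    rintro rfl
    rw [O.upper.left] at hu'; rw [O.el_left] at hl'
    rcases le_total 0 ω with h | h
    · nlinarith [hu' h, sq_nonneg ω]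
    · nlinarith [hl' h, sq_nonneg ω]
  have hyb : y ≠ b := by
    rintro rfl
    rw [O.upper.right] at hu'; rw [O.el_right] at hl'
    rcases le_total 0 ω with h | h
    · nlinarith [hu' h, sq_nonneg ω]
    · nlinarith [hl' h, sq_nonneg ω]
  have hn : Icc a b ∈ 𝓝 y := Icc_mem_nhds (lt_of_le_of_ne hy.1 hya.symm) (lt_of_le_of_ne hy.2 hyb)
  have hfst : Tendsto Prod.fst (𝓝 (y, ω)) (𝓝 y) := continuous_fst.tendsto _
  have hcu : ContinuousAt (fun p : ℝ × ℝ => eu p.1) (y, ω) :=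
    ContinuousAt.comp' (f := Prod.fst) (O.upper.cont.continuousAt hn) continuousAt_fst
  have hcl : ContinuousAt (fun p : ℝ × ℝ => el p.1) (y, ω) :=
    ContinuousAt.comp' (f := Prod.fst) (O.el_cont.continuousAt hn) continuousAt_fst
  have hsq : ContinuousAt (fun p : ℝ × ℝ => p.2 ^ 2 / 2) (y, ω) := by fun_prop
  have h2 : ∀ᶠ p : ℝ × ℝ in 𝓝 (y, ω), 0 ≤ p.2 → p.2 ^ 2 / 2 ≤ eu p.1 := by
    rcases le_or_gt 0 ω with h | h
    · filter_upwards [hsq.eventually_lt hcu (hu' h)] with p hp _ using hp.le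
    · filter_upwards [continuousAt_snd.eventually_lt (continuousAt_const (y := (0 : ℝ)))
        (h : (y, ω).2 < 0)] with p hp h'
      exact absurd h' (not_le.2 hp)
  have h3 : ∀ᶠ p : ℝ × ℝ in 𝓝 (y, ω), p.2 ≤ 0 → p.2 ^ 2 / 2 ≤ el p.1 := by
    rcases le_or_gt ω 0 with h | h
    · filter_upwards [hsq.eventually_lt hcl (hl' h)] with p hp _ using hp.le
    · filter_upwards [(continuousAt_const (y := (0 : ℝ))).eventually_lt continuousAt_snd
        (h : 0 < (y, ω).2)] with p hp h'
      exact absurd h' (not_le.2 hp)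
  filter_upwards [hfst hn, h2, h3] with p h1 h2 h3
  exact (O.mem_hull_iff p).2 ⟨h1, h2, h3⟩

/-- A point which can be joined to the axis by a vertical segment that does not meet the curve
belongs to the hull. -/
theorem mem_hull_of_segment (O : Oval m M a b eu el C) {y ω : ℝ} (hy : y ∈ Ioo a b)
    (hseg : ∀ w ∈ uIcc 0 ω, (y, w) ∉ C) : (y, ω) ∈ verticalHull C := by
  have hy' := Ioo_subset_Icc_self hy
  refine (O.mem_hull_iff _).2 ⟨hy', fun h => ?_, fun h => ?_⟩ <;> simp only at h ⊢
  · by_contra! hcon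
    refine hseg _ ?_ (O.upper_mem hy')
    rw [uIcc_of_le h]
    exact ⟨Real.sqrt_nonneg _, Real.sqrt_le_iff.2 ⟨h, by linarith⟩⟩
  · by_contra! hcon
    refine hseg _ ?_ (O.lower_mem hy')
    rw [uIcc_of_ge h]
    have : √(2 * el y) ≤ -ω := Real.sqrt_le_iff.2 ⟨by linarith, by nlinarith⟩
    exact ⟨by linarith, neg_nonpos.2 (Real.sqrt_nonneg _)⟩

/-! ### Forward invariance of the hull. -/

section Invariance

variable {Y W F : ℝ → ℝ} {σ τ : ℝ}

/-- Positive energy below the upper arc keeps the point away from both corners, so for a short time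
the trajectory stays over `(a, b)` and above the axis, where it can be compared with the arc. -/
theorem stays_of_pos (O : Oval m M a b eu el C) (hm : LipschitzOnBounded m)
    (h : IsTrajectory m M σ τ Y W F) (hστ : σ < τ) (h0 : (Y σ, W σ) ∈ verticalHull C)
    (hW : 0 < W σ) : ∃ t ∈ Ioc σ τ, (Y t, W t) ∈ verticalHull C := by
  obtain ⟨hy, hu, -⟩ := (O.mem_hull_iff _).1 h0
  simp only at hy hu
  have hu := hu hW.le
  have hsq : 0 < W σ ^ 2 / 2 := by positivity
  have hya : a < Y σ := lt_of_le_of_ne hy.1 fun h => by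
    rw [← h, O.upper.left] at hu; linarith
  have hyb : Y σ < b := lt_of_le_of_ne hy.2 fun h => by
    rw [h, O.upper.right] at hu; linarith
  have hcY : ContinuousWithinAt Y (Icc σ τ) σ := h.contY σ (left_mem_Icc.2 hστ.le)
  have hcW : ContinuousWithinAt W (Icc σ τ) σ := h.contW σ (left_mem_Icc.2 hστ.le)
  have hev : ∀ᶠ t in 𝓝[Icc σ τ] σ, 0 < W t ∧ Y t ∈ Ioo a b :=
    (hcW.eventually (lt_mem_nhds hW)).and (hcY.eventually (Ioo_mem_nhds hya hyb))
  rw [nhdsWithin_Icc_eq_nhdsGE hστ] at hev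
  obtain ⟨t, ht, hsub⟩ := (mem_nhdsGE_iff_exists_Icc_subset).1 hev
  have hσt : σ < t := ht
  have htm : σ < min t τ := lt_min hσt hστ
  have hsub' : ∀ r ∈ Icc σ (min t τ), 0 < W r ∧ Y r ∈ Ioo a b := fun r hr =>
    hsub ⟨hr.1, hr.2.trans (min_le_left _ _)⟩
  have h' := h.mono le_rfl (min_le_right t τ)
  have hle := O.upper.le_of_le hm htm h'.contY h'.contW h'.derivY h'.derivW h'.le_F
    (fun r hr => (hsub' r (Ioo_subset_Icc_self hr)).1.le)
    (fun r hr => (hsub' r (Ioo_subset_Icc_self hr)).2) hu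
  obtain ⟨h1, h2⟩ := hsub' _ (right_mem_Icc.2 htm.le)
  exact ⟨min t τ, ⟨htm, min_le_right _ _⟩, (O.mem_hull_iff _).2
    ⟨Ioo_subset_Icc_self h2, fun _ => hle, fun h => absurd h (not_le.2 h1)⟩⟩

/-- At the right corner `ω' ≤ -m < 0` pushes the trajectory below the axis, hence to the left. It is
then compared with the lower arc, both starting with energy zero. -/
theorem stays_of_right (O : Oval m M a b eu el C) (hm : LipschitzOnBounded m)
    (hM : LipschitzOnBounded M) (h : IsTrajectory m M σ τ Y W F) (hστ : σ < τ) (hW : W σ = 0)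
    (hY : Y σ = b) : ∃ t ∈ Ioc σ τ, (Y t, W t) ∈ verticalHull C := by
  have hcY : ContinuousWithinAt Y (Icc σ τ) σ := h.contY σ (left_mem_Icc.2 hστ.le)
  have hcW : ContinuousWithinAt W (Icc σ τ) σ := h.contW σ (left_mem_Icc.2 hστ.le)
  have hcm : ContinuousWithinAt (fun t => m (Y t, W t)) (Icc σ τ) σ :=
    hm.continuous.continuousAt.comp_continuousWithinAt (hcY.prodMk hcW)
  have hev : ∀ᶠ t in 𝓝[Icc σ τ] σ, 0 < m (Y t, W t) ∧ a < Y t := by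
    refine (hcm.eventually (lt_mem_nhds ?_)).and (hcY.eventually (lt_mem_nhds ?_))
    · simp only [hY, hW]; exact O.right_pos
    · rw [hY]; exact O.upper.lt
  rw [nhdsWithin_Icc_eq_nhdsGE hστ] at hev
  obtain ⟨t, ht, hsub⟩ := (mem_nhdsGE_iff_exists_Icc_subset).1 hev
  have hσt : σ < t := ht
  have htm : σ < min t τ := lt_min hσt hστ
  have hsub' : ∀ r ∈ Icc σ (min t τ), 0 < m (Y r, W r) ∧ a < Y r := fun r hr =>
    hsub ⟨hr.1, hr.2.trans (min_le_left _ _)⟩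
  have h' := h.mono le_rfl (min_le_right t τ)
  have hWanti : StrictAntiOn W (Icc σ (min t τ)) := by
    refine strictAntiOn_of_hasDerivWithinAt_neg (f' := fun t => -F t) (convex_Icc _ _) h'.contW
      (fun r hr => ?_) (fun r hr => ?_) <;> rw [interior_Icc] at hr
    · exact (h'.derivW r hr).hasDerivWithinAt
    · have := h'.le_F r hr
      linarith [(hsub' r (Ioo_subset_Icc_self hr)).1]
  have hWneg : ∀ r ∈ Ioc σ (min t τ), W r < 0 := fun r hr => by
    have := hWanti (left_mem_Icc.2 htm.le) (Ioc_subset_Icc_self hr) hr.1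
    rwa [hW] at this
  have hYanti : StrictAntiOn Y (Icc σ (min t τ)) := by
    refine strictAntiOn_of_hasDerivWithinAt_neg (f' := W) (convex_Icc _ _) h'.contY
      (fun r hr => ?_) (fun r hr => ?_) <;> rw [interior_Icc] at hr
    · exact (h'.derivY r hr).hasDerivWithinAt
    · exact hWneg r ⟨hr.1, hr.2.le⟩
  have hYlt : ∀ r ∈ Ioc σ (min t τ), Y r < b := fun r hr => by
    have := hYanti (left_mem_Icc.2 htm.le) (Ioc_subset_Icc_self hr) hr.1
    rwa [hY] at this
  have h'' := h'.reflect
  have hle := O.lower.le_of_le hM.reflect htm h''.contY h''.contW h''.derivY h''.derivW h''.le_F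
    (fun r hr => by simpa using (hWneg r ⟨hr.1, hr.2.le⟩).le)
    (fun r hr => ⟨neg_lt_neg (hYlt r ⟨hr.1, hr.2.le⟩),
      neg_lt_neg (hsub' r (Ioo_subset_Icc_self hr)).2⟩)
    (by simp [hW, hY, O.el_right])
  simp only [Pi.neg_apply, neg_sq, neg_neg] at hle
  have hmem := right_mem_Ioc.2 htm
  exact ⟨min t τ, ⟨htm, min_le_right _ _⟩, (O.mem_hull_iff _).2
    ⟨⟨(hsub' _ (right_mem_Icc.2 htm.le)).2.le, (hYlt _ hmem).le⟩,
      fun h => absurd h (not_le.2 (hWneg _ hmem)), fun _ => hle⟩⟩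

/-- The hull of an oval is forward invariant for the differential inclusion. -/
theorem mem_hull_of_trajectory (O : Oval m M a b eu el C) (hm : LipschitzOnBounded m)
    (hM : LipschitzOnBounded M) {s t : ℝ} (h : IsTrajectory m M s t Y W F) (hst : s ≤ t)
    (h0 : (Y s, W s) ∈ verticalHull C) : (Y t, W t) ∈ verticalHull C := by
  have hcl : IsCompact (Icc s t ∩ (fun r => (Y r, W r)) ⁻¹' verticalHull C) :=
    isCompact_Icc.of_isClosed_subset
      ((h.contY.prodMk h.contW).preimage_isClosed_of_isClosed isClosed_Icc O.isClosed_hull)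
      inter_subset_left
  obtain ⟨σ, ⟨hσ, hσC⟩, hmax⟩ := hcl.exists_isGreatest ⟨s, left_mem_Icc.2 hst, h0⟩
  rcases eq_or_lt_of_le hσ.2 with h1 | hσt
  · rw [← h1]; exact hσC
  have h' := h.mono hσ.1 le_rfl
  -- Since `σ` is the last time in the hull, a slightly later time in it is a contradiction. The
  -- cases are: below the axis, the two corners, axis points between them (interior to the hull),
  -- and above the axis.
  suffices hs : ∃ r ∈ Ioc σ t, (Y r, W r) ∈ verticalHull C by
    obtain ⟨r, hr, hrC⟩ := hs
    exact absurd (hmax ⟨⟨hσ.1.trans hr.1.le, hr.2⟩, hrC⟩) (not_le.2 hr.1)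
  have hmem := (O.mem_hull_iff _).1 hσC
  simp only at hmem
  have hrefl : ∀ r, (-Y r, -W r) ∈ verticalHull {p | -p ∈ C} ↔ (Y r, W r) ∈ verticalHull C := by
    intro r
    rw [mem_hull_reflect]
    simp
  rcases lt_trichotomy (W σ) 0 with hW | hW | hW
  · obtain ⟨r, hr, hrC⟩ := O.reflect.stays_of_pos hM.reflect h'.reflect hσt
      ((hrefl σ).2 hσC) (by simpa using hW)
    exact ⟨r, hr, (hrefl r).1 hrC⟩
  · rcases eq_or_lt_of_le hmem.1.1 with hY | hY
    · obtain ⟨r, hr, hrC⟩ := O.reflect.stays_of_right hM.reflect hm.reflect h'.reflect hσt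
        (by simpa using hW) (by simp [hY])
      exact ⟨r, hr, (hrefl r).1 hrC⟩
    rcases eq_or_lt_of_le hmem.1.2 with hY' | hY'
    · exact O.stays_of_right hm hM h' hσt hW hY'
    · have hnC : (Y σ, W σ) ∉ C := by
        intro hC
        have := ((O.mem_iff _).1 hC).2
        have h1 := O.upper.pos _ ⟨hY, hY'⟩
        have h2 := O.el_pos ⟨hY, hY'⟩
        simp only [hW] at this
        rcases this with h3 | h3 <;> norm_num at h3 <;> linarith
      have hn := O.hull_mem_nhds hσC hnC
      have hc : ContinuousWithinAt (fun r => (Y r, W r)) (Icc σ t) σ :=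
        (h'.contY.prodMk h'.contW) σ (left_mem_Icc.2 hσt.le)
      have hev := hc hn
      rw [nhdsWithin_Icc_eq_nhdsGE hσt] at hev
      obtain ⟨r, hr, hsub⟩ := (mem_nhdsGE_iff_exists_Icc_subset).1 hev
      have hσr : σ < r := hr
      exact ⟨min r t, ⟨lt_min hσr hσt, min_le_right _ _⟩,
        hsub ⟨(lt_min hσr hσt).le, min_le_left _ _⟩⟩
  · exact O.stays_of_pos hm h' hσt hσC hW

end Invariance

end Oval

/-! ### Nesting of ovals of comparable fields. -/

section Nesting

/-- Of two upper arcs, the one with the larger field that starts inside ends inside. -/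
theorem UpperArc.le_of_start_le {m₁ m₂ : ℝ × ℝ → ℝ} {a₁ b₁ a₂ b₂ : ℝ} {e₁ e₂ : ℝ → ℝ}
    (A₁ : UpperArc m₁ a₁ b₁ e₁) (A₂ : UpperArc m₂ a₂ b₂ e₂) (hm : ∀ p, m₂ p ≤ m₁ p)
    (hlip : LipschitzOnBounded m₂) (h1 : a₂ ≤ a₁) (h2 : a₁ < b₂) :
    b₁ ≤ b₂ ∧ ∀ y ∈ Icc a₁ b₁, e₁ y ≤ e₂ y := by
  obtain ⟨s₀, s₁, Y, W, hs, hY, hW, hYa, hYb, he, hd⟩ := A₁.param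
  have hmono : StrictMonoOn Y (Icc s₀ s₁) := by
    refine strictMonoOn_of_hasDerivWithinAt_pos (f' := W) (convex_Icc _ _) hY
      (fun r hr => ?_) (fun r hr => ?_) <;> rw [interior_Icc] at hr
    · exact (hd r hr).2.2.1.hasDerivWithinAt
    · exact (hd r hr).1
  -- The first arc, run in time with `F = m₁ ≥ m₂`, is an admissible trajectory beneath the second.
  have key : ∀ σ ∈ Icc s₀ s₁, Y σ ≤ b₂ → W σ ^ 2 / 2 ≤ e₂ (Y σ) := by
    intro σ hσ hYσ
    have h0 : W s₀ ^ 2 / 2 ≤ e₂ (Y s₀) := by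
      rw [he s₀ (left_mem_Icc.2 hs.le), hYa, A₁.left]
      exact A₂.nonneg ⟨h1, h2.le⟩
    rcases eq_or_lt_of_le hσ.1 with h | h
    · rw [← h]; exact h0
    have hsub : ∀ r ∈ Ioo s₀ σ, r ∈ Ioo s₀ s₁ := fun r hr => ⟨hr.1, hr.2.trans_le hσ.2⟩
    refine A₂.le_of_le hlip h (F := fun t => m₁ (Y t, W t))
      (hY.mono (Icc_subset_Icc_right hσ.2)) (hW.mono (Icc_subset_Icc_right hσ.2))
      (fun r hr => (hd r (hsub r hr)).2.2.1) (fun r hr => (hd r (hsub r hr)).2.2.2)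
      (fun r _ => hm _) (fun r hr => (hd r (hsub r hr)).1.le) (fun r hr => ?_) h0
    refine ⟨h1.trans_lt (hd r (hsub r hr)).2.1.1, lt_of_lt_of_le ?_ hYσ⟩
    exact hmono (Ioo_subset_Icc_self (hsub r hr)) hσ hr.2
  have hb : b₁ ≤ b₂ := by
    by_contra! hcon
    obtain ⟨σ, hσ, hYσ⟩ := intermediate_value_Icc hs.le hY
      (⟨by rw [hYa]; exact h2.le, by rw [hYb]; exact hcon.le⟩ : b₂ ∈ Icc (Y s₀) (Y s₁))
    have h3 := key σ hσ hYσ.le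
    have h4 : σ ∈ Ioo s₀ s₁ := by
      refine ⟨lt_of_le_of_ne hσ.1 ?_, lt_of_le_of_ne hσ.2 ?_⟩
      · rintro rfl; linarith
      · rintro rfl; linarith
    rw [hYσ, A₂.right] at h3
    have := (hd σ h4).1
    nlinarith
  refine ⟨hb, fun y hy => ?_⟩
  obtain ⟨σ, hσ, rfl⟩ := intermediate_value_Icc hs.le hY (by rwa [hYa, hYb])
  rw [← he σ hσ]
  exact key σ hσ (hy.2.trans hb)

/-- Two nested upper arcs that end at the same point coincide. -/
theorem UpperArc.eq_of_end_eq {m₁ m₂ : ℝ × ℝ → ℝ} {a₁ a₂ b : ℝ} {e₁ e₂ : ℝ → ℝ}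
    (A₁ : UpperArc m₁ a₁ b e₁) (A₂ : UpperArc m₂ a₂ b e₂) (hm : ∀ p, m₂ p ≤ m₁ p)
    (hlip : LipschitzOnBounded m₂) (h1 : a₂ ≤ a₁) :
    a₁ = a₂ ∧ ∀ y ∈ Icc a₁ b, e₁ y = e₂ y := by
  have hle := (A₁.le_of_start_le A₂ hm hlip h1 A₁.lt).2
  obtain ⟨s₀, s₁, Y, W, hs, hY, hW, hYa, hYb, he, hd⟩ := A₁.param
  -- A strict gap would persist up to the common end, where both energies vanish.
  have key : ∀ σ ∈ Icc s₀ s₁, e₂ (Y σ) ≤ e₁ (Y σ) := by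
    intro σ hσ
    by_contra! hcon
    rcases eq_or_lt_of_le hσ.2 with h | h
    · rw [h, hYb, A₂.right, A₁.right] at hcon
      exact lt_irrefl _ hcon
    have hsub : ∀ r ∈ Ioo σ s₁, r ∈ Ioo s₀ s₁ := fun r hr => ⟨hσ.1.trans_lt hr.1, hr.2⟩
    have := A₂.lt_of_lt hlip h (F := fun t => m₁ (Y t, W t))
      (hY.mono (Icc_subset_Icc_left hσ.1)) (hW.mono (Icc_subset_Icc_left hσ.1))
      (fun r hr => (hd r (hsub r hr)).2.2.1) (fun r hr => (hd r (hsub r hr)).2.2.2)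
      (fun r _ => hm _) (fun r hr => (hd r (hsub r hr)).1.le)
      (fun r hr => ⟨h1.trans_lt (hd r (hsub r hr)).2.1.1, (hd r (hsub r hr)).2.1.2⟩)
      (by rwa [he σ hσ])
    rw [he s₁ (right_mem_Icc.2 hs.le), hYb, A₁.right, A₂.right] at this
    exact lt_irrefl _ this
  constructor
  · by_contra hne
    have h2 := key s₀ (left_mem_Icc.2 hs.le)
    rw [hYa, A₁.left] at h2
    have := A₂.pos a₁ ⟨lt_of_le_of_ne h1 (Ne.symm hne), A₁.lt⟩
    linarith
  · intro y hy
    refine le_antisymm (hle y hy) ?_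
    obtain ⟨σ, hσ, rfl⟩ := intermediate_value_Icc hs.le hY (by rwa [hYa, hYb])
    exact key σ hσ

variable {m₁ M₁ m₂ M₂ : ℝ × ℝ → ℝ} {a₁ b₁ a₂ b₂ : ℝ} {eu₁ el₁ eu₂ el₂ : ℝ → ℝ}
  {C₁ C₂ : Set (ℝ × ℝ)}

/-- The lower arcs run leftwards from the right ends, so the order of the right ends yields that of
the left ends; from these the upper arcs start. The condition `a₂ < b₁` makes the lower comparison
start over the second oval. -/
theorem Oval.le_of_right_le (O₁ : Oval m₁ M₁ a₁ b₁ eu₁ el₁ C₁) (O₂ : Oval m₂ M₂ a₂ b₂ eu₂ el₂ C₂)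
    (hm : ∀ p, m₂ p ≤ m₁ p) (hM : ∀ p, M₁ p ≤ M₂ p) (hlm : LipschitzOnBounded m₂)
    (hlM : LipschitzOnBounded M₂) (hb : b₁ ≤ b₂) (hab : a₂ < b₁) :
    a₂ ≤ a₁ ∧ ∀ y ∈ Icc a₁ b₁, eu₁ y ≤ eu₂ y ∧ el₁ y ≤ el₂ y := by
  obtain ⟨h1, h2⟩ := O₁.lower.le_of_start_le O₂.lower (fun p => neg_le_neg (hM _)) hlM.reflect
    (neg_le_neg hb) (neg_lt_neg hab)
  have ha : a₂ ≤ a₁ := neg_le_neg_iff.1 h1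
  obtain ⟨-, h3⟩ := O₁.upper.le_of_start_le O₂.upper hm hlm ha (O₁.upper.lt.trans_le hb)
  refine ⟨ha, fun y hy => ⟨h3 y hy, ?_⟩⟩
  simpa using h2 (-y) ⟨neg_le_neg hy.2, neg_le_neg hy.1⟩

/-- Cycles of comparable fields are nested as soon as their right ends are. -/
theorem Oval.hull_subset (O₁ : Oval m₁ M₁ a₁ b₁ eu₁ el₁ C₁) (O₂ : Oval m₂ M₂ a₂ b₂ eu₂ el₂ C₂)
    (hm : ∀ p, m₂ p ≤ m₁ p) (hM : ∀ p, M₁ p ≤ M₂ p) (hlm : LipschitzOnBounded m₂)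
    (hlM : LipschitzOnBounded M₂) (hb : b₁ ≤ b₂) (hab : a₂ < b₁) :
    verticalHull C₁ ⊆ verticalHull C₂ := by
  obtain ⟨ha, h⟩ := O₁.le_of_right_le O₂ hm hM hlm hlM hb hab
  intro p hp
  obtain ⟨hp1, hp2, hp3⟩ := (O₁.mem_hull_iff p).1 hp
  obtain ⟨h1, h2⟩ := h _ hp1
  exact (O₂.mem_hull_iff p).2 ⟨⟨ha.trans hp1.1, hp1.2.trans hb⟩,
    fun h' => (hp2 h').trans h1, fun h' => (hp3 h').trans h2⟩

/-- If the right ends of two cycles of comparable fields coincide, then so do the left ends, and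
the fields agree along the upper arcs. -/
theorem Oval.fields_eq (O₁ : Oval m₁ M₁ a₁ b₁ eu₁ el₁ C₁) (O₂ : Oval m₂ M₂ a₂ b₂ eu₂ el₂ C₂)
    (hm : ∀ p, m₂ p ≤ m₁ p) (hM : ∀ p, M₁ p ≤ M₂ p) (hlm : LipschitzOnBounded m₂)
    (hlM : LipschitzOnBounded M₂) (hb : b₁ = b₂) :
    a₁ = a₂ ∧ ∀ y ∈ Ioo a₁ b₁, m₁ (y, √(2 * eu₁ y)) = m₂ (y, √(2 * eu₁ y)) := by
  subst hb
  obtain ⟨ha, -⟩ := O₁.le_of_right_le O₂ hm hM hlm hlM le_rfl O₂.upper.lt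
  obtain ⟨rfl, he⟩ := O₁.upper.eq_of_end_eq O₂.upper hm hlm ha
  refine ⟨rfl, fun y hy => ?_⟩
  -- Coinciding graphs have coinciding slopes, and the slopes are the fields up to sign.
  have h1 := O₁.upper.hasDerivAt y hy
  have h2 := O₂.upper.hasDerivAt y hy
  have h3 := h2.congr_of_eventuallyEq (f₁ := eu₁) (by
    filter_upwards [Icc_mem_nhds hy.1 hy.2] with v hv using he v hv)
  have h4 := h1.unique h3
  rw [← he y (Ioo_subset_Icc_self hy)] at h4
  exact neg_inj.1 h4

end Nesting

/-! ### Two norm estimates. -/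

section Auxiliary

theorem ContDiff.exists_lipschitz_on_ball {E F : Type*} [NormedAddCommGroup E] [NormedSpace ℝ E]
    [ProperSpace E] [NormedAddCommGroup F] [NormedSpace ℝ F] {f : E → F} (hf : ContDiff ℝ 1 f)
    (R : ℝ) : ∃ L : ℝ, 0 ≤ L ∧ ∀ p q : E, ‖p‖ ≤ R → ‖q‖ ≤ R → ‖f p - f q‖ ≤ L * ‖p - q‖ := by
  obtain ⟨B, hB⟩ := (isCompact_closedBall (0 : E) R).exists_bound_of_continuousOn
    (hf.continuous_fderiv one_ne_zero).continuousOn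
  refine ⟨|B|, abs_nonneg B, fun p q hp hq => ?_⟩
  exact (convex_closedBall (0 : E) R).norm_image_sub_le_of_norm_fderiv_le (𝕜 := ℝ)
    (fun x _ => (hf.differentiable one_ne_zero).differentiableAt)
    (fun x hx => (hB x hx).trans (le_abs_self B)) (by simpa using hq) (by simpa using hp)

/-- The factor `4` is the dimension, as the norm is the supremum norm. -/
theorem abs_dotProduct_le (u x : Fin 4 → ℝ) : |u ⬝ᵥ x| ≤ 4 * ‖u‖ * ‖x‖ := by
  calc |u ⬝ᵥ x| ≤ ∑ i, |u i * x i| := Finset.abs_sum_le_sum_abs _ _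
    _ ≤ ∑ _i : Fin 4, ‖u‖ * ‖x‖ := by
      refine Finset.sum_le_sum fun i _ => ?_
      rw [abs_mul]
      exact mul_le_mul (norm_le_pi_norm u i) (norm_le_pi_norm x i) (abs_nonneg _) (norm_nonneg _)
    _ = 4 * ‖u‖ * ‖x‖ := by simp; ring

end Auxiliary

namespace InverterSystem

/-! ### Sublevel sets of `VCC`; after them, the extremal forces. -/

section Ellipsoid

variable {P : Matrix (Fin 4) (Fin 4) ℝ}

theorem continuous_VCC : Continuous (VCC P) := by
  unfold VCC
  fun_prop

theorem VCC_zero : VCC P 0 = 0 := by simp [VCC]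

theorem VCC_smul (c : ℝ) (x : Fin 4 → ℝ) : VCC P (c • x) = c ^ 2 * VCC P x := by
  simp only [VCC, Matrix.mulVec_smul, dotProduct_smul, smul_dotProduct, smul_eq_mul]
  ring

theorem VCC_pos (hP : P.PosDef) {x : Fin 4 → ℝ} (hx : x ≠ 0) : 0 < VCC P x := by
  simpa [VCC] using hP.dotProduct_mulVec_pos hx

/-- A positive definite form dominates the square of the norm. -/
theorem exists_mul_norm_sq_le_VCC (hP : P.PosDef) :
    ∃ c > 0, ∀ x : Fin 4 → ℝ, c * ‖x‖ ^ 2 ≤ VCC P x := by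
  obtain ⟨u, hu, hmin⟩ := (isCompact_sphere (0 : Fin 4 → ℝ) 1).exists_isMinOn
    (NormedSpace.sphere_nonempty.2 zero_le_one) (continuous_VCC (P := P)).continuousOn
  have hu1 : ‖u‖ = 1 := by simpa using hu
  refine ⟨VCC P u, VCC_pos hP (by rintro rfl; simp at hu1), fun x => ?_⟩
  by_cases hx : x = 0
  · simp [hx, VCC_zero]
  have hn : ‖x‖ ≠ 0 := norm_ne_zero_iff.2 hx
  have hmem : ‖x‖⁻¹ • x ∈ Metric.sphere (0 : Fin 4 → ℝ) 1 := by
    simp [norm_smul, inv_mul_cancel₀ hn]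
  have h := hmin hmem
  simp only [mem_ofPred_eq, VCC_smul] at h
  calc VCC P u * ‖x‖ ^ 2 ≤ ‖x‖⁻¹ ^ 2 * VCC P x * ‖x‖ ^ 2 := by gcongr
    _ = VCC P x := by field_simp

/-- The sublevel sets of `VCC`. -/
def ellipsoid (P : Matrix (Fin 4) (Fin 4) ℝ) (V : ℝ) : Set (Fin 4 → ℝ) := {x | VCC P x ≤ V}

theorem isCompact_ellipsoid (hP : P.PosDef) (V : ℝ) : IsCompact (ellipsoid P V) := by
  obtain ⟨c, hc, h⟩ := exists_mul_norm_sq_le_VCC hP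
  refine Metric.isCompact_of_isClosed_isBounded
    (isClosed_le continuous_VCC continuous_const) ?_
  refine (Metric.isBounded_closedBall (x := (0 : Fin 4 → ℝ)) (r := √(V / c))).subset fun x hx => ?_
  rw [mem_closedBall_zero_iff]
  refine Real.le_sqrt_of_sq_le ?_
  rw [le_div_iff₀ hc]
  have : VCC P x ≤ V := hx
  linarith [h x]

theorem zero_mem_ellipsoid {V : ℝ} (hV : 0 ≤ V) : (0 : Fin 4 → ℝ) ∈ ellipsoid P V := by
  simpa [ellipsoid, VCC_zero] using hV

theorem ellipsoid_mono {V V' : ℝ} (h : V ≤ V') : ellipsoid P V ⊆ ellipsoid P V' :=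
  fun _ hx => le_trans hx h

theorem ellipsoid_zero (hP : P.PosDef) : ellipsoid P 0 = {0} := by
  refine Subset.antisymm (fun x hx => ?_) (singleton_subset_iff.2 (zero_mem_ellipsoid le_rfl))
  by_contra hne
  exact absurd hx (not_le.2 (VCC_pos hP hne))

end Ellipsoid

variable (S : InverterSystem)

/-- The ratio `kp / ki` of the gains. -/
def slope : ℝ := S.kp / S.ki

/-- The change of variables from `(θ - (kp / ki) ω, ω)` to `(θ, ω)`. -/
def toPhase (p : ℝ × ℝ) : ℝ × ℝ := (p.1 + S.slope * p.2, p.2)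

/-- The change of variables from `(θ, ω)` to `(θ - (kp / ki) ω, ω)`. -/
def ofPhase (p : ℝ × ℝ) : ℝ × ℝ := (p.1 - S.slope * p.2, p.2)

@[simp] theorem toPhase_ofPhase (p : ℝ × ℝ) : S.toPhase (S.ofPhase p) = p := by
  simp [toPhase, ofPhase]

@[simp] theorem ofPhase_toPhase (p : ℝ × ℝ) : S.ofPhase (S.toPhase p) = p := by
  simp [toPhase, ofPhase]

theorem continuous_ofPhase : Continuous S.ofPhase := by unfold ofPhase; fun_prop

theorem contDiff_toPhase : ContDiff ℝ 1 S.toPhase := by unfold toPhase; fun_prop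

theorem mem_image_ofPhase {C : Set (ℝ × ℝ)} {p : ℝ × ℝ} :
    p ∈ S.ofPhase '' C ↔ S.toPhase p ∈ C := by
  constructor
  · rintro ⟨q, hq, rfl⟩; simpa
  · intro h; exact ⟨_, h, by simp⟩

/-- The force `ki f` in the variables `(θ - (kp / ki) ω, ω)`; the system becomes `y' = ω`,
`ω' = -force`. -/
def force (p : ℝ × ℝ) (x : Fin 4 → ℝ) : ℝ := S.ki * S.f (S.toPhase p).1 (S.toPhase p).2 x

/-- The least force over an ellipsoid. -/
def lowerForce (P : Matrix (Fin 4) (Fin 4) ℝ) (V : ℝ) (p : ℝ × ℝ) : ℝ :=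
  sInf (S.force p '' ellipsoid P V)

/-- The greatest force over an ellipsoid. -/
def upperForce (P : Matrix (Fin 4) (Fin 4) ℝ) (V : ℝ) (p : ℝ × ℝ) : ℝ :=
  sSup (S.force p '' ellipsoid P V)

variable {S} {P : Matrix (Fin 4) (Fin 4) ℝ} {V : ℝ}

theorem continuousOn_force (hreg : ∀ x ∈ ellipsoid P V, S.ν ⬝ᵥ x ≠ S.μ) (p : ℝ × ℝ) :
    ContinuousOn (S.force p) (ellipsoid P V) := by
  unfold force f
  refine continuousOn_const.mul (ContinuousOn.div (by fun_prop) (by fun_prop) fun x hx => ?_)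
  exact sub_ne_zero.2 (hreg x hx).symm

theorem isLeast_lowerForce (hP : P.PosDef) (hV : 0 ≤ V)
    (hreg : ∀ x ∈ ellipsoid P V, S.ν ⬝ᵥ x ≠ S.μ) (p : ℝ × ℝ) :
    IsLeast (S.force p '' ellipsoid P V) (S.lowerForce P V p) :=
  ((isCompact_ellipsoid hP V).image_of_continuousOn (continuousOn_force hreg p)).isLeast_sInf
    ((nonempty_of_mem (zero_mem_ellipsoid hV)).image _)

theorem isGreatest_upperForce (hP : P.PosDef) (hV : 0 ≤ V)
    (hreg : ∀ x ∈ ellipsoid P V, S.ν ⬝ᵥ x ≠ S.μ) (p : ℝ × ℝ) :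
    IsGreatest (S.force p '' ellipsoid P V) (S.upperForce P V p) :=
  ((isCompact_ellipsoid hP V).image_of_continuousOn (continuousOn_force hreg p)).isGreatest_sSup
    ((nonempty_of_mem (zero_mem_ellipsoid hV)).image _)

theorem lowerForce_le (hP : P.PosDef) (hV : 0 ≤ V)
    (hreg : ∀ x ∈ ellipsoid P V, S.ν ⬝ᵥ x ≠ S.μ) (p : ℝ × ℝ) {x : Fin 4 → ℝ}
    (hx : x ∈ ellipsoid P V) : S.lowerForce P V p ≤ S.force p x :=
  (isLeast_lowerForce hP hV hreg p).2 (mem_image_of_mem _ hx)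

theorem le_upperForce (hP : P.PosDef) (hV : 0 ≤ V)
    (hreg : ∀ x ∈ ellipsoid P V, S.ν ⬝ᵥ x ≠ S.μ) (p : ℝ × ℝ) {x : Fin 4 → ℝ}
    (hx : x ∈ ellipsoid P V) : S.force p x ≤ S.upperForce P V p :=
  (isGreatest_upperForce hP hV hreg p).2 (mem_image_of_mem _ hx)

theorem lowerForce_le_upperForce (hP : P.PosDef) (hV : 0 ≤ V)
    (hreg : ∀ x ∈ ellipsoid P V, S.ν ⬝ᵥ x ≠ S.μ) (p : ℝ × ℝ) :
    S.lowerForce P V p ≤ S.upperForce P V p :=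
  (lowerForce_le hP hV hreg p (zero_mem_ellipsoid hV)).trans
    (le_upperForce hP hV hreg p (zero_mem_ellipsoid hV))

/-- The force is Lipschitz on bounded sets, uniformly over an ellipsoid. -/
theorem exists_force_lipschitz (hS : S.StandingAssumptions) (hP : P.PosDef)
    (hV : 0 ≤ V) (hreg : ∀ x ∈ ellipsoid P V, S.ν ⬝ᵥ x ≠ S.μ) (R : ℝ) :
    ∃ L : ℝ, 0 ≤ L ∧ ∀ x ∈ ellipsoid P V, ∀ p q : ℝ × ℝ, ‖p‖ ≤ R → ‖q‖ ≤ R →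
      |S.force p x - S.force q x| ≤ L * ‖p - q‖ := by
  obtain ⟨L₁, hL₁, h1⟩ := (hS.g_contDiff.comp S.contDiff_toPhase).exists_lipschitz_on_ball R
  obtain ⟨L₂, hL₂, h2⟩ := hS.h_contDiff.exists_lipschitz_on_ball R
  obtain ⟨B, hB⟩ := (isCompact_ellipsoid hP V).exists_bound_of_continuousOn
    (f := fun x => x) continuousOn_id
  have hB0 : 0 ≤ B := (norm_nonneg _).trans (hB 0 (zero_mem_ellipsoid hV))
  have hcont : ContinuousOn (fun x => (S.μ - S.ν ⬝ᵥ x)⁻¹) (ellipsoid P V) :=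
    ContinuousOn.inv₀ (by fun_prop) fun x hx => sub_ne_zero.2 (hreg x hx).symm
  obtain ⟨d, hd⟩ := (isCompact_ellipsoid hP V).exists_bound_of_continuousOn hcont
  have hd0 : 0 ≤ d := (norm_nonneg _).trans (hd 0 (zero_mem_ellipsoid hV))
  have hki := hS.ki_pos
  refine ⟨S.ki * ((L₁ + 4 * L₂ * B) * d), by positivity, fun x hx p q hp hq => ?_⟩
  have e : S.force p x - S.force q x = S.ki * (((S.g (S.toPhase p) - S.g (S.toPhase q)) -
      (S.h p.2 - S.h q.2) ⬝ᵥ x) * (S.μ - S.ν ⬝ᵥ x)⁻¹) := by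
    simp only [force, f, toPhase, sub_dotProduct, div_eq_mul_inv]
    ring
  have h3 := h1 p q hp hq
  simp only [Function.comp_apply, Real.norm_eq_abs] at h3
  have h4 : ‖S.h p.2 - S.h q.2‖ ≤ L₂ * ‖p - q‖ :=
    (h2 p.2 q.2 ((norm_snd_le p).trans hp) ((norm_snd_le q).trans hq)).trans
      (mul_le_mul_of_nonneg_left (norm_snd_le (p - q)) hL₂)
  have h5 : |(S.h p.2 - S.h q.2) ⬝ᵥ x| ≤ 4 * (L₂ * ‖p - q‖) * B :=
    (abs_dotProduct_le _ _).trans (by gcongr; exact hB x hx)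
  have h6 : |(S.μ - S.ν ⬝ᵥ x)⁻¹| ≤ d := hd x hx
  rw [e, abs_mul, abs_mul, abs_of_pos hki]
  calc S.ki * (|S.g (S.toPhase p) - S.g (S.toPhase q) - (S.h p.2 - S.h q.2) ⬝ᵥ x| *
        |(S.μ - S.ν ⬝ᵥ x)⁻¹|)
      ≤ S.ki * ((L₁ * ‖p - q‖ + 4 * (L₂ * ‖p - q‖) * B) * d) := by
        gcongr
        exact (abs_sub _ _).trans (add_le_add h3 h5)
    _ = _ := by ring

/-- A minimum of functions with a common Lipschitz constant: the value at `p` is tested with the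
minimiser for `q`. -/
theorem lipschitz_lowerForce (hS : S.StandingAssumptions) (hP : P.PosDef) (hV : 0 ≤ V)
    (hreg : ∀ x ∈ ellipsoid P V, S.ν ⬝ᵥ x ≠ S.μ) : LipschitzOnBounded (S.lowerForce P V) := by
  intro R
  obtain ⟨L, hL, h⟩ := exists_force_lipschitz hS hP hV hreg R
  have key : ∀ p q : ℝ × ℝ, ‖p‖ ≤ R → ‖q‖ ≤ R →
      S.lowerForce P V p - S.lowerForce P V q ≤ L * ‖p - q‖ := by
    intro p q hp hq
    obtain ⟨x, hx, hxq⟩ := (isLeast_lowerForce hP hV hreg q).1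
    have h1 := lowerForce_le hP hV hreg p hx
    have h2 := (abs_le.1 (h x hx p q hp hq)).2
    linarith
  refine ⟨L, hL, fun p q hp hq => abs_le.2 ⟨?_, key p q hp hq⟩⟩
  have := key q p hq hp
  rw [norm_sub_rev] at this
  linarith

theorem lipschitz_upperForce (hS : S.StandingAssumptions) (hP : P.PosDef) (hV : 0 ≤ V)
    (hreg : ∀ x ∈ ellipsoid P V, S.ν ⬝ᵥ x ≠ S.μ) : LipschitzOnBounded (S.upperForce P V) := by
  intro R
  obtain ⟨L, hL, h⟩ := exists_force_lipschitz hS hP hV hreg R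
  have key : ∀ p q : ℝ × ℝ, ‖p‖ ≤ R → ‖q‖ ≤ R →
      S.upperForce P V p - S.upperForce P V q ≤ L * ‖p - q‖ := by
    intro p q hp hq
    obtain ⟨x, hx, hxp⟩ := (isGreatest_upperForce hP hV hreg p).1
    have h1 := le_upperForce hP hV hreg q hx
    have h2 := (abs_le.1 (h x hx p q hp hq)).2
    linarith
  refine ⟨L, hL, fun p q hp hq => abs_le.2 ⟨?_, key p q hp hq⟩⟩
  have := key q p hq hp
  rw [norm_sub_rev] at this
  linarith

theorem lowerForce_anti (hP : P.PosDef) {V V' : ℝ} (hV : 0 ≤ V) (hVV' : V ≤ V')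
    (hreg : ∀ x ∈ ellipsoid P V', S.ν ⬝ᵥ x ≠ S.μ) (p : ℝ × ℝ) :
    S.lowerForce P V' p ≤ S.lowerForce P V p := by
  have hreg' : ∀ x ∈ ellipsoid P V, S.ν ⬝ᵥ x ≠ S.μ := fun x hx => hreg x (ellipsoid_mono hVV' hx)
  obtain ⟨x, hx, hxp⟩ := (isLeast_lowerForce hP hV hreg' p).1
  rw [← hxp]
  exact lowerForce_le hP (hV.trans hVV') hreg p (ellipsoid_mono hVV' hx)

theorem upperForce_mono (hP : P.PosDef) {V V' : ℝ} (hV : 0 ≤ V) (hVV' : V ≤ V')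
    (hreg : ∀ x ∈ ellipsoid P V', S.ν ⬝ᵥ x ≠ S.μ) (p : ℝ × ℝ) :
    S.upperForce P V p ≤ S.upperForce P V' p := by
  have hreg' : ∀ x ∈ ellipsoid P V, S.ν ⬝ᵥ x ≠ S.μ := fun x hx => hreg x (ellipsoid_mono hVV' hx)
  obtain ⟨x, hx, hxp⟩ := (isGreatest_upperForce hP hV hreg' p).1
  rw [← hxp]
  exact le_upperForce hP (hV.trans hVV') hreg p (ellipsoid_mono hVV' hx)

/-- The points at which the force does not depend on `x`. -/
def Degenerate (S : InverterSystem) (p : ℝ × ℝ) : Prop :=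
  ∃ c : ℝ, S.h p.2 = c • S.ν ∧ S.g (S.toPhase p) = c * S.μ

theorem Degenerate.force_eq {p : ℝ × ℝ} (hp : S.Degenerate p) {x : Fin 4 → ℝ}
    (hx : S.ν ⬝ᵥ x ≠ S.μ) (hμ : S.μ ≠ 0) : S.force p x = S.force p 0 := by
  obtain ⟨c, hc, hg⟩ := hp
  have h1 : S.μ - S.ν ⬝ᵥ x ≠ 0 := sub_ne_zero.2 hx.symm
  have hg' : S.g ((S.toPhase p).1, (S.toPhase p).2) = c * S.μ := hg
  have hc' : S.h (S.toPhase p).2 = c • S.ν := hc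
  simp only [force, f, hg', hc', smul_dotProduct, smul_eq_mul, dotProduct_zero, sub_zero]
  congr 1
  field_simp

/-- If the force has a local extremum in `x`, then it does not depend on `x`. -/
theorem degenerate_of_isLocalExtr {p : ℝ × ℝ} {x : Fin 4 → ℝ} (hki : S.ki ≠ 0)
    (hx : S.ν ⬝ᵥ x ≠ S.μ) (h : IsLocalExtr (S.force p) x) : S.Degenerate p := by
  have h0 : S.μ - S.ν ⬝ᵥ x ≠ 0 := sub_ne_zero.2 hx.symm
  set c := (S.g (S.toPhase p) - S.h p.2 ⬝ᵥ x) / (S.μ - S.ν ⬝ᵥ x) with hc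
  -- Along a line in direction `d` the derivative of the quotient vanishes at `x`, so the slopes of
  -- numerator and denominator are in the ratio `c`, the value of the quotient.
  have key : ∀ d : Fin 4 → ℝ, S.h p.2 ⬝ᵥ d = c * (S.ν ⬝ᵥ d) := by
    intro d
    have hline : Continuous fun t : ℝ => x + t • d := by fun_prop
    have hloc : IsLocalExtr (fun t : ℝ => S.force p (x + t • d)) 0 := by
      have h' : IsLocalExtr (S.force p) (x + (0 : ℝ) • d) := by simpa using h
      exact h'.comp_continuous (g := fun t : ℝ => x + t • d) hline.continuousAt
    have hN : HasDerivAt (fun t : ℝ => S.g (S.toPhase p) - (S.h p.2 ⬝ᵥ x + t * (S.h p.2 ⬝ᵥ d)))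
        (-(S.h p.2 ⬝ᵥ d)) 0 := by
      simpa using (((hasDerivAt_id (0 : ℝ)).mul_const (S.h p.2 ⬝ᵥ d)).const_add
        (S.h p.2 ⬝ᵥ x)).const_sub (S.g (S.toPhase p))
    have hD : HasDerivAt (fun t : ℝ => S.μ - (S.ν ⬝ᵥ x + t * (S.ν ⬝ᵥ d)))
        (-(S.ν ⬝ᵥ d)) 0 := by
      simpa using (((hasDerivAt_id (0 : ℝ)).mul_const (S.ν ⬝ᵥ d)).const_add
        (S.ν ⬝ᵥ x)).const_sub S.μ
    have hq := (hN.div hD (by simpa using h0)).const_mul S.ki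
    have hz := hloc.hasDerivAt_eq_zero (hq.congr_of_eventuallyEq
      (Eventually.of_forall fun t => by
        simp only [force, f, toPhase, dotProduct_add, dotProduct_smul, smul_eq_mul, Pi.div_apply]))
    simp only [zero_mul, add_zero] at hz
    have hz2 := (mul_eq_zero.1 hz).resolve_left hki
    rw [div_eq_zero_iff] at hz2
    have hz3 := hz2.resolve_right (pow_ne_zero 2 h0)
    rw [hc, div_mul_eq_mul_div, eq_div_iff h0]
    linarith
  have hh : S.h p.2 = c • S.ν := by
    refine dotProduct_eq _ _ fun d => ?_
    rw [key d, smul_dotProduct, smul_eq_mul]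
  refine ⟨c, hh, ?_⟩
  have h1 : c * (S.μ - S.ν ⬝ᵥ x) = S.g (S.toPhase p) - S.h p.2 ⬝ᵥ x := by
    rw [hc, div_mul_cancel₀ _ h0]
  rw [key x] at h1
  linarith

/-- A minimiser over the smaller ellipsoid lies in the interior of the larger one; if the minima
agree, it is a local minimum. -/
theorem degenerate_of_lowerForce_eq (hki : S.ki ≠ 0) (hP : P.PosDef) {V V' : ℝ} (hV : 0 ≤ V)
    (hVV' : V < V') (hreg : ∀ x ∈ ellipsoid P V', S.ν ⬝ᵥ x ≠ S.μ) {p : ℝ × ℝ}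
    (h : S.lowerForce P V p = S.lowerForce P V' p) : S.Degenerate p := by
  have hreg' : ∀ x ∈ ellipsoid P V, S.ν ⬝ᵥ x ≠ S.μ :=
    fun x hx => hreg x (ellipsoid_mono hVV'.le hx)
  obtain ⟨x, hx, hxp⟩ := (isLeast_lowerForce hP hV hreg' p).1
  refine degenerate_of_isLocalExtr hki (hreg' x hx) (Or.inl ?_)
  have hev : ∀ᶠ z in 𝓝 x, VCC P z < V' :=
    continuous_VCC.continuousAt.eventually_lt continuousAt_const (lt_of_le_of_lt hx hVV')
  filter_upwards [hev] with z hz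
  rw [hxp, h]
  exact lowerForce_le hP (hV.trans hVV'.le) hreg p hz.le

theorem degenerate_of_upperForce_eq (hki : S.ki ≠ 0) (hP : P.PosDef) {V V' : ℝ} (hV : 0 ≤ V)
    (hVV' : V < V') (hreg : ∀ x ∈ ellipsoid P V', S.ν ⬝ᵥ x ≠ S.μ) {p : ℝ × ℝ}
    (h : S.upperForce P V p = S.upperForce P V' p) : S.Degenerate p := by
  have hreg' : ∀ x ∈ ellipsoid P V, S.ν ⬝ᵥ x ≠ S.μ :=
    fun x hx => hreg x (ellipsoid_mono hVV'.le hx)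
  obtain ⟨x, hx, hxp⟩ := (isGreatest_upperForce hP hV hreg' p).1
  refine degenerate_of_isLocalExtr hki (hreg' x hx) (Or.inr ?_)
  have hev : ∀ᶠ z in 𝓝 x, VCC P z < V' :=
    continuous_VCC.continuousAt.eventually_lt continuousAt_const (lt_of_le_of_lt hx hVV')
  filter_upwards [hev] with z hz
  rw [hxp, h]
  exact le_upperForce hP (hV.trans hVV'.le) hreg p hz.le

theorem lowerForce_zero (hP : P.PosDef) (p : ℝ × ℝ) : S.lowerForce P 0 p = S.force p 0 := by
  simp [lowerForce, ellipsoid_zero hP]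

theorem upperForce_zero (hP : P.PosDef) (p : ℝ × ℝ) : S.upperForce P 0 p = S.force p 0 := by
  simp [upperForce, ellipsoid_zero hP]

end InverterSystem

namespace InverterSystem

/-! ### From the comparison system to the variables `(y, ω)`. -/

section Conversion

open MeasureTheory
open scoped Pointwise

variable {S : InverterSystem} {P : Matrix (Fin 4) (Fin 4) ℝ} {V : ℝ}

theorem lowerForce_eq_fStar (hki : 0 < S.ki) {p : ℝ × ℝ} (hp : 0 ≤ p.2) :
    S.lowerForce P V (S.ofPhase p) = S.ki * S.fStar P V p.1 p.2 := by
  have : S.force (S.ofPhase p) '' ellipsoid P V = S.ki • (S.f p.1 p.2 '' {x | VCC P x ≤ V}) := by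
    rw [← image_smul, image_image]
    exact image_congr fun x _ => by simp [force]
  rw [lowerForce, this, Real.sInf_smul_of_nonneg hki.le, fStar, if_pos hp, smul_eq_mul]

theorem upperForce_eq_fStar (hki : 0 < S.ki) {p : ℝ × ℝ} (hp : p.2 < 0) :
    S.upperForce P V (S.ofPhase p) = S.ki * S.fStar P V p.1 p.2 := by
  have : S.force (S.ofPhase p) '' ellipsoid P V = S.ki • (S.f p.1 p.2 '' {x | VCC P x ≤ V}) := by
    rw [← image_smul, image_image]
    exact image_congr fun x _ => by simp [force]
  rw [upperForce, this, Real.sSup_smul_of_nonneg hki.le, fStar, if_neg (not_le.2 hp), smul_eq_mul]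

/-- A closed orbit of the comparison system, in the variables `(θ - (kp / ki) ω, ω)`. -/
theorem IsClockwiseCycle.exists_cycleData (hS : S.StandingAssumptions) (hP : P.PosDef)
    (hV : 0 ≤ V) (hreg : ∀ x ∈ ellipsoid P V, S.ν ⬝ᵥ x ≠ S.μ) {C : Set (ℝ × ℝ)}
    (hC : S.IsClockwiseCycle P V C) :
    ∃ (T : ℝ) (y ω G : ℝ → ℝ), CycleData (S.lowerForce P V) (S.upperForce P V) T y ω G ∧
      (range fun t => (y t, ω t)) = S.ofPhase '' C := by
  obtain ⟨T, c, hT, hcc, hper, hinj, rfl, hint, -⟩ := hC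
  have hki := hS.ki_pos
  have hlm := lipschitz_lowerForce hS hP hV hreg
  have hlM := lipschitz_upperForce hS hP hV hreg
  set G : ℝ → ℝ := fun t => S.ki * S.fStar P V (c t).1 (c t).2 with hG
  have hGpos : ∀ t, 0 ≤ (c t).2 → G t = S.lowerForce P V (S.ofPhase (c t)) := fun t ht =>
    (lowerForce_eq_fStar hki ht).symm
  have hGneg : ∀ t, (c t).2 < 0 → G t = S.upperForce P V (S.ofPhase (c t)) := fun t ht =>
    (upperForce_eq_fStar hki ht).symm
  have hoc : Continuous fun t => S.ofPhase (c t) := S.continuous_ofPhase.comp hcc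
  have hc1 : Continuous fun t => S.lowerForce P V (S.ofPhase (c t)) := hlm.continuous.comp hoc
  have hc2 : Continuous fun t => S.upperForce P V (S.ofPhase (c t)) := hlM.continuous.comp hoc
  have hGmeas : Measurable G := by
    have : G = fun t => if 0 ≤ (c t).2 then S.lowerForce P V (S.ofPhase (c t))
        else S.upperForce P V (S.ofPhase (c t)) := by
      funext t
      split_ifs with h
      · exact hGpos t h
      · exact hGneg t (not_le.1 h)
    rw [this]
    refine Measurable.ite ?_ hc1.measurable hc2.measurable
    exact (isClosed_le continuous_const hcc.snd).measurableSet
  have hGloc : LocallyIntegrable G volume := by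
    refine LocallyIntegrable.mono ((hc1.abs.add hc2.abs).locallyIntegrable)
      hGmeas.aestronglyMeasurable (Eventually.of_forall fun t => ?_)
    rw [Real.norm_eq_abs, Real.norm_eq_abs]
    refine le_trans ?_ (le_abs_self _)
    change _ ≤ |S.lowerForce P V (S.ofPhase (c t))| + |S.upperForce P V (S.ofPhase (c t))|
    rcases le_or_gt 0 (c t).2 with h | h
    · rw [hGpos t h]; linarith [abs_nonneg (S.upperForce P V (S.ofPhase (c t)))]
    · rw [hGneg t h]; linarith [abs_nonneg (S.lowerForce P V (S.ofPhase (c t)))]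
  have hGint : ∀ s t : ℝ, IntervalIntegrable G volume s t := fun s t =>
    intervalIntegrable_iff.mpr <|
      (hGloc.integrableOn_isCompact isCompact_uIcc).mono_set uIoc_subset_uIcc
  have hfield : ∀ t, S.comparisonField P V (c t) = (-S.slope * G t + (c t).2, -G t) := by
    intro t
    simp only [comparisonField, hG, slope]
    congr 1
    · field_simp
    · ring
  have hFint : ∀ s t : ℝ, IntervalIntegrable (fun r => S.comparisonField P V (c r)) volume s t := by
    intro s t
    have h1 : IntervalIntegrable (fun t => -S.slope * G t + (c t).2) volume s t :=
      ((hGint s t).const_mul _).add (hcc.snd.intervalIntegrable s t)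
    have h2 : IntervalIntegrable (fun t => -G t) volume s t := (hGint s t).neg
    simp only [hfield]
    exact ⟨h1.1.prodMk h2.1, h1.2.prodMk h2.2⟩
  have hsnd : ∀ t, (c t).2 = (c 0).2 + ∫ r in (0 : ℝ)..t, -G r := by
    intro t
    have h := congrArg (ContinuousLinearMap.snd ℝ ℝ ℝ) (hint t)
    rw [map_add, ← ContinuousLinearMap.intervalIntegral_comp_comm _ (hFint 0 t)] at h
    simpa [hfield] using h
  have hfst : ∀ t, (S.ofPhase (c t)).1 = (S.ofPhase (c 0)).1 + ∫ r in (0 : ℝ)..t, (c r).2 := by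
    intro t
    -- In the combination `θ - (kp / ki) ω` the discontinuous term cancels, so `y` is continuously
    -- differentiable with `y' = ω`.
    have h := congrArg (ContinuousLinearMap.fst ℝ ℝ ℝ - S.slope • ContinuousLinearMap.snd ℝ ℝ ℝ)
      (hint t)
    rw [map_add, ← ContinuousLinearMap.intervalIntegral_comp_comm _ (hFint 0 t)] at h
    simpa [hfield, ofPhase] using h
  refine ⟨T, fun t => (S.ofPhase (c t)).1, fun t => (c t).2, G, ?_, ?_⟩
  · refine
      { period_pos := hT
        continuous_ω := hcc.snd
        periodic_y := fun t => by simp only [hper t]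
        periodic_ω := fun t => by simp only [hper t]
        inj := ?_
        hasDerivAt_y := ?_
        locallyIntegrable := hGloc
        ω_sub := ?_
        G_pos := fun t ht => hGpos t ht.le
        G_neg := fun t ht => hGneg t ht
        G_zero := fun t ht => ?_
        lipschitz_m := hlm
        lipschitz_M := hlM
        le := lowerForce_le_upperForce hP hV hreg }
    · intro s t h1 h2
      have hst : c s = c t := by
        have h3 : S.ofPhase (c s) = S.ofPhase (c t) := Prod.ext h1 h2
        simpa using congrArg S.toPhase h3
      obtain ⟨s', hs', hcs⟩ : ∃ n : ℤ, s + n • T ∈ Ico 0 T ∧ c (s + n • T) = c s := by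
        obtain ⟨n, hn, -⟩ := existsUnique_add_zsmul_mem_Ico hT s 0
        exact ⟨n, by simpa using hn, hper.zsmul n s⟩
      obtain ⟨t', ht', hct⟩ : ∃ n : ℤ, t + n • T ∈ Ico 0 T ∧ c (t + n • T) = c t := by
        obtain ⟨n, hn, -⟩ := existsUnique_add_zsmul_mem_Ico hT t 0
        exact ⟨n, by simpa using hn, hper.zsmul n t⟩
      have := hinj hs' ht' (by rw [hcs, hct, hst])
      refine ⟨s' - t', ?_⟩
      rw [zsmul_eq_mul, zsmul_eq_mul] at this
      push_cast
      linarith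
    · intro t
      have h := (intervalIntegral.integral_hasDerivAt_right
        (hcc.snd.intervalIntegrable 0 t) (hcc.snd.stronglyMeasurableAtFilter _ _)
        hcc.snd.continuousAt).const_add (S.ofPhase (c 0)).1
      exact h.congr_of_eventuallyEq (Eventually.of_forall hfst)
    · intro s t
      rw [hsnd t, hsnd s, intervalIntegral.integral_neg, intervalIntegral.integral_neg,
        ← intervalIntegral.integral_add_adjacent_intervals (hGint 0 s) (hGint s t)]
      ring
    · have h := hGpos t ht.ge
      have h' := lowerForce_le_upperForce hP hV hreg (S.ofPhase (c t))
      change S.lowerForce P V (S.ofPhase (c t)) ≤ G t ∧ G t ≤ S.upperForce P V (S.ofPhase (c t))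
      rw [h]
      exact ⟨le_rfl, h'⟩
  · rw [← range_comp]
    rfl

/-- A clockwise cycle meets both half-axes. -/
theorem IsClockwiseCycle.exists_axis_points {C : Set (ℝ × ℝ)} (hC : S.IsClockwiseCycle P V C) :
    (∃ y < 0, (y, (0 : ℝ)) ∈ S.ofPhase '' C) ∧ ∃ y > 0, (y, (0 : ℝ)) ∈ S.ofPhase '' C := by
  obtain ⟨T, c, hT, -, -, -, rfl, -, r, φ, -, hφ, hr, hcφ, hφT⟩ := hC
  have hval : ∀ α : ℝ, ∃ (k : ℤ) (t : ℝ), φ t = α + k * (2 * Real.pi) := by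
    intro α
    have hpi : 0 < 2 * Real.pi := by positivity
    -- During one period the angle runs continuously through an interval of length `2 π`, so it
    -- takes every value modulo `2 π`.
    obtain ⟨n, hn, -⟩ := existsUnique_add_zsmul_mem_Ioc hpi α (φ 0 - 2 * Real.pi)
    rw [zsmul_eq_mul, sub_add_cancel] at hn
    have h0 : φ T = φ 0 - 2 * Real.pi := by simpa using hφT 0
    obtain ⟨t, -, ht⟩ := intermediate_value_Icc' hT.le hφ.continuousOn
      (⟨by rw [h0]; exact hn.1.le, hn.2⟩ : α + n * (2 * Real.pi) ∈ Icc (φ T) (φ 0))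
    exact ⟨n, t, ht⟩
  constructor
  · obtain ⟨k, t, ht⟩ := hval Real.pi
    refine ⟨-r t, neg_lt_zero.2 (hr t), c t, mem_range_self t, ?_⟩
    rw [hcφ t, ht, Real.cos_add_int_mul_two_pi, Real.sin_add_int_mul_two_pi]
    simp [ofPhase]
  · obtain ⟨k, t, ht⟩ := hval 0
    refine ⟨r t, hr t, c t, mem_range_self t, ?_⟩
    rw [hcφ t, ht, Real.cos_add_int_mul_two_pi, Real.sin_add_int_mul_two_pi]
    simp [ofPhase]

theorem IsClockwiseCycle.exists_oval (hS : S.StandingAssumptions) (hP : P.PosDef)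
    (hV : 0 ≤ V) (hreg : ∀ x ∈ ellipsoid P V, S.ν ⬝ᵥ x ≠ S.μ) {C : Set (ℝ × ℝ)}
    (hC : S.IsClockwiseCycle P V C) :
    ∃ (a b : ℝ) (eu el : ℝ → ℝ),
      Oval (S.lowerForce P V) (S.upperForce P V) a b eu el (S.ofPhase '' C) ∧ a < 0 ∧ 0 < b := by
  obtain ⟨T, y, ω, G, D, hr⟩ := hC.exists_cycleData hS hP hV hreg
  obtain ⟨a, b, eu, el, O⟩ := D.exists_oval
  rw [hr] at O
  obtain ⟨⟨y₁, h1, h1'⟩, ⟨y₂, h2, h2'⟩⟩ := hC.exists_axis_points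
  exact ⟨a, b, eu, el, O, ((O.mem_iff _).1 h1').1.1.trans_lt h1,
    lt_of_lt_of_le h2 ((O.mem_iff _).1 h2').1.2⟩

end Conversion

/-! ### Damping near the origin without input. -/

section Linearization

variable {S : InverterSystem}

theorem force_zero (p : ℝ × ℝ) : S.force p 0 = S.ki * (S.g (S.toPhase p) / S.μ) := by
  simp [force, f]

/-- Near the origin the force with `x = 0` is a positive combination of `y` and `ω`. -/
theorem exists_force_linearization (hS : S.StandingAssumptions) :
    ∃ α β : ℝ, 0 < α ∧ 0 < β ∧ ∀ ε > 0, ∀ᶠ p : ℝ × ℝ in 𝓝 0,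
      |S.force p 0 - (α * p.1 + β * p.2)| ≤ ε * ‖p‖ := by
  have hg : HasFDerivAt S.g (fderiv ℝ S.g (0, 0)) (0, 0) :=
    (hS.g_contDiff.differentiable one_ne_zero).differentiableAt.hasFDerivAt
  set Dg := fderiv ℝ S.g (0, 0) with hDg
  set fθ := Dg (1, 0) / S.μ with hfθ
  set fω := Dg (0, 1) / S.μ with hfω
  have hd1 : deriv (fun s => S.f s 0 0) 0 = fθ := by
    have h : HasDerivAt (fun s : ℝ => S.g (s, 0)) (Dg (1, 0)) 0 :=
      hg.comp_hasDerivAt (f := fun s : ℝ => (s, (0 : ℝ))) 0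
          ((hasDerivAt_id (0 : ℝ)).prodMk (hasDerivAt_const 0 (0 : ℝ)))
    have : (fun s => S.f s 0 0) = fun s => S.g (s, 0) / S.μ := by funext s; simp [f]
    rw [this]
    exact (h.div_const S.μ).deriv
  have hd2 : deriv (fun s => S.f 0 s 0) 0 = fω := by
    have h : HasDerivAt (fun s : ℝ => S.g (0, s)) (Dg (0, 1)) 0 :=
      hg.comp_hasDerivAt (f := fun s : ℝ => ((0 : ℝ), s)) 0
          ((hasDerivAt_const 0 (0 : ℝ)).prodMk (hasDerivAt_id (0 : ℝ)))
    have : (fun s => S.f 0 s 0) = fun s => S.g (0, s) / S.μ := by funext s; simp [f]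
    rw [this]
    exact (h.div_const S.μ).deriv
  -- These are the determinant and minus the trace of the Jacobian. For a non-real eigenvalue `z`
  -- they equal `|z| ^ 2` and `-2 Re z`.
  have hα : 0 < S.ki * fθ ∧ 0 < S.kp * fθ + S.ki * fω := by
    obtain ⟨z, hz⟩ := spectrum.nonempty_of_isAlgClosed_of_finiteDimensional ℂ
      (S.jacobian.map (fun a : ℝ => (a : ℂ)))
    obtain ⟨hre, him⟩ := hS.oscillatory z hz
    rw [Matrix.mem_spectrum_iff_isRoot_charpoly, Matrix.charpoly_fin_two, Polynomial.IsRoot.def]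
      at hz
    simp only [jacobian, hd1, hd2, Matrix.trace_fin_two, Matrix.det_fin_two, Matrix.map_apply,
      Matrix.of_apply, Matrix.cons_val', Matrix.cons_val_zero, Matrix.cons_val_one,
      Matrix.cons_val_fin_one, Polynomial.eval_add, Polynomial.eval_sub, Polynomial.eval_pow,
      Polynomial.eval_X, Polynomial.eval_mul, Polynomial.eval_C] at hz
    have e1 := congrArg Complex.re hz
    have e2 := congrArg Complex.im hz
    simp [pow_two] at e1 e2
    have h3 : S.kp * fθ + S.ki * fω = -2 * z.re := by
      have : z.im * (2 * z.re + (S.kp * fθ + S.ki * fω)) = 0 := by linarith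
      have := (mul_eq_zero.1 this).resolve_left him
      linarith
    have h4 : S.ki * fθ = z.re ^ 2 + z.im ^ 2 := by
      have h5 : S.ki * fθ = -(z.re * z.re - z.im * z.im) - (S.kp * fθ + S.ki * fω) * z.re := by
        linarith
      rw [h3] at h5
      linarith
    constructor
    · rw [h4]
      have := sq_nonneg z.re
      have := sq_pos_of_ne_zero him
      linarith
    · rw [h3]; linarith
  refine ⟨S.ki * fθ, S.kp * fθ + S.ki * fω, hα.1, hα.2, ?_⟩
  have hto : HasFDerivAt S.toPhase ((ContinuousLinearMap.fst ℝ ℝ ℝ +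
      S.slope • ContinuousLinearMap.snd ℝ ℝ ℝ).prod (ContinuousLinearMap.snd ℝ ℝ ℝ)) (0, 0) :=
    ((ContinuousLinearMap.fst ℝ ℝ ℝ +
      S.slope • ContinuousLinearMap.snd ℝ ℝ ℝ).prod (ContinuousLinearMap.snd ℝ ℝ ℝ)).hasFDerivAt
  have ht0 : S.toPhase (0, 0) = (0, 0) := by simp [toPhase]
  have hcomp := (HasFDerivAt.comp ((0 : ℝ), (0 : ℝ)) (by rw [ht0]; exact hg) hto).const_mul
    (S.ki / S.μ)
  intro ε hε
  have ho := hcomp.isLittleO.def hε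
  filter_upwards [ho] with p hp
  have hlin : Dg (S.toPhase p) = p.1 * Dg (1, 0) + (S.slope * p.1 * 0 + (S.slope * Dg (1, 0) +
      Dg (0, 1)) * p.2) := by
    have : S.toPhase p = (p.1 + S.slope * p.2) • ((1 : ℝ), (0 : ℝ)) + p.2 • ((0 : ℝ), (1 : ℝ)) := by
      simp [toPhase]
    rw [this, map_add, map_smul, map_smul, smul_eq_mul, smul_eq_mul]
    ring
  have hμ := hS.mu_ne
  have hki := hS.ki_pos.ne'
  have hp0 : p - ((0 : ℝ), (0 : ℝ)) = p := by simp
  have hconv : S.force p 0 - (S.ki * fθ * p.1 + (S.kp * fθ + S.ki * fω) * p.2) =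
      S.ki / S.μ * (S.g (S.toPhase p) - Dg (S.toPhase p)) := by
    rw [force_zero, hlin, hfθ, hfω, slope]
    field_simp
    ring
  rw [hp0] at hp
  rw [hconv, ← Real.norm_eq_abs]
  refine le_trans (le_of_eq ?_) hp
  simp only [Function.comp_apply, ht0, hS.g_zero, mul_zero, sub_zero,
    _root_.smul_apply, ContinuousLinearMap.comp_apply, smul_eq_mul]
  congr 1
  rw [mul_sub]
  rfl

/-- Close to the origin the system with `x = 0` has no closed orbits. -/
theorem exists_no_small_cycle (hS : S.StandingAssumptions) :
    ∃ δ > 0, ∀ (T : ℝ) (y ω : ℝ → ℝ), 0 < T → Function.Periodic y T → Function.Periodic ω T →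
      (∀ t, HasDerivAt y (ω t) t) → (∀ t, HasDerivAt ω (-S.force (y t, ω t) 0) t) →
      (∀ t, ‖(y t, ω t)‖ < δ) → ∃ t, (y t, ω t) = (0, 0) := by
  obtain ⟨α, β, hα, hβ, hlin⟩ := exists_force_linearization hS
  -- The weight of the mixed term `y ω` in `E`: it must produce `-d α y ^ 2` while costing at most
  -- half of the damping `-β ω ^ 2`.
  obtain ⟨d, hd, hd1⟩ : ∃ d > 0, d * (1 + β ^ 2 / (2 * α)) ≤ β / 2 := by
    refine ⟨β / 2 / (1 + β ^ 2 / (2 * α)), by positivity, ?_⟩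
    rw [div_mul_cancel₀]
    positivity
  have hε : 0 < min (β / 2) (d * α / 2) / (4 * (1 + d)) := by positivity
  -- With this tolerance the nonlinear remainder consumes at most a quarter of the quadratic decay,
  -- so `E` strictly decreases, contrary to periodicity.
  set ε := min (β / 2) (d * α / 2) / (4 * (1 + d)) with hεdef
  obtain ⟨δ, hδ, hball⟩ := Metric.eventually_nhds_iff.1 (hlin ε hε)
  refine ⟨δ, hδ, fun T y ω hT hy hω hyd hωd hsmall => ?_⟩
  by_contra! hne
  set E : ℝ → ℝ := fun t => ω t ^ 2 / 2 + α * y t ^ 2 / 2 + d * (y t * ω t) with hE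
  have hEd : ∀ t, HasDerivAt E (ω t * -S.force (y t, ω t) 0 + α * (y t * ω t) +
      d * (ω t * ω t + y t * -S.force (y t, ω t) 0)) t := by
    intro t
    have h := ((((hωd t).pow 2).div_const 2).add ((((hyd t).pow 2).const_mul α).div_const 2)).add
      (((hyd t).mul (hωd t)).const_mul d)
    refine h.congr_deriv ?_
    push_cast
    ring
  have hneg : ∀ t, ω t * -S.force (y t, ω t) 0 + α * (y t * ω t) +
      d * (ω t * ω t + y t * -S.force (y t, ω t) 0) < 0 := by
    intro t
    have hr := hball (y := (y t, ω t)) (by simpa [dist_eq_norm] using hsmall t)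
    simp only at hr
    set r := S.force (y t, ω t) 0 - (α * y t + β * ω t) with hrdef
    have hF : S.force (y t, ω t) 0 = α * y t + β * ω t + r := by rw [hrdef]; ring
    set n := ‖(y t, ω t)‖ with hn
    have hn0 : 0 < n := norm_pos_iff.2 (hne t)
    have hyn : |y t| ≤ n := norm_fst_le (y t, ω t)
    have hωn : |ω t| ≤ n := norm_snd_le (y t, ω t)
    have hsum : n ^ 2 ≤ y t ^ 2 + ω t ^ 2 := by
      have : n = max |y t| |ω t| := rfl
      rcases max_choice |y t| |ω t| with h | h <;> rw [this, h, sq_abs]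
      · nlinarith [sq_nonneg (ω t)]
      · nlinarith [sq_nonneg (y t)]
    have hr1 : -(ω t * r) ≤ n * (ε * n) := by
      rw [← abs_of_nonneg (by positivity : 0 ≤ n * (ε * n))]
      refine (neg_le_abs _).trans ?_
      rw [abs_mul, abs_of_nonneg (by positivity : 0 ≤ n * (ε * n))]
      gcongr
    have hr2 : -(y t * r) ≤ n * (ε * n) := by
      refine (neg_le_abs _).trans ?_
      rw [abs_mul]
      gcongr
    have hy2 : -(β * (y t * ω t)) ≤ α / 2 * y t ^ 2 + β ^ 2 / (2 * α) * ω t ^ 2 := by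
      have h : 0 ≤ α / 2 * (y t + β / α * ω t) ^ 2 := by positivity
      have e : α / 2 * (y t + β / α * ω t) ^ 2 =
          α / 2 * y t ^ 2 + β ^ 2 / (2 * α) * ω t ^ 2 + β * (y t * ω t) := by
        field_simp
        ring
      linarith
    have hmain : ω t * -S.force (y t, ω t) 0 + α * (y t * ω t) +
        d * (ω t * ω t + y t * -S.force (y t, ω t) 0) ≤
        -(β / 2) * ω t ^ 2 - d * α / 2 * y t ^ 2 + (1 + d) * (n * (ε * n)) := by
      rw [hF]
      have h1 := mul_le_mul_of_nonneg_left hy2 hd.le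
      have h2 := mul_le_mul_of_nonneg_left hr2 hd.le
      have h3 := mul_le_mul_of_nonneg_right hd1 (sq_nonneg (ω t))
      linarith
    have hmin1 := min_le_left (β / 2) (d * α / 2)
    have hmin2 := min_le_right (β / 2) (d * α / 2)
    have hmin0 : 0 < min (β / 2) (d * α / 2) := by positivity
    have hεn : (1 + d) * (n * (ε * n)) = min (β / 2) (d * α / 2) / 4 * n ^ 2 := by
      rw [hεdef]
      field_simp
    rw [hεn] at hmain
    have h4 : min (β / 2) (d * α / 2) * ω t ^ 2 ≤ β / 2 * ω t ^ 2 := by gcongr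
    have h5 : min (β / 2) (d * α / 2) * y t ^ 2 ≤ d * α / 2 * y t ^ 2 := by gcongr
    have h6 : min (β / 2) (d * α / 2) * n ^ 2 ≤ min (β / 2) (d * α / 2) * (y t ^ 2 + ω t ^ 2) := by
      gcongr
    have h7 : 0 < min (β / 2) (d * α / 2) * n ^ 2 := by positivity
    linarith
  have hanti : StrictAnti E := strictAnti_of_hasDerivAt_neg hEd hneg
  have := hanti hT
  have h0 : E T = E 0 := by
    have h1 : y T = y 0 := by simpa using hy 0
    have h2 : ω T = ω 0 := by simpa using hω 0
    simp only [hE, h1, h2]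
  linarith

end Linearization

end InverterSystem

/-- Closed sets which do not meet a compact set stay away from all its small perturbations. -/
theorem exists_pos_forall_le_dist {K R : Set (ℝ × ℝ)} (hK : IsCompact K) (hR : IsClosed R)
    (h : Disjoint K R) : ∃ δ > 0, ∀ p ∈ K, ∀ q ∈ R, δ ≤ dist p q := by
  obtain ⟨r, hr, h⟩ := Metric.exists_pos_forall_lt_edist hK hR h
  refine ⟨r, hr, fun p hp q hq => ?_⟩
  have := h p hp q hq
  rw [edist_nndist, ENNReal.coe_lt_coe] at this
  exact (NNReal.coe_lt_coe.2 this).le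

/-! ### The family of ovals: monotonicity in `V` and foliation of the largest hull. -/

namespace InverterSystem

/-- The family of cycles in the variables `(θ - (kp / ki) ω, ω)`, with their decomposition into
arcs. -/
structure OvalFamily (S : InverterSystem) (P : Matrix (Fin 4) (Fin 4) ℝ) (Vbar : ℝ)
    (C : ℝ → Set (ℝ × ℝ)) (a b : ℝ → ℝ) (eu el : ℝ → ℝ → ℝ) : Prop where
  standing : S.StandingAssumptions
  posDef : P.PosDef
  nonneg : 0 ≤ Vbar
  reg : ∀ x ∈ ellipsoid P Vbar, S.ν ⬝ᵥ x ≠ S.μ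
  zero : C 0 = {(0, 0)}
  cycle : ∀ V ∈ Ioc 0 Vbar, ∃ (T : ℝ) (y ω G : ℝ → ℝ),
    CycleData (S.lowerForce P V) (S.upperForce P V) T y ω G ∧ (range fun t => (y t, ω t)) = C V
  oval : ∀ V ∈ Ioc 0 Vbar,
    Oval (S.lowerForce P V) (S.upperForce P V) (a V) (b V) (eu V) (el V) (C V)
  left_neg : ∀ V ∈ Ioc 0 Vbar, a V < 0
  right_pos : ∀ V ∈ Ioc 0 Vbar, 0 < b V
  left_zero : a 0 = 0
  right_zero : b 0 = 0
  close : ∀ V₀ ∈ Icc 0 Vbar, ∀ δ > 0, ∀ᶠ V in 𝓝[Icc 0 Vbar] V₀,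
    (∀ p ∈ C V, ∃ q ∈ C V₀, dist p q < δ) ∧ ∀ p ∈ C V₀, ∃ q ∈ C V, dist p q < δ

theorem IsCycleFamily.exists_ovalFamily {S : InverterSystem} (hS : S.StandingAssumptions)
    {P : Matrix (Fin 4) (Fin 4) ℝ} (hP : P.PosDef) {Vbar : ℝ} (hVbar : 0 ≤ Vbar)
    (hreg : ∀ x ∈ ellipsoid P Vbar, S.ν ⬝ᵥ x ≠ S.μ) {C : ℝ → Set (ℝ × ℝ)}
    (hC : S.IsCycleFamily P Vbar C) :
    ∃ (a b : ℝ → ℝ) (eu el : ℝ → ℝ → ℝ),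
      OvalFamily S P Vbar (fun V => S.ofPhase '' C V) a b eu el := by
  have hreg' : ∀ V ∈ Ioc 0 Vbar, ∀ x ∈ ellipsoid P V, S.ν ⬝ᵥ x ≠ S.μ :=
    fun V hV x hx => hreg x (ellipsoid_mono hV.2 hx)
  have hex : ∀ V, ∃ (a b : ℝ) (eu el : ℝ → ℝ), (V ∈ Ioc 0 Vbar →
      Oval (S.lowerForce P V) (S.upperForce P V) a b eu el (S.ofPhase '' C V) ∧ a < 0 ∧ 0 < b) ∧
      (V = 0 → a = 0 ∧ b = 0) := by
    intro V
    by_cases hV : V ∈ Ioc 0 Vbar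
    · obtain ⟨a, b, eu, el, h⟩ := (hC.cycle V hV).exists_oval hS hP hV.1.le (hreg' V hV)
      exact ⟨a, b, eu, el, fun _ => h, fun h0 => absurd hV.1 (by rw [h0]; exact lt_irrefl _)⟩
    -- At `V = 0` the ends have to be `0`, so that they depend continuously on `V` down to the
    -- trivial cycle.
    · exact ⟨0, 0, 0, 0, fun h => absurd h hV, fun _ => ⟨rfl, rfl⟩⟩
  choose a b eu el h using hex
  have hcpt : ∀ V ∈ Icc 0 Vbar, IsCompact (C V) ∧ (C V).Nonempty := by
    intro V hV
    rcases eq_or_lt_of_le hV.1 with h0 | h0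
    · rw [← h0, hC.zero]; exact ⟨isCompact_singleton, singleton_nonempty _⟩
    · have h1 := (h V).1 ⟨h0, hV.2⟩
      have e : C V = S.toPhase '' (S.ofPhase '' C V) := by rw [image_image]; simp
      rw [e]
      exact ⟨h1.1.isCompact.image S.contDiff_toPhase.continuous,
        ⟨_, mem_image_of_mem _ h1.1.left_mem⟩⟩
  have hdist : ∀ p q : ℝ × ℝ, dist (S.ofPhase p) (S.ofPhase q) ≤ (1 + |S.slope|) * dist p q := by
    intro p q
    have h1 : |p.1 - q.1| ≤ dist p q := by
      rw [dist_eq_norm]; exact norm_fst_le (p - q)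
    have h2 : |p.2 - q.2| ≤ dist p q := by
      rw [dist_eq_norm]; exact norm_snd_le (p - q)
    have h0 : 0 ≤ dist p q := dist_nonneg
    rw [dist_eq_norm, Prod.norm_def]
    refine max_le ?_ ?_ <;> simp only [ofPhase, Prod.fst_sub, Prod.snd_sub, Real.norm_eq_abs]
    · calc |p.1 - S.slope * p.2 - (q.1 - S.slope * q.2)|
          = |(p.1 - q.1) - S.slope * (p.2 - q.2)| := by congr 1; ring
        _ ≤ |p.1 - q.1| + |S.slope * (p.2 - q.2)| := abs_sub _ _
        _ ≤ dist p q + |S.slope| * dist p q := by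
          rw [abs_mul]; gcongr
        _ = _ := by ring
    · nlinarith [abs_nonneg S.slope]
  refine ⟨a, b, eu, el, hS, hP, hVbar, hreg, by simp [hC.zero, ofPhase],
    fun V hV => (hC.cycle V hV).exists_cycleData hS hP hV.1.le (hreg' V hV),
    fun V hV => ((h V).1 hV).1, fun V hV => ((h V).1 hV).2.1, fun V hV => ((h V).1 hV).2.2,
    ((h 0).2 rfl).1, ((h 0).2 rfl).2, fun V₀ hV₀ δ hδ => ?_⟩
  have hδ' : 0 < δ / (1 + |S.slope|) := by positivity
  have hlt : ∀ p q : ℝ × ℝ, dist p q < δ / (1 + |S.slope|) →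
      dist (S.ofPhase p) (S.ofPhase q) < δ := by
    intro p q hpq
    refine (hdist p q).trans_lt ?_
    rw [lt_div_iff₀ (by positivity)] at hpq
    linarith
  filter_upwards [(hC.continuous V₀ hV₀).eventually (gt_mem_nhds hδ'), self_mem_nhdsWithin]
    with V hV hVmem
  obtain ⟨hc, hne⟩ := hcpt V hVmem
  obtain ⟨hc₀, hne₀⟩ := hcpt V₀ hV₀
  -- Finiteness matters: `Metric.hausdorffDist` is `0` by default when the extended distance is
  -- infinite.
  have hfin := Metric.hausdorffEDist_ne_top_of_nonempty_of_bounded hne hne₀ hc.isBounded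
    hc₀.isBounded
  constructor
  · rintro _ ⟨p, hp, rfl⟩
    obtain ⟨q, hq, hpq⟩ := Metric.exists_dist_lt_of_hausdorffDist_lt hp hV hfin
    exact ⟨_, mem_image_of_mem _ hq, hlt p q hpq⟩
  · rintro _ ⟨p, hp, rfl⟩
    obtain ⟨q, hq, hpq⟩ := Metric.exists_dist_lt_of_hausdorffDist_lt' hp hV hfin
    rw [dist_comm] at hpq
    exact ⟨_, mem_image_of_mem _ hq, hlt p q hpq⟩

/-- The factor is determined by `g` since `μ ≠ 0`; this exhibits degeneracy as a closed condition.
-/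
theorem degenerate_iff {S : InverterSystem} (hμ : S.μ ≠ 0) (p : ℝ × ℝ) :
    S.Degenerate p ↔ S.h p.2 = (S.g (S.toPhase p) / S.μ) • S.ν := by
  constructor
  · rintro ⟨c, h, hg⟩
    rw [hg, mul_div_cancel_right₀ _ hμ, h]
  · intro h
    exact ⟨_, h, (div_mul_cancel₀ _ hμ).symm⟩

theorem isClosed_degenerate {S : InverterSystem} (hS : S.StandingAssumptions) :
    IsClosed {p | S.Degenerate p} := by
  simp only [degenerate_iff hS.mu_ne]
  have h1 : Continuous fun p : ℝ × ℝ => S.h p.2 := hS.h_contDiff.continuous.comp continuous_snd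
  have h2 : Continuous fun p : ℝ × ℝ => S.g (S.toPhase p) :=
    hS.g_contDiff.continuous.comp S.contDiff_toPhase.continuous
  exact isClosed_eq h1 ((h2.div_const _).smul continuous_const)

namespace OvalFamily

variable {S : InverterSystem} {P : Matrix (Fin 4) (Fin 4) ℝ} {Vbar : ℝ} {C : ℝ → Set (ℝ × ℝ)}
  {a b : ℝ → ℝ} {eu el : ℝ → ℝ → ℝ}

theorem reg' (O : OvalFamily S P Vbar C a b eu el) {V : ℝ} (hV : V ≤ Vbar) :
    ∀ x ∈ ellipsoid P V, S.ν ⬝ᵥ x ≠ S.μ := fun x hx => O.reg x (ellipsoid_mono hV hx)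

theorem lipschitz_lower (O : OvalFamily S P Vbar C a b eu el) {V : ℝ} (hV : V ∈ Icc 0 Vbar) :
    LipschitzOnBounded (S.lowerForce P V) :=
  lipschitz_lowerForce O.standing O.posDef hV.1 (O.reg' hV.2)

theorem lipschitz_upper (O : OvalFamily S P Vbar C a b eu el) {V : ℝ} (hV : V ∈ Icc 0 Vbar) :
    LipschitzOnBounded (S.upperForce P V) :=
  lipschitz_upperForce O.standing O.posDef hV.1 (O.reg' hV.2)

theorem isCompact (O : OvalFamily S P Vbar C a b eu el) {V : ℝ} (hV : V ∈ Icc 0 Vbar) :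
    IsCompact (C V) := by
  rcases eq_or_lt_of_le hV.1 with h | h
  · rw [← h, O.zero]; exact isCompact_singleton
  · exact (O.oval V ⟨h, hV.2⟩).isCompact

theorem right_mem (O : OvalFamily S P Vbar C a b eu el) {V : ℝ} (hV : V ∈ Icc 0 Vbar) :
    (b V, (0 : ℝ)) ∈ C V := by
  rcases eq_or_lt_of_le hV.1 with h | h
  · rw [← h, O.zero, O.right_zero]; rfl
  · exact (O.oval V ⟨h, hV.2⟩).right_mem

theorem left_mem (O : OvalFamily S P Vbar C a b eu el) {V : ℝ} (hV : V ∈ Icc 0 Vbar) :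
    (a V, (0 : ℝ)) ∈ C V := by
  rcases eq_or_lt_of_le hV.1 with h | h
  · rw [← h, O.zero, O.left_zero]; rfl
  · exact (O.oval V ⟨h, hV.2⟩).left_mem

theorem fst_mem (O : OvalFamily S P Vbar C a b eu el) {V : ℝ} (hV : V ∈ Icc 0 Vbar) {p : ℝ × ℝ}
    (hp : p ∈ C V) : p.1 ∈ Icc (a V) (b V) := by
  rcases eq_or_lt_of_le hV.1 with h | h
  · rw [← h, O.zero] at hp
    rw [← h, O.left_zero, O.right_zero, mem_singleton_iff.1 hp]
    exact ⟨le_rfl, le_rfl⟩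
  · exact (((O.oval V ⟨h, hV.2⟩).mem_iff _).1 hp).1

/-- `b V` is the largest first coordinate on `C V`, so curves that are `δ`-close have `δ`-close
right ends. -/
theorem continuousOn_right (O : OvalFamily S P Vbar C a b eu el) : ContinuousOn b (Icc 0 Vbar) := by
  intro V₀ hV₀
  rw [ContinuousWithinAt, Metric.tendsto_nhds]
  intro δ hδ
  filter_upwards [O.close V₀ hV₀ δ hδ, self_mem_nhdsWithin] with V ⟨h1, h2⟩ hV
  obtain ⟨q, hq, hpq⟩ := h1 _ (O.right_mem hV)
  obtain ⟨q', hq', hpq'⟩ := h2 _ (O.right_mem hV₀)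
  have h3 := (O.fst_mem hV₀ hq).2
  have h4 := (O.fst_mem hV hq').2
  have h5 : |b V - q.1| < δ := lt_of_le_of_lt (by
    rw [dist_eq_norm]; exact norm_fst_le ((b V, (0 : ℝ)) - q)) hpq
  have h6 : |b V₀ - q'.1| < δ := lt_of_le_of_lt (by
    rw [dist_eq_norm]; exact norm_fst_le ((b V₀, (0 : ℝ)) - q')) hpq'
  rw [Real.dist_eq, abs_lt]
  rw [abs_lt] at h5 h6
  constructor <;> linarith [h5.2, h6.2]

theorem continuousOn_left (O : OvalFamily S P Vbar C a b eu el) : ContinuousOn a (Icc 0 Vbar) := by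
  intro V₀ hV₀
  rw [ContinuousWithinAt, Metric.tendsto_nhds]
  intro δ hδ
  filter_upwards [O.close V₀ hV₀ δ hδ, self_mem_nhdsWithin] with V ⟨h1, h2⟩ hV
  obtain ⟨q, hq, hpq⟩ := h1 _ (O.left_mem hV)
  obtain ⟨q', hq', hpq'⟩ := h2 _ (O.left_mem hV₀)
  have h3 := (O.fst_mem hV₀ hq).1
  have h4 := (O.fst_mem hV hq').1
  have h5 : |a V - q.1| < δ := lt_of_le_of_lt (by
    rw [dist_eq_norm]; exact norm_fst_le ((a V, (0 : ℝ)) - q)) hpq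
  have h6 : |a V₀ - q'.1| < δ := lt_of_le_of_lt (by
    rw [dist_eq_norm]; exact norm_fst_le ((a V₀, (0 : ℝ)) - q')) hpq'
  rw [Real.dist_eq, abs_lt]
  rw [abs_lt] at h5 h6
  constructor <;> linarith [h5.1, h6.1]

/-- The field cannot be independent of `x` near the axis `ω = 0` if the cycles shrink to the
origin. -/
theorem not_eventually_h_eq_zero (O : OvalFamily S P Vbar C a b eu el) (hVbar : 0 < Vbar)
    (hν : S.ν = 0) : ¬ ∀ᶠ w in 𝓝 (0 : ℝ), S.h w = 0 := by
  intro hh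
  obtain ⟨ε, hε, hh⟩ := Metric.eventually_nhds_iff.1 hh
  obtain ⟨δ, hδ, hno⟩ := exists_no_small_cycle O.standing
  have hcl := O.close 0 ⟨le_rfl, O.nonneg⟩ (min ε δ) (lt_min hε hδ)
  have hsub : Ioc 0 Vbar ⊆ Icc 0 Vbar := Ioc_subset_Icc_self
  have hcl' := hcl.filter_mono (nhdsWithin_mono _ hsub)
  rw [nhdsWithin_Ioc_eq_nhdsGT hVbar] at hcl'
  obtain ⟨V, ⟨h1, -⟩, hV⟩ := (hcl'.and (Ioc_mem_nhdsGT hVbar)).exists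
  obtain ⟨T, y, ω, G, D, hr⟩ := O.cycle V hV
  have hsmall : ∀ t, ‖(y t, ω t)‖ < min ε δ := by
    intro t
    obtain ⟨q, hq, hpq⟩ := h1 (y t, ω t) (by rw [← hr]; exact mem_range_self t)
    rw [O.zero, mem_singleton_iff] at hq
    rw [hq] at hpq
    simpa [dist_eq_norm] using hpq
  -- On a cycle this close to the origin `h` vanishes, and `ν = 0`, so the two fields coincide with
  -- the force at `x = 0` and the orbit is an ordinary closed solution.
  have hdeg : ∀ t, S.Degenerate (y t, ω t) := by
    intro t
    rw [degenerate_iff O.standing.mu_ne, hν, smul_zero]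
    refine hh ?_
    rw [dist_zero_right]
    exact (norm_snd_le (y t, ω t)).trans_lt ((hsmall t).trans_le (min_le_left _ _))
  have hG : ∀ t, G t = S.force (y t, ω t) 0 := by
    intro t
    obtain ⟨x, hx, hxm⟩ := (isLeast_lowerForce O.posDef hV.1.le (O.reg' hV.2) (y t, ω t)).1
    obtain ⟨x', hx', hxM⟩ := (isGreatest_upperForce O.posDef hV.1.le (O.reg' hV.2) (y t, ω t)).1
    rw [(hdeg t).force_eq (O.reg' hV.2 x hx) O.standing.mu_ne] at hxm
    rw [(hdeg t).force_eq (O.reg' hV.2 x' hx') O.standing.mu_ne] at hxM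
    rcases lt_trichotomy (ω t) 0 with h | h | h
    · rw [D.G_neg t h, ← hxM]
    · have := D.G_zero t h
      rw [← hxm, ← hxM] at this
      exact le_antisymm this.2 this.1
    · rw [D.G_pos t h, ← hxm]
  have hGc : Continuous fun t => S.force (y t, ω t) 0 := by
    simp only [force_zero]
    exact continuous_const.mul ((O.standing.g_contDiff.continuous.comp
      (S.contDiff_toPhase.continuous.comp (D.continuous_y.prodMk D.continuous_ω))).div_const _)
  obtain ⟨t, ht⟩ := hno T y ω D.period_pos D.periodic_y D.periodic_ω D.hasDerivAt_y
    (fun t => by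
      have h := (intervalIntegral.integral_hasDerivAt_right (hGc.intervalIntegrable 0 t)
        (hGc.stronglyMeasurableAtFilter _ _) hGc.continuousAt).neg.const_add (ω 0)
      refine h.congr_of_eventuallyEq (Eventually.of_forall fun s => ?_)
      have h2 := D.ω_sub 0 s
      simp only [hG] at h2
      simp only [Pi.neg_apply]
      linarith)
    (fun t => (hsmall t).trans_le (min_le_right _ _))
  -- The remaining possibility, a passage through the origin, fails because the origin lies strictly
  -- between the two corners.
  have hmem : ((0 : ℝ), (0 : ℝ)) ∈ C V := by rw [← hr, ← ht]; exact mem_range_self t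
  have hO := O.oval V hV
  have h3 := ((hO.mem_iff _).1 hmem).2
  have hin : (0 : ℝ) ∈ Ioo (a V) (b V) := ⟨O.left_neg V hV, O.right_pos V hV⟩
  have h4 := hO.upper.pos 0 hin
  have h5 := hO.el_pos hin
  rcases h3 with ⟨-, h⟩ | ⟨-, h⟩ <;> norm_num at h <;> linarith

/-- The corners of a cycle and the points near the axis are not all degenerate. -/
theorem not_degenerate (O : OvalFamily S P Vbar C a b eu el) {V : ℝ} (hV : V ∈ Ioc 0 Vbar)
    (ha : S.Degenerate (a V, 0)) (hb : S.Degenerate (b V, 0))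
    (hw : ∀ᶠ w in 𝓝 (0 : ℝ), ∃ y, S.Degenerate (y, w)) : False := by
  by_cases hν : S.ν = 0
  · refine O.not_eventually_h_eq_zero (hV.1.trans_le hV.2) hν ?_
    filter_upwards [hw] with w ⟨y, c, hc, _⟩
    simpa [hν] using hc
  · obtain ⟨c, hc, hg⟩ := ha
    obtain ⟨c', hc', hg'⟩ := hb
    -- Both factors are determined by `h 0`. Thus the force at `x = 0` is the same at the two
    -- corners, although it is negative at the left one and positive at the right one.
    have hcc : c = c' := by
      have h : c • S.ν = c' • S.ν := by rw [← hc, ← hc']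
      exact smul_left_injective ℝ hν h
    have hO := O.oval V hV
    have h1 := le_upperForce O.posDef hV.1.le (O.reg' hV.2) (a V, 0) (zero_mem_ellipsoid hV.1.le)
    have h2 := lowerForce_le O.posDef hV.1.le (O.reg' hV.2) (b V, 0) (zero_mem_ellipsoid hV.1.le)
    rw [force_zero, hg, mul_div_cancel_right₀ _ O.standing.mu_ne] at h1
    rw [force_zero, hg', mul_div_cancel_right₀ _ O.standing.mu_ne] at h2
    rw [hcc] at h1
    linarith [hO.left_neg, hO.right_pos]

/-- Not all points of a cycle are degenerate. -/
theorem exists_not_degenerate (O : OvalFamily S P Vbar C a b eu el) {V : ℝ} (hV : V ∈ Ioc 0 Vbar)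
    (hu : ∀ y ∈ Ioo (a V) (b V), S.Degenerate (y, √(2 * eu V y)))
    (hl : ∀ y ∈ Ioo (a V) (b V), S.Degenerate (y, -√(2 * el V y))) : False := by
  have hO := O.oval V hV
  have hcu : ContinuousOn (fun y => √(2 * eu V y)) (Icc (a V) (b V)) :=
    (continuousOn_const.mul hO.upper.cont).sqrt
  have hcl : ContinuousOn (fun y => √(2 * el V y)) (Icc (a V) (b V)) :=
    (continuousOn_const.mul hO.el_cont).sqrt
  have hall : ∀ y ∈ Icc (a V) (b V), S.Degenerate (y, √(2 * eu V y)) := by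
    have hmaps : MapsTo (fun y => (y, √(2 * eu V y))) (closure (Ioo (a V) (b V)))
        (closure {p | S.Degenerate p}) := by
      refine MapsTo.closure_of_continuousOn (fun y hy => hu y hy) ?_
      rw [closure_Ioo hO.upper.lt.ne]
      exact continuousOn_id.prodMk hcu
    rwa [closure_Ioo hO.upper.lt.ne, (isClosed_degenerate O.standing).closure_eq] at hmaps
  have h0 : (0 : ℝ) ∈ Ioo (a V) (b V) := ⟨O.left_neg V hV, O.right_pos V hV⟩
  have ha := hall _ (left_mem_Icc.2 hO.upper.lt.le)
  have hb := hall _ (right_mem_Icc.2 hO.upper.lt.le)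
  rw [hO.upper.left, mul_zero, Real.sqrt_zero] at ha
  rw [hO.upper.right, mul_zero, Real.sqrt_zero] at hb
  refine O.not_degenerate hV ha hb ?_
  have hpu : 0 < √(2 * eu V 0) := Real.sqrt_pos.2 (by linarith [hO.upper.pos 0 h0])
  have hpl : 0 < √(2 * el V 0) := Real.sqrt_pos.2 (by linarith [hO.el_pos h0])
  have hsub : Icc (a V) 0 ⊆ Icc (a V) (b V) := Icc_subset_Icc_right h0.2.le
  -- Between the left corner and `y = 0` the two arcs pass through all small heights of either sign.
  filter_upwards [Ioo_mem_nhds (neg_lt_zero.2 hpl) hpu] with w hw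
  rcases lt_trichotomy w 0 with h | rfl | h
  · obtain ⟨y, hy, hyw⟩ := intermediate_value_Icc h0.1.le (hcl.mono hsub)
      (show -w ∈ Icc _ _ from ⟨by simp only [hO.el_left, mul_zero, Real.sqrt_zero]; linarith,
        by linarith [hw.1]⟩)
    simp only at hyw
    have hya : y ≠ a V := by
      rintro rfl
      rw [hO.el_left, mul_zero, Real.sqrt_zero] at hyw
      linarith
    refine ⟨y, ?_⟩
    have := hl y ⟨lt_of_le_of_ne hy.1 hya.symm, hy.2.trans_lt h0.2⟩
    rwa [hyw, neg_neg] at this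
  · exact ⟨_, ha⟩
  · obtain ⟨y, hy, hyw⟩ := intermediate_value_Icc h0.1.le (hcu.mono hsub)
      (show w ∈ Icc _ _ from ⟨by simp only [hO.upper.left, mul_zero, Real.sqrt_zero]; linarith,
        by linarith [hw.2]⟩)
    simp only at hyw
    refine ⟨y, ?_⟩
    have := hall y (hsub hy)
    rwa [hyw] at this

theorem lower_anti (O : OvalFamily S P Vbar C a b eu el) {V V' : ℝ} (hV : 0 ≤ V) (h : V ≤ V')
    (hV' : V' ≤ Vbar) (p : ℝ × ℝ) : S.lowerForce P V' p ≤ S.lowerForce P V p :=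
  lowerForce_anti O.posDef hV h (O.reg' hV') p

theorem upper_mono (O : OvalFamily S P Vbar C a b eu el) {V V' : ℝ} (hV : 0 ≤ V) (h : V ≤ V')
    (hV' : V' ≤ Vbar) (p : ℝ × ℝ) : S.upperForce P V p ≤ S.upperForce P V' p :=
  upperForce_mono O.posDef hV h (O.reg' hV') p

/-- Equal right ends at two positive levels make the fields agree along the upper arcs and, by
reflection, along the lower ones; the whole smaller cycle would be degenerate. -/
theorem injOn_right (O : OvalFamily S P Vbar C a b eu el) : InjOn b (Icc 0 Vbar) := by
  have key : ∀ V ∈ Icc 0 Vbar, ∀ V' ∈ Icc 0 Vbar, V < V' → b V ≠ b V' := by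
    intro V hV V' hV' hlt hb
    have hV'' : V' ∈ Ioc 0 Vbar := ⟨hV.1.trans_lt hlt, hV'.2⟩
    rcases eq_or_lt_of_le hV.1 with h0 | h0
    · rw [← h0, O.right_zero] at hb
      exact (O.right_pos V' hV'').ne hb
    have hVm : V ∈ Ioc 0 Vbar := ⟨h0, hV.2⟩
    have hO := O.oval V hVm
    have hO' := O.oval V' hV''
    have hki := O.standing.ki_pos.ne'
    obtain ⟨ha, hu⟩ := hO.fields_eq hO' (O.lower_anti hV.1 hlt.le hV'.2)
      (O.upper_mono hV.1 hlt.le hV'.2) (O.lipschitz_lower hV') (O.lipschitz_upper hV') hb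
    obtain ⟨-, hl⟩ := hO.reflect.fields_eq hO'.reflect
      (fun p => neg_le_neg (O.upper_mono hV.1 hlt.le hV'.2 _))
      (fun p => neg_le_neg (O.lower_anti hV.1 hlt.le hV'.2 _)) (O.lipschitz_upper hV').reflect
      (O.lipschitz_lower hV').reflect (by rw [ha])
    refine O.exists_not_degenerate hVm (fun y hy => ?_) (fun y hy => ?_)
    · exact degenerate_of_lowerForce_eq hki O.posDef hV.1 hlt (O.reg' hV'.2) (hu y hy)
    · have := hl (-y) ⟨neg_lt_neg hy.2, neg_lt_neg hy.1⟩
      simp only [_root_.reflect, Prod.neg_mk, neg_neg, neg_inj] at this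
      exact degenerate_of_upperForce_eq hki O.posDef hV.1 hlt (O.reg' hV'.2) this
  intro V hV V' hV' h
  rcases lt_trichotomy V V' with h' | h' | h'
  · exact absurd h (key V hV V' hV' h')
  · exact h'
  · exact absurd h.symm (key V' hV' V hV h')

/-- A continuous injective function on an interval is strictly monotone, and `b 0 = 0 ≤ b Vbar`
settles the direction. -/
theorem monotoneOn_right (O : OvalFamily S P Vbar C a b eu el) : MonotoneOn b (Icc 0 Vbar) := by
  rcases eq_or_lt_of_le O.nonneg with h | h
  · rw [← h, Icc_self]
    exact subsingleton_singleton.monotoneOn b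
  refine (O.continuousOn_right.strictMonoOn_of_injOn_Icc O.nonneg ?_ O.injOn_right).monotoneOn
  rw [O.right_zero]
  exact (O.right_pos Vbar ⟨h, le_rfl⟩).le

/-- The hulls of the cycles increase with `V`. -/
theorem hull_mono (O : OvalFamily S P Vbar C a b eu el) {V V' : ℝ} (hV : 0 ≤ V) (h : V ≤ V')
    (hV' : V' ≤ Vbar) : verticalHull (C V) ⊆ verticalHull (C V') := by
  rcases eq_or_lt_of_le h with rfl | hlt
  · exact Subset.rfl
  have hV'' : V' ∈ Ioc 0 Vbar := ⟨hV.trans_lt hlt, hV'⟩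
  have hO' := O.oval V' hV''
  rcases eq_or_lt_of_le hV with h0 | h0
  · refine verticalHull_mono ?_
    rw [← h0, O.zero, singleton_subset_iff]
    have hin : (0 : ℝ) ∈ Icc (a V') (b V') := ⟨(O.left_neg V' hV'').le, (O.right_pos V' hV'').le⟩
    refine (hO'.mem_hull_iff _).2 ⟨hin, fun _ => ?_, fun _ => ?_⟩
    · simpa using hO'.upper.nonneg hin
    · simpa using hO'.el_nonneg hin
  · have hVm : V ∈ Ioc 0 Vbar := ⟨h0, h.trans hV'⟩
    exact (O.oval V hVm).hull_subset hO' (O.lower_anti hV h hV') (O.upper_mono hV h hV')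
      (O.lipschitz_lower (Ioc_subset_Icc_self hV'')) (O.lipschitz_upper (Ioc_subset_Icc_self hV''))
      (O.monotoneOn_right (Ioc_subset_Icc_self hVm) (Ioc_subset_Icc_self hV'') h)
      ((O.left_neg V' hV'').trans (O.right_pos V hVm))

theorem eventually_disjoint (O : OvalFamily S P Vbar C a b eu el) {V₀ : ℝ} (hV₀ : V₀ ∈ Icc 0 Vbar)
    {R : Set (ℝ × ℝ)} (hR : IsClosed R) (h : ∀ p ∈ R, p ∉ C V₀) :
    ∀ᶠ V in 𝓝[Icc 0 Vbar] V₀, ∀ p ∈ R, p ∉ C V := by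
  obtain ⟨δ, hδ, hd⟩ := exists_pos_forall_le_dist (O.isCompact hV₀) hR
    (Set.disjoint_right.2 h)
  filter_upwards [O.close V₀ hV₀ δ hδ] with V ⟨h1, _⟩ p hp hpC
  obtain ⟨q, hq, hpq⟩ := h1 p hpC
  rw [dist_comm] at hpq
  exact absurd (hd q hq p hp) (not_le.2 hpq)

/-- Outside the hull, the downward or the upward vertical ray from `p` misses the curve. The ray is
closed and the curve compact, so nearby curves miss it too. -/
theorem eventually_notMem_hull (O : OvalFamily S P Vbar C a b eu el) {V₀ : ℝ}
    (hV₀ : V₀ ∈ Icc 0 Vbar) {p : ℝ × ℝ} (hp : p ∉ verticalHull (C V₀)) :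
    ∀ᶠ V in 𝓝[Icc 0 Vbar] V₀, p ∉ verticalHull (C V) := by
  rcases not_and_or.1 hp with h | h
  · have hR : IsClosed {q : ℝ × ℝ | q.1 = p.1 ∧ q.2 ≤ p.2} :=
      (isClosed_eq continuous_fst continuous_const).inter
        (isClosed_le continuous_snd continuous_const)
    filter_upwards [O.eventually_disjoint hV₀ hR fun q hq hqC =>
      h ⟨q.2, hq.2, by rw [← hq.1]; exact hqC⟩] with V hV hpV
    obtain ⟨⟨w, hw, hwC⟩, -⟩ := hpV
    exact hV (p.1, w) ⟨rfl, hw⟩ hwC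
  · have hR : IsClosed {q : ℝ × ℝ | q.1 = p.1 ∧ p.2 ≤ q.2} :=
      (isClosed_eq continuous_fst continuous_const).inter
        (isClosed_le continuous_const continuous_snd)
    filter_upwards [O.eventually_disjoint hV₀ hR fun q hq hqC =>
      h ⟨q.2, hq.2, by rw [← hq.1]; exact hqC⟩] with V hV hpV
    obtain ⟨-, ⟨w, hw, hwC⟩⟩ := hpV
    exact hV (p.1, w) ⟨rfl, hw⟩ hwC

/-- An interior point of a hull is an interior point of the neighbouring hulls. -/
theorem eventually_mem_hull (O : OvalFamily S P Vbar C a b eu el) {V₀ : ℝ} (hV₀ : V₀ ∈ Ioc 0 Vbar)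
    {p : ℝ × ℝ} (hp : p ∈ verticalHull (C V₀)) (hpC : p ∉ C V₀) :
    ∀ᶠ V in 𝓝[Icc 0 Vbar] V₀, p ∈ verticalHull (C V) ∧ p ∉ C V := by
  obtain ⟨y, ω⟩ := p
  have hO := O.oval V₀ hV₀
  have hV₀' := Ioc_subset_Icc_self hV₀
  obtain ⟨hy, hu, hl⟩ := (hO.mem_hull_iff _).1 hp
  simp only at hy hu hl
  -- The compact vertical segment from the axis to the point misses the curve; this persists for
  -- nearby `V` and certifies membership through `Oval.mem_hull_of_segment`.
  have hseg : ∀ q ∈ ({y} : Set ℝ) ×ˢ uIcc 0 ω, q ∉ C V₀ := by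
    rintro ⟨y', w⟩ ⟨hy', hw⟩ hC
    simp only [mem_singleton_iff] at hy' hw
    subst hy'
    have h1 := ((hO.mem_iff _).1 hC).2
    simp only at h1
    have h2 := hO.upper.nonneg hy
    have h3 := hO.el_nonneg hy
    rcases le_total 0 ω with h | h
    · rw [uIcc_of_le h] at hw
      have hlt : ω ^ 2 / 2 ≠ eu V₀ y' := fun e => hpC ((hO.mem_iff _).2 ⟨hy, Or.inl ⟨h, e⟩⟩)
      have hlt' := lt_of_le_of_ne (hu h) hlt
      rcases h1 with ⟨h4, h5⟩ | ⟨h4, h5⟩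
      · nlinarith [hw.1, hw.2]
      · have hw0 : w = 0 := le_antisymm h4 hw.1
        rw [hw0] at h5
        have hel : el V₀ y' = 0 := by rw [← h5]; norm_num
        have hend : y' = a V₀ ∨ y' = b V₀ := by
          by_contra! hne
          have := hO.el_pos ⟨lt_of_le_of_ne hy.1 hne.1.symm, lt_of_le_of_ne hy.2 hne.2⟩
          linarith
        rcases hend with rfl | rfl
        · rw [hO.upper.left] at hlt'; nlinarith [sq_nonneg ω]
        · rw [hO.upper.right] at hlt'; nlinarith [sq_nonneg ω]
    · rw [uIcc_of_ge h] at hw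
      have hlt : ω ^ 2 / 2 ≠ el V₀ y' := fun e => hpC ((hO.mem_iff _).2 ⟨hy, Or.inr ⟨h, e⟩⟩)
      have hlt' := lt_of_le_of_ne (hl h) hlt
      rcases h1 with ⟨h4, h5⟩ | ⟨h4, h5⟩
      · have hw0 : w = 0 := le_antisymm hw.2 h4
        rw [hw0] at h5
        have heu : eu V₀ y' = 0 := by rw [← h5]; norm_num
        have hend : y' = a V₀ ∨ y' = b V₀ := by
          by_contra! hne
          have := hO.upper.pos y' ⟨lt_of_le_of_ne hy.1 hne.1.symm, lt_of_le_of_ne hy.2 hne.2⟩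
          linarith
        rcases hend with rfl | rfl
        · rw [hO.el_left] at hlt'; nlinarith [sq_nonneg ω]
        · rw [hO.el_right] at hlt'; nlinarith [sq_nonneg ω]
      · nlinarith [hw.1, hw.2]
  have hya : y ≠ a V₀ := by
    rintro rfl
    exact hseg (a V₀, 0) ⟨rfl, left_mem_uIcc⟩ hO.left_mem
  have hyb : y ≠ b V₀ := by
    rintro rfl
    exact hseg (b V₀, 0) ⟨rfl, left_mem_uIcc⟩ hO.right_mem
  have hev := O.eventually_disjoint hV₀' (isClosed_singleton.prod isClosed_Icc) hseg
  have hap := (O.continuousOn_left V₀ hV₀').eventually (gt_mem_nhds (lt_of_le_of_ne hy.1 hya.symm))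
  have hbp := (O.continuousOn_right V₀ hV₀').eventually (lt_mem_nhds (lt_of_le_of_ne hy.2 hyb))
  have hpos : ∀ᶠ V in 𝓝[Icc 0 Vbar] V₀, 0 < V :=
    eventually_nhdsWithin_of_eventually_nhds (lt_mem_nhds hV₀.1)
  filter_upwards [hev, hap, hbp, hpos, self_mem_nhdsWithin] with V h1 h2 h3 h4 h5
  exact ⟨(O.oval V ⟨h4, h5.2⟩).mem_hull_of_segment ⟨h2, h3⟩ fun w hw => h1 (y, w) ⟨rfl, hw⟩,
    h1 (y, ω) ⟨rfl, right_mem_uIcc⟩⟩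

/-- If a point lies in the interior of a hull, it lies in the interior of a smaller one. -/
theorem exists_lt_mem_hull (O : OvalFamily S P Vbar C a b eu el) {V₀ : ℝ} (hV₀ : V₀ ∈ Ioc 0 Vbar)
    {p : ℝ × ℝ} (hp : p ∈ verticalHull (C V₀)) (hpC : p ∉ C V₀) :
    ∃ V ∈ Ioo 0 V₀, p ∈ verticalHull (C V) ∧ p ∉ C V := by
  have h := (O.eventually_mem_hull hV₀ hp hpC).filter_mono
    (nhdsWithin_mono V₀ (show Ioo 0 V₀ ⊆ Icc 0 Vbar from
      fun V hV => ⟨hV.1.le, hV.2.le.trans hV₀.2⟩))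
  rw [nhdsWithin_Ioo_eq_nhdsLT hV₀.1] at h
  obtain ⟨V, hV, hV'⟩ := (h.and (Ioo_mem_nhdsLT hV₀.1)).exists
  exact ⟨V, hV', hV⟩

theorem verticalHull_zero (O : OvalFamily S P Vbar C a b eu el) :
    verticalHull (C 0) = {(0, 0)} := by
  rw [O.zero]
  refine Subset.antisymm ?_ (subset_verticalHull _)
  rintro ⟨y, ω⟩ ⟨⟨w, hw, h⟩, ⟨w', hw', h'⟩⟩
  simp only [mem_singleton_iff, Prod.mk.injEq] at h h' hw hw' ⊢
  exact ⟨h.1, le_antisymm (h'.2 ▸ hw') (h.2 ▸ hw)⟩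

/-- The right-continuity of the hulls. -/
theorem mem_hull_of_forall_gt (O : OvalFamily S P Vbar C a b eu el) {V₀ : ℝ}
    (hV₀ : V₀ ∈ Icc 0 Vbar) {p : ℝ × ℝ} (hbar : p ∈ verticalHull (C Vbar))
    (h : ∀ V ∈ Ioc V₀ Vbar, p ∈ verticalHull (C V)) : p ∈ verticalHull (C V₀) := by
  by_contra hp
  rcases eq_or_lt_of_le hV₀.2 with h0 | h0
  · rw [h0] at hp; exact hp hbar
  have hev := (O.eventually_notMem_hull hV₀ hp).filter_mono
    (nhdsWithin_mono V₀ (show Ioc V₀ Vbar ⊆ Icc 0 Vbar from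
      fun V hV => ⟨hV₀.1.trans hV.1.le, hV.2⟩))
  rw [nhdsWithin_Ioc_eq_nhdsGT h0] at hev
  obtain ⟨V, hV, hV'⟩ := (hev.and (Ioc_mem_nhdsGT h0)).exists
  exact hV (h V hV')

/-- Every point of the largest hull lies on a cycle. -/
theorem exists_mem_cycle (O : OvalFamily S P Vbar C a b eu el) {p : ℝ × ℝ}
    (hp : p ∈ verticalHull (C Vbar)) : ∃ V ∈ Icc 0 Vbar, p ∈ C V := by
  -- The lowest level whose hull contains `p` is attained by right-continuity, and `p` lies on that
  -- cycle because an interior point would belong to a smaller hull.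
  set I := {V | V ∈ Icc 0 Vbar ∧ p ∈ verticalHull (C V)} with hI
  have hne : I.Nonempty := ⟨Vbar, ⟨O.nonneg, le_rfl⟩, hp⟩
  have hbdd : BddBelow I := ⟨0, fun V hV => hV.1.1⟩
  have hmem : sInf I ∈ Icc 0 Vbar :=
    ⟨le_csInf hne fun V hV => hV.1.1, csInf_le hbdd ⟨⟨O.nonneg, le_rfl⟩, hp⟩⟩
  have hhull : p ∈ verticalHull (C (sInf I)) := by
    refine O.mem_hull_of_forall_gt hmem hp fun V hV => ?_
    obtain ⟨V', hV', hlt⟩ := exists_lt_of_csInf_lt hne hV.1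
    exact O.hull_mono hV'.1.1 hlt.le hV.2 hV'.2
  refine ⟨sInf I, hmem, ?_⟩
  by_contra hpC
  rcases eq_or_lt_of_le hmem.1 with h0 | h0
  · rw [← h0, O.verticalHull_zero] at hhull
    rw [← h0, O.zero] at hpC
    exact hpC hhull
  · obtain ⟨V, hV, hVp, -⟩ := O.exists_lt_mem_hull ⟨h0, hmem.2⟩ hhull hpC
    exact absurd (csInf_le hbdd ⟨⟨hV.1.le, hV.2.le.trans hmem.2⟩, hVp⟩) (not_le.2 hV.2)

theorem mem_hull_iff_exists (O : OvalFamily S P Vbar C a b eu el) {p : ℝ × ℝ} :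
    p ∈ verticalHull (C Vbar) ↔ ∃ V ∈ Icc 0 Vbar, p ∈ C V := by
  refine ⟨O.exists_mem_cycle, ?_⟩
  rintro ⟨V, hV, hp⟩
  exact O.hull_mono hV.1 hV.2 le_rfl (subset_verticalHull _ hp)

end OvalFamily

end InverterSystem

/-! ### Orbits of a continuous field that move on an oval. -/

section Orbits

/-- A solution of `y' = ω`, `ω' = -φ (y, ω)`, for nonnegative times, which moves on `C`. -/
structure IsOrbit (φ : ℝ × ℝ → ℝ) (C : Set (ℝ × ℝ)) (Y W : ℝ → ℝ) : Prop where
  contY : Continuous Y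
  contW : Continuous W
  derivY : ∀ t, 0 ≤ t → HasDerivAt Y (W t) t
  derivW : ∀ t, 0 ≤ t → HasDerivAt W (-φ (Y t, W t)) t
  mem : ∀ t, 0 ≤ t → (Y t, W t) ∈ C

theorem IsOrbit.reflect {φ : ℝ × ℝ → ℝ} {C : Set (ℝ × ℝ)} {Y W : ℝ → ℝ} (h : IsOrbit φ C Y W) :
    IsOrbit (reflect φ) {p | -p ∈ C} (-Y) (-W) where
  contY := h.contY.neg
  contW := h.contW.neg
  derivY t ht := (h.derivY t ht).neg
  derivW t ht := by
    have := (h.derivW t ht).neg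
    simpa [_root_.reflect] using this
  mem t ht := by simpa using h.mem t ht

namespace Oval

variable {m M φ : ℝ × ℝ → ℝ} {a b : ℝ} {eu el : ℝ → ℝ} {C : Set (ℝ × ℝ)} {Y W : ℝ → ℝ}

theorem eq_left_or_right (O : Oval m M a b eu el C) {y : ℝ} (h : (y, (0 : ℝ)) ∈ C) :
    y = a ∨ y = b := by
  obtain ⟨hy, h⟩ := (O.mem_iff _).1 h
  by_contra! hne
  have hy' : y ∈ Ioo a b := ⟨lt_of_le_of_ne hy.1 hne.1.symm, lt_of_le_of_ne hy.2 hne.2⟩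
  have h1 := O.upper.pos y hy'
  have h2 := O.el_pos hy'
  rcases h with ⟨-, h⟩ | ⟨-, h⟩ <;> norm_num at h <;> linarith

theorem eq_sqrt_of_nonneg (O : Oval m M a b eu el C) {y w : ℝ} (h : (y, w) ∈ C) (hw : 0 ≤ w) :
    w = √(2 * eu y) := by
  rcases eq_or_lt_of_le hw with h0 | h0
  · rw [← h0] at h ⊢
    rcases O.eq_left_or_right h with rfl | rfl
    · simp [O.upper.left]
    · simp [O.upper.right]
  · rcases ((O.mem_iff _).1 h).2 with ⟨-, h1⟩ | ⟨h1, -⟩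
    · rw [← h1, mul_div_cancel₀ _ two_ne_zero, Real.sqrt_sq hw]
    · exact absurd h1 (not_le.2 h0)

/-- An orbit on an oval does not stay in the upper half-plane. -/
theorem exists_neg_of_orbit (O : Oval m M a b eu el C) (hφ : Continuous φ)
    (hm : ∀ p, m p ≤ φ p) (hM : ∀ p, φ p ≤ M p) (h : IsOrbit φ C Y W) {τ : ℝ} (hτ : 0 ≤ τ) :
    ∃ t, τ ≤ t ∧ W t < 0 := by
  by_contra! hcon
  have hmemY : ∀ t, τ ≤ t → Y t ∈ Icc a b :=
    fun t ht => ((O.mem_iff _).1 (h.mem t (hτ.trans ht))).1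
  -- In the closed upper half-plane `Y` would increase to a limit and the orbit would converge on
  -- the oval to an equilibrium on the axis, that is, to a corner; but `φ` has a strict sign at both
  -- corners.
  have hmono : MonotoneOn Y (Ici τ) := by
    refine monotoneOn_of_hasDerivWithinAt_nonneg (f' := W) (convex_Ici τ)
      h.contY.continuousOn (fun t ht => ?_) (fun t ht => ?_) <;> rw [interior_Ici] at ht
    · exact (h.derivY t (hτ.trans (le_of_lt ht))).hasDerivWithinAt
    · exact hcon t (le_of_lt ht)
  have hmono' : Monotone fun t => Y (max τ t) := fun s t hst =>
    hmono (mem_Ici.2 (le_max_left τ s)) (mem_Ici.2 (le_max_left τ t)) (max_le_max_left τ hst)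
  have hbdd : BddAbove (range fun t => Y (max τ t)) := by
    refine ⟨b, ?_⟩
    rintro _ ⟨t, rfl⟩
    exact (hmemY _ (le_max_left _ _)).2
  obtain ⟨l, hl⟩ : ∃ l, Tendsto Y atTop (𝓝 l) := by
    refine ⟨_, (tendsto_atTop_ciSup hmono' hbdd).congr' ?_⟩
    filter_upwards [eventually_ge_atTop τ] with t ht
    rw [max_eq_right ht]
  have hev : ∀ᶠ t in atTop, Y t ∈ Icc a b := by
    filter_upwards [eventually_ge_atTop τ] with t ht using hmemY t ht
  have hlmem : l ∈ Icc a b := isClosed_Icc.mem_of_tendsto hl hev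
  have hW : Tendsto W atTop (𝓝 √(2 * eu l)) := by
    have h1 : Tendsto (fun t => eu (Y t)) atTop (𝓝 (eu l)) :=
      (O.upper.cont l hlmem).tendsto.comp (tendsto_nhdsWithin_iff.2 ⟨hl, hev⟩)
    refine ((h1.const_mul 2).sqrt).congr' ?_
    filter_upwards [eventually_ge_atTop τ] with t ht
    exact (O.eq_sqrt_of_nonneg (h.mem t (hτ.trans ht)) (hcon t ht)).symm
  have h0 := eq_zero_of_tendsto_deriv (τ := 0) (fun t ht => (h.derivY t ht).hasDerivWithinAt) hl hW
  rw [h0] at hW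
  have hφ' : Tendsto (fun t => -φ (Y t, W t)) atTop (𝓝 (-φ (l, 0))) :=
    ((hφ.tendsto _).comp (hl.prodMk_nhds hW)).neg
  have h1 := eq_zero_of_tendsto_deriv (τ := 0)
    (fun t ht => (h.derivW t ht).hasDerivWithinAt) hW hφ'
  have hcor : l = a ∨ l = b := by
    refine O.eq_left_or_right ?_
    have := O.upper_mem hlmem
    rwa [h0] at this
  rcases hcor with rfl | rfl
  · linarith [O.left_neg, hM (l, 0)]
  · linarith [O.right_pos, hm (l, 0)]

/-- The field of an orbit on an oval agrees with the field of the upper arc. -/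
theorem field_eq_of_orbit (O : Oval m M a b eu el C) (h : IsOrbit φ C Y W) {t : ℝ} (ht : 0 < t)
    (hW : 0 < W t) : φ (Y t, W t) = m (Y t, W t) := by
  have hmem := h.mem t ht.le
  have hw := O.eq_sqrt_of_nonneg hmem hW.le
  have hy := ((O.mem_iff _).1 hmem).1
  simp only at hy
  have hya : Y t ≠ a := by
    intro e
    rw [e, O.upper.left, mul_zero, Real.sqrt_zero] at hw
    exact hW.ne' hw
  have hyb : Y t ≠ b := by
    intro e
    rw [e, O.upper.right, mul_zero, Real.sqrt_zero] at hw
    exact hW.ne' hw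
  have h1 := (O.upper.hasDerivAt (Y t) ⟨lt_of_le_of_ne hy.1 hya.symm, lt_of_le_of_ne hy.2 hyb⟩).comp
    t (h.derivY t ht.le)
  rw [← hw] at h1
  have h2 := ((h.derivW t ht.le).pow 2).div_const 2
  -- The orbit moves along the arc, so its energy has two derivatives, `-W φ` and `-W m`.
  have hev : (fun r => (W ^ 2) r / 2) =ᶠ[𝓝 t] eu ∘ Y := by
    filter_upwards [lt_mem_nhds ht, h.contW.continuousAt.eventually (lt_mem_nhds hW)] with r hr hWr
    have h3 := O.eq_sqrt_of_nonneg (h.mem r hr.le) hWr.le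
    have h4 := O.upper.nonneg ((O.mem_iff _).1 (h.mem r hr.le)).1
    simp only [Pi.pow_apply, Function.comp_apply] at h4 ⊢
    rw [h3, Real.sq_sqrt (by linarith)]
    ring
  have h5 := h2.unique (h1.congr_of_eventuallyEq hev)
  have h6 : W t * (m (Y t, W t) - φ (Y t, W t)) = 0 := by
    norm_num at h5
    linarith
  have := (mul_eq_zero.1 h6).resolve_left hW.ne'
  linarith

/-- If an oval carries an orbit of an intermediate field, then this field agrees with the field of
the upper arc at points which accumulate at the right corner. -/
theorem exists_field_eq_of_orbit (O : Oval m M a b eu el C) (hφ : Continuous φ)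
    (hm : ∀ p, m p ≤ φ p) (hM : ∀ p, φ p ≤ M p) (h : IsOrbit φ C Y W) :
    (b, (0 : ℝ)) ∈ closure {p | φ p = m p} ∧
      ∃ w₀ > 0, ∀ w ∈ Ioo 0 w₀, ∃ y, φ (y, w) = m (y, w) := by
  have hreflect : ∃ t, 1 ≤ t ∧ (-W) t < 0 := by
    refine O.reflect.exists_neg_of_orbit (φ := _root_.reflect φ) ?_ ?_ ?_ h.reflect zero_le_one
    · unfold _root_.reflect
      fun_prop
    · exact fun p => neg_le_neg (hM _)
    · exact fun p => neg_le_neg (hm _)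
  obtain ⟨s, hs, hWs⟩ := hreflect
  have hWs' : 0 < W s := by simpa using hWs
  have hs0 : 0 < s := by linarith
  obtain ⟨t, hst, hWt⟩ := O.exists_neg_of_orbit hφ hm hM h hs0.le
  obtain ⟨e, he, hWe, hpos⟩ := exists_first_zero h.contW hst hWs' hWt.le
  have he0 : 0 < e := hs0.trans he.1
  have heq : ∀ r ∈ Ico s e, φ (Y r, W r) = m (Y r, W r) := fun r hr =>
    O.field_eq_of_orbit h (hs0.trans_le hr.1) (hpos r hr)
  constructor
  · have hmem := h.mem e he0.le
    rw [hWe] at hmem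
    have hYe : Y e = b := by
      -- At the left corner `W' = -φ > 0`, so `W` would be negative just before `e`.
      refine (O.eq_left_or_right hmem).resolve_left fun hYe => ?_
      have hd := h.derivW e he0.le
      rw [hWe, hYe] at hd
      have hneg : φ (a, 0) < 0 := (hM _).trans_lt O.left_neg
      have hev := eventually_nhdsWithin_sign_eq_of_deriv_pos
        (show 0 < deriv W e by rw [hd.deriv]; linarith) hWe
      have hev' := (hev.filter_mono (nhdsWithin_le_nhds (s := Iio e))).and (Ico_mem_nhdsLT he.1)
      obtain ⟨r, hr, hr'⟩ := hev'.exists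
      rw [sign_pos (hpos r hr'), sign_neg (by linarith [hr'.2])] at hr
      exact absurd hr (by decide)
    have hlim : Tendsto (fun r => (Y r, W r)) (𝓝[<] e) (𝓝 (b, 0)) := by
      have := ((h.contY.prodMk h.contW).tendsto e).mono_left (nhdsWithin_le_nhds (s := Iio e))
      rwa [hYe, hWe] at this
    refine mem_closure_of_tendsto hlim ?_
    filter_upwards [Ico_mem_nhdsLT he.1] with r hr using heq r hr
  · refine ⟨W s, hWs', fun w hw => ?_⟩
    obtain ⟨r, hr, hrw⟩ := intermediate_value_Icc' he.1.le h.contW.continuousOn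
      (show w ∈ Icc (W e) (W s) from ⟨by rw [hWe]; exact hw.1.le, hw.2.le⟩)
    have hre : r ≠ e := by
      rintro rfl
      rw [hWe] at hrw
      exact hw.1.ne hrw
    refine ⟨Y r, ?_⟩
    rw [← hrw]
    exact heq r ⟨hr.1, lt_of_le_of_ne hr.2 hre⟩

end Oval

end Orbits

/-! ### Global solutions. -/

section GlobalExistence

variable {E : Type*} [NormedAddCommGroup E] [NormedSpace ℝ E] [CompleteSpace E]

/-- A bounded and globally Lipschitz vector field has global solutions. -/
theorem exists_global_solution {v : ℝ → E → E} {K L : NNReal} (hv : ∀ t, LipschitzWith K (v t))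
    (hc : ∀ u, Continuous fun t => v t u) (hL : ∀ t u, ‖v t u‖ ≤ L) (u₀ : E) :
    ∃ u : ℝ → E, u 0 = u₀ ∧ ∀ t, HasDerivAt u (v t (u t)) t := by
  have hex : ∀ n : ℕ, ∃ u : ℝ → E, u 0 = u₀ ∧
      ∀ t ∈ Ioo (-(n + 1) : ℝ) (n + 1), HasDerivAt u (v t (u t)) t := by
    intro n
    have hn : (0 : ℝ) < n + 1 := by positivity
    have hP : IsPicardLindelof v (tmin := -(n + 1 : ℝ)) (tmax := n + 1)
        ⟨0, by constructor <;> linarith⟩ u₀ (L * (n + 1)) 0 L K := by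
      refine ⟨fun t _ => (hv t).lipschitzOnWith, fun u _ => (hc u).continuousOn,
        fun t _ u _ => hL t u, ?_⟩
      simp
    obtain ⟨u, hu0, hu⟩ := hP.exists_eq_forall_mem_Icc_hasDerivWithinAt₀
    exact ⟨u, hu0, fun t ht => (hu t (Ioo_subset_Icc_self ht)).hasDerivAt
      (Icc_mem_nhds ht.1 ht.2)⟩
  choose u hu0 hu using hex
  have huniq : ∀ n k : ℕ, n ≤ k → EqOn (u n) (u k) (Ioo (-(n + 1) : ℝ) (n + 1)) := by
    intro n k hnk
    have hnk' : (n : ℝ) ≤ k := by exact_mod_cast hnk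
    refine ODE_solution_unique_of_mem_Ioo (v := v) (s := fun _ => univ) (K := K) (t₀ := 0)
      (fun t _ => (hv t).lipschitzOnWith) ⟨by linarith [n.cast_nonneg (α := ℝ)], by positivity⟩
      (fun t ht => ⟨hu n t ht, mem_univ _⟩)
      (fun t ht => ⟨hu k t ⟨by linarith [ht.1], by linarith [ht.2]⟩, mem_univ _⟩)
      (by rw [hu0, hu0])
  have hloc : ∀ (n : ℕ) (t : ℝ), |t| < n + 1 → u ⌈|t|⌉₊ t = u n t := by
    intro n t ht
    rcases le_total ⌈|t|⌉₊ n with h | h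
    · refine huniq _ _ h ?_
      rw [mem_Ioo, ← abs_lt]
      exact (Nat.le_ceil _).trans_lt (lt_add_one _)
    · refine (huniq _ _ h ?_).symm
      rwa [mem_Ioo, ← abs_lt]
  -- By uniqueness the solutions on growing intervals agree where they overlap, so the index may
  -- depend on `t`.
  refine ⟨fun t => u ⌈|t|⌉₊ t, by simp [hu0], fun t => ?_⟩
  obtain ⟨n, hn⟩ := exists_nat_gt |t|
  have hn' : |t| < n + 1 := by linarith
  have hev : (fun r => u ⌈|r|⌉₊ r) =ᶠ[𝓝 t] u n := by
    have : ∀ᶠ r : ℝ in 𝓝 t, |r| < n + 1 :=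
      continuous_abs.continuousAt.eventually_lt continuousAt_const hn'
    filter_upwards [this] with r hr using hloc n r hr
  simp only [hloc n t hn']
  exact (hu n t (abs_lt.1 hn')).congr_of_eventuallyEq hev

end GlobalExistence

theorem norm_le_of_mem_verticalHull {C : Set (ℝ × ℝ)} {R : ℝ} (h : ∀ q ∈ C, ‖q‖ ≤ R) {p : ℝ × ℝ}
    (hp : p ∈ verticalHull C) : ‖p‖ ≤ R := by
  obtain ⟨⟨w, hw, hC⟩, ⟨w', hw', hC'⟩⟩ := hp
  have h1 := h _ hC
  have h2 := h _ hC'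
  rw [Prod.norm_def, max_le_iff, Real.norm_eq_abs, Real.norm_eq_abs] at h1 h2 ⊢
  exact ⟨h1.1, abs_le.2 ⟨(abs_le.1 h1.2).1.trans hw, hw'.trans (abs_le.1 h2.2).2⟩⟩

/-- The plane retracts onto its squares without increasing distances. -/
theorem exists_retraction {R : ℝ} (hR : 0 ≤ R) : ∃ r : ℝ × ℝ → ℝ × ℝ, LipschitzWith 1 r ∧
    (∀ p, ‖r p‖ ≤ R) ∧ ∀ p, ‖p‖ ≤ R → r p = p := by
  have hκ : LipschitzWith 1 fun y : ℝ => max (-R) (min y R) :=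
    (LipschitzWith.id.min_const R).const_max (-R)
  refine ⟨fun p => (max (-R) (min p.1 R), max (-R) (min p.2 R)), ?_, fun p => ?_, fun p hp => ?_⟩
  · have h1 := hκ.comp (LipschitzWith.prod_fst (α := ℝ) (β := ℝ))
    have h2 := hκ.comp (LipschitzWith.prod_snd (α := ℝ) (β := ℝ))
    simpa using h1.prodMk h2
  · rw [Prod.norm_def]
    refine max_le ?_ ?_ <;> rw [Real.norm_eq_abs, abs_le] <;>
      exact ⟨le_max_left _ _, max_le (by linarith) (min_le_right _ _)⟩
  · rw [Prod.norm_def, max_le_iff, Real.norm_eq_abs, Real.norm_eq_abs, abs_le, abs_le] at hp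
    ext
    · simp only; rw [min_eq_left hp.1.2, max_eq_right hp.1.1]
    · simp only; rw [min_eq_left hp.2.2, max_eq_right hp.2.1]

namespace InverterSystem

variable {S : InverterSystem} {P : Matrix (Fin 4) (Fin 4) ℝ} {V Vbar : ℝ}

theorem continuousOn_force_prod (hS : S.StandingAssumptions)
    (hreg : ∀ x ∈ ellipsoid P V, S.ν ⬝ᵥ x ≠ S.μ) :
    ContinuousOn (fun z : (ℝ × ℝ) × (Fin 4 → ℝ) => S.force z.1 z.2) (univ ×ˢ ellipsoid P V) := by
  have h1 : Continuous fun z : (ℝ × ℝ) × (Fin 4 → ℝ) => S.g (S.toPhase z.1) :=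
    hS.g_contDiff.continuous.comp (S.contDiff_toPhase.continuous.comp continuous_fst)
  have h2 : Continuous fun z : (ℝ × ℝ) × (Fin 4 → ℝ) => S.h z.1.2 :=
    hS.h_contDiff.continuous.comp (continuous_snd.comp continuous_fst)
  have h3 : Continuous fun z : (ℝ × ℝ) × (Fin 4 → ℝ) =>
      S.g (S.toPhase z.1) - S.h z.1.2 ⬝ᵥ z.2 := h1.sub (h2.dotProduct continuous_snd)
  exact continuousOn_const.mul (h3.continuousOn.div (by fun_prop)
    fun z hz => sub_ne_zero.2 (hreg z.2 hz.2).symm)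

/-- The planar system with a given input has global solutions, as long as they stay in a given
bounded region. -/
theorem exists_solution_in_ball (hS : S.StandingAssumptions) (hP : P.PosDef) (hV : 0 ≤ V)
    (hreg : ∀ x ∈ ellipsoid P V, S.ν ⬝ᵥ x ≠ S.μ) {x : ℝ → Fin 4 → ℝ} (hx : Continuous x)
    (hxV : ∀ t, x t ∈ ellipsoid P V) {R : ℝ} (hR : 0 ≤ R) (p₀ : ℝ × ℝ) :
    ∃ p : ℝ → ℝ × ℝ, p 0 = p₀ ∧ Continuous p ∧ ∀ t, ‖p t‖ ≤ R →
      HasDerivAt p ((p t).2, -S.force (p t) (x t)) t := by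
  -- Composed with the retraction the field is bounded and globally Lipschitz, and it is unchanged
  -- inside the square.
  obtain ⟨r, hr, hrR, hrid⟩ := exists_retraction hR
  obtain ⟨L, hL, hlip⟩ := exists_force_lipschitz hS hP hV hreg R
  obtain ⟨B, hB⟩ := (isCompact_ellipsoid hP V).exists_bound_of_continuousOn
    (continuousOn_force hreg (0 : ℝ × ℝ))
  have hB0 : 0 ≤ B := (norm_nonneg _).trans (hB 0 (zero_mem_ellipsoid hV))
  have hrn : ∀ p q, ‖r p - r q‖ ≤ ‖p - q‖ := fun p q => by
    simpa [dist_eq_norm] using hr.dist_le_mul p q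
  have hv : ∀ t, LipschitzWith (⟨L, hL⟩ + 1)
      fun p => ((r p).2, -S.force (r p) (x t)) := by
    intro t
    refine LipschitzWith.of_dist_le_mul fun p q => ?_
    rw [dist_eq_norm, dist_eq_norm, Prod.norm_def]
    have h1 : ‖(r p).2 - (r q).2‖ ≤ ‖p - q‖ := (norm_snd_le (r p - r q)).trans (hrn p q)
    have h2 : |S.force (r p) (x t) - S.force (r q) (x t)| ≤ L * ‖p - q‖ :=
      (hlip _ (hxV t) _ _ (hrR p) (hrR q)).trans (by gcongr; exact hrn p q)
    have h0 := norm_nonneg (p - q)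
    have e : ((⟨L, hL⟩ + 1 : NNReal) : ℝ) = L + 1 := rfl
    rw [e]
    refine max_le ?_ ?_
    · simp only [Prod.fst_sub]
      nlinarith
    · simp only [Prod.snd_sub, Real.norm_eq_abs]
      rw [neg_sub_neg, abs_sub_comm]
      linarith
  have hc : ∀ p, Continuous fun t => ((r p).2, -S.force (r p) (x t)) := fun p =>
    continuous_const.prodMk ((continuousOn_force hreg (r p)).comp_continuous hx hxV).neg
  have hbound : ∀ t p, ‖((r p).2, -S.force (r p) (x t))‖ ≤
      ((⟨R + (B + L * R), by positivity⟩ : NNReal) : ℝ) := by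
    intro t p
    have h1 : ‖(r p).2‖ ≤ R := (norm_snd_le _).trans (hrR p)
    have h2 := hlip _ (hxV t) (r p) 0 (hrR p) (by simpa using hR)
    have h3 := hB _ (hxV t)
    rw [sub_zero] at h2
    have h4 : L * ‖r p‖ ≤ L * R := by gcongr; exact hrR p
    have h5 : |S.force (r p) (x t)| ≤ B + L * R := by
      have := abs_sub_abs_le_abs_sub (S.force (r p) (x t)) (S.force 0 (x t))
      rw [Real.norm_eq_abs] at h3
      linarith
    have h6 : 0 ≤ L * R := by positivity
    rw [Prod.norm_def]
    refine max_le ?_ ?_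
    · change ‖(r p).2‖ ≤ R + (B + L * R)
      linarith
    · change ‖-S.force (r p) (x t)‖ ≤ R + (B + L * R)
      rw [norm_neg, Real.norm_eq_abs]
      linarith
  obtain ⟨p, hp0, hp⟩ := exists_global_solution hv hc hbound p₀
  refine ⟨p, hp0, continuous_iff_continuousAt.2 fun t => (hp t).continuousAt, fun t ht => ?_⟩
  have := hp t
  rwa [hrid _ ht] at this

namespace OvalFamily

variable {C : ℝ → Set (ℝ × ℝ)} {a b : ℝ → ℝ} {eu el : ℝ → ℝ → ℝ}

theorem isClosed_hull (O : OvalFamily S P Vbar C a b eu el) (hV : V ∈ Icc 0 Vbar) :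
    IsClosed (verticalHull (C V)) := by
  rcases eq_or_lt_of_le hV.1 with h | h
  · rw [← h, O.verticalHull_zero]; exact isClosed_singleton
  · exact (O.oval V ⟨h, hV.2⟩).isClosed_hull

theorem exists_norm_le (O : OvalFamily S P Vbar C a b eu el) (hV : V ∈ Icc 0 Vbar) :
    ∃ R, 0 ≤ R ∧ ∀ p ∈ verticalHull (C V), ‖p‖ ≤ R := by
  obtain ⟨R, hR⟩ := (O.isCompact hV).isBounded.exists_norm_le
  exact ⟨R, (norm_nonneg _).trans (hR _ (O.right_mem hV)),
    fun p hp => norm_le_of_mem_verticalHull hR hp⟩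

theorem isCompact_hull (O : OvalFamily S P Vbar C a b eu el) (hV : V ∈ Icc 0 Vbar) :
    IsCompact (verticalHull (C V)) := by
  obtain ⟨R, -, hR⟩ := O.exists_norm_le hV
  exact Metric.isCompact_of_isClosed_isBounded (O.isClosed_hull hV)
    (isBounded_iff_forall_norm_le.2 ⟨R, hR⟩)

/-- For `V = 0` there is no oval: the hull is the origin, and invariance is uniqueness of the rest
solution, proved with `Y ^ 2 + W ^ 2`. -/
theorem mem_hull_of_trajectory (O : OvalFamily S P Vbar C a b eu el) (hV : V ∈ Icc 0 Vbar)
    {s t : ℝ} {Y W F : ℝ → ℝ}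
    (h : IsTrajectory (S.lowerForce P V) (S.upperForce P V) s t Y W F) (hst : s ≤ t)
    (h0 : (Y s, W s) ∈ verticalHull (C V)) : (Y t, W t) ∈ verticalHull (C V) := by
  rcases eq_or_lt_of_le hV.1 with hV0 | hV0
  swap
  · exact (O.oval V ⟨hV0, hV.2⟩).mem_hull_of_trajectory (O.lipschitz_lower hV)
      (O.lipschitz_upper hV) h hst h0
  rw [← hV0, O.verticalHull_zero, mem_singleton_iff, Prod.mk.injEq] at h0 ⊢
  rw [← hV0] at h
  obtain ⟨R, hR⟩ := isCompact_Icc.exists_bound_of_continuousOn (h.contY.prodMk h.contW)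
  have hR0 : 0 ≤ R := (norm_nonneg _).trans (hR s (left_mem_Icc.2 hst))
  obtain ⟨L, hL, hlip⟩ := O.lipschitz_lower (left_mem_Icc.2 O.nonneg) R
  have hF : ∀ r ∈ Ioo s t, |F r| ≤ L * (|Y r| + |W r|) := by
    intro r hr
    have h1 := h.le_F r hr
    have h2 := h.F_le r hr
    rw [upperForce_zero O.posDef, ← lowerForce_zero O.posDef] at h2
    have h3 : S.lowerForce P 0 (0, 0) = 0 := by
      rw [lowerForce_zero O.posDef, force_zero]
      simp [toPhase, O.standing.g_zero]
    have h4 := hlip (Y r, W r) (0, 0) (hR r (Ioo_subset_Icc_self hr)) (by simpa using hR0)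
    rw [h3, sub_zero, le_antisymm h1 h2] at h4
    refine h4.trans (mul_le_mul_of_nonneg_left ?_ hL)
    rw [Prod.norm_def]
    simp only [Prod.fst_sub, Prod.snd_sub, sub_zero, Real.norm_eq_abs]
    exact max_le (by linarith [abs_nonneg (W r)]) (by linarith [abs_nonneg (Y r)])
  have hD := nonpos_of_deriv_le_mul_abs (D := fun r => Y r ^ 2 + W r ^ 2)
    (D' := fun r => 2 * Y r * W r + 2 * W r * -F r) (K := 1 + 3 * L) hst
    ((h.contY.pow 2).add (h.contW.pow 2))
    (fun r hr => by
      have := ((h.derivY r hr).pow 2).add ((h.derivW r hr).pow 2)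
      simpa using! this)
    (fun r hr => by
      have h1 := hF r hr
      rw [abs_of_nonneg (by positivity)]
      have h2 : W r * -F r ≤ |W r| * (L * (|Y r| + |W r|)) := by
        calc W r * -F r ≤ |W r * -F r| := le_abs_self _
          _ = |W r| * |F r| := by rw [abs_mul, abs_neg]
          _ ≤ _ := by gcongr
      have h3 : |W r| * |Y r| ≤ (Y r ^ 2 + W r ^ 2) / 2 := by
        nlinarith [sq_nonneg (|W r| - |Y r|), sq_abs (W r), sq_abs (Y r)]
      have h4 : 2 * Y r * W r ≤ Y r ^ 2 + W r ^ 2 := by nlinarith [sq_nonneg (Y r - W r)]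
      have h5 : |W r| * |W r| ≤ Y r ^ 2 + W r ^ 2 := by
        nlinarith [sq_abs (W r), sq_nonneg (Y r)]
      nlinarith [mul_le_mul_of_nonneg_left h3 hL, mul_le_mul_of_nonneg_left h5 hL])
    (by simp [h0.1, h0.2])
  constructor <;> nlinarith [sq_nonneg (Y t), sq_nonneg (W t)]

/-- The planar trajectories with admissible inputs do not leave the hulls of the cycles. -/
theorem mem_hull (O : OvalFamily S P Vbar C a b eu el) (hV : V ∈ Icc 0 Vbar) {s t : ℝ}
    {p : ℝ → ℝ × ℝ} {x : ℝ → Fin 4 → ℝ} (hc : ContinuousOn p (Icc s t))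
    (hd : ∀ r ∈ Ioo s t, HasDerivAt p ((p r).2, -S.force (p r) (x r)) r)
    (hx : ∀ r ∈ Ioo s t, x r ∈ ellipsoid P V) (hst : s ≤ t) (h0 : p s ∈ verticalHull (C V)) :
    p t ∈ verticalHull (C V) :=
  O.mem_hull_of_trajectory hV (Y := fun r => (p r).1) (W := fun r => (p r).2)
    (F := fun r => S.force (p r) (x r))
    ⟨continuous_fst.comp_continuousOn hc, continuous_snd.comp_continuousOn hc,
      fun r hr => (hd r hr).fst, fun r hr => (hd r hr).snd,
      fun r hr => lowerForce_le O.posDef hV.1 (O.reg' hV.2) _ (hx r hr),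
      fun r hr => le_upperForce O.posDef hV.1 (O.reg' hV.2) _ (hx r hr)⟩ hst h0

/-- The planar system with an admissible input has a global solution in the largest hull. -/
theorem exists_solution (O : OvalFamily S P Vbar C a b eu el) {x : ℝ → Fin 4 → ℝ}
    (hx : Continuous x) (hxV : ∀ t, x t ∈ ellipsoid P Vbar) {p₀ : ℝ × ℝ}
    (hp₀ : p₀ ∈ verticalHull (C Vbar)) :
    ∃ p : ℝ → ℝ × ℝ, p 0 = p₀ ∧ Continuous p ∧ ∀ t, 0 ≤ t → p t ∈ verticalHull (C Vbar) ∧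
      HasDerivAt p ((p t).2, -S.force (p t) (x t)) t := by
  have hVbar : Vbar ∈ Icc 0 Vbar := ⟨O.nonneg, le_rfl⟩
  obtain ⟨R, hR0, hR⟩ := O.exists_norm_le hVbar
  obtain ⟨p, hp0, hpc, hp⟩ := exists_solution_in_ball O.standing O.posDef O.nonneg O.reg hx hxV
    (R := R + 1) (by linarith) p₀
  have hmem : ∀ T, Icc 0 T ⊆ {t | p t ∈ verticalHull (C Vbar)} := by
    intro T
    -- Continuation in time: in the hull the norm is at most `R`, and the margin `1` keeps the
    -- equation valid slightly beyond, where invariance applies.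
    refine IsClosed.Icc_subset_of_forall_exists_gt
      (((O.isClosed_hull hVbar).preimage hpc).inter isClosed_Icc) (by simpa [hp0] using hp₀) ?_
    rintro s ⟨hs, -⟩ y hy
    have hlt : ‖p s‖ < R + 1 := by linarith [hR _ hs]
    obtain ⟨δ, hδ, hball⟩ := Metric.eventually_nhds_iff.1
      (hpc.norm.continuousAt.eventually (gt_mem_nhds hlt))
    have hz : s < min y (s + δ / 2) := lt_min hy (by linarith)
    refine ⟨min y (s + δ / 2), ?_, hz, min_le_left _ _⟩
    refine O.mem_hull hVbar hpc.continuousOn (fun r hr => hp r (hball ?_).le)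
      (fun r _ => hxV r) hz.le hs
    rw [Real.dist_eq, abs_of_pos (by linarith [hr.1])]
    linarith [hr.2, min_le_right y (s + δ / 2)]
  refine ⟨p, hp0, hpc, fun t ht => ?_⟩
  have h1 := hmem t (right_mem_Icc.2 ht)
  exact ⟨h1, hp t (by linarith [hR _ h1])⟩

end OvalFamily

end InverterSystem

/-! ### Convergence of the planar part. -/

namespace InverterSystem

namespace OvalFamily

variable {S : InverterSystem} {P : Matrix (Fin 4) (Fin 4) ℝ} {Vbar : ℝ} {C : ℝ → Set (ℝ × ℝ)}
  {a b : ℝ → ℝ} {eu el : ℝ → ℝ → ℝ}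

/-- A cycle carries no orbit of the system without input. -/
theorem not_isOrbit (O : OvalFamily S P Vbar C a b eu el) {V : ℝ} (hV : V ∈ Ioc 0 Vbar)
    {Y W : ℝ → ℝ} (h : IsOrbit (fun p => S.force p 0) (C V) Y W) : False := by
  have hO := O.oval V hV
  have hV' := Ioc_subset_Icc_self hV
  have hki := O.standing.ki_pos.ne'
  have h0 : (0 : ℝ) ∈ Icc 0 Vbar := left_mem_Icc.2 O.nonneg
  have hφ : Continuous fun p => S.force p 0 := by
    have := (O.lipschitz_lower h0).continuous
    rwa [show S.lowerForce P 0 = fun p => S.force p 0 from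
      funext (lowerForce_zero O.posDef)] at this
  have hm : ∀ p, S.lowerForce P V p ≤ S.force p 0 := fun p =>
    lowerForce_le O.posDef hV'.1 (O.reg' hV.2) p (zero_mem_ellipsoid hV'.1)
  have hM : ∀ p, S.force p 0 ≤ S.upperForce P V p := fun p =>
    le_upperForce O.posDef hV'.1 (O.reg' hV.2) p (zero_mem_ellipsoid hV'.1)
  obtain ⟨hb, w₀, hw₀, hw⟩ := hO.exists_field_eq_of_orbit hφ hm hM h
  obtain ⟨ha, w₁, hw₁, hw'⟩ := hO.reflect.exists_field_eq_of_orbit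
    (φ := _root_.reflect fun p => S.force p 0) (hφ.comp continuous_neg).neg
    (fun p => neg_le_neg (hM _)) (fun p => neg_le_neg (hm _)) h.reflect
  -- The force at `x = 0` is the minimum over the ellipsoid of level `0`, so this is a coincidence
  -- of minima at the levels `0` and `V`.
  have hlow : ∀ p, S.force p 0 = S.lowerForce P V p → S.Degenerate p := fun p hp =>
    degenerate_of_lowerForce_eq hki O.posDef le_rfl hV.1 (O.reg' hV.2)
      (by rw [lowerForce_zero O.posDef, hp])
  have hupp : ∀ p, S.force p 0 = S.upperForce P V p → S.Degenerate p := fun p hp =>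
    degenerate_of_upperForce_eq hki O.posDef le_rfl hV.1 (O.reg' hV.2)
      (by rw [upperForce_zero O.posDef, hp])
  have hcl := isClosed_degenerate O.standing
  have hb' : S.Degenerate (b V, 0) := closure_minimal (fun p hp => hlow p hp) hcl hb
  have ha' : S.Degenerate (a V, 0) := by
    have hcl' : IsClosed {p | S.Degenerate (-p)} := hcl.preimage continuous_neg
    have := closure_minimal (fun p (hp : _ = _) => hupp (-p) (neg_injective hp)) hcl' ha
    have this : S.Degenerate (-(-a V, (0 : ℝ))) := this
    rwa [Prod.neg_mk, neg_neg, neg_zero] at this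
  refine O.not_degenerate hV ha' hb' ?_
  filter_upwards [Ioo_mem_nhds (neg_lt_zero.2 hw₁) hw₀] with w hww
  rcases lt_trichotomy w 0 with hlt | rfl | hlt
  · obtain ⟨y, hy⟩ := hw' (-w) ⟨by linarith, by linarith [hww.1]⟩
    have := hupp _ (neg_injective hy)
    simp only [Prod.neg_mk, neg_neg] at this
    exact ⟨_, this⟩
  · exact ⟨_, hb'⟩
  · obtain ⟨y, hy⟩ := hw w ⟨hlt, hww.2⟩
    exact ⟨y, hlow _ hy⟩

/-- The input has little influence once it is small. -/
theorem eventually_force_close (O : OvalFamily S P Vbar C a b eu el) {x : ℝ → Fin 4 → ℝ}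
    (hx : ∀ t, 0 ≤ t → x t ∈ ellipsoid P Vbar) (hx0 : Tendsto x atTop (𝓝 0)) {ε : ℝ} (hε : 0 < ε) :
    ∃ T, 0 ≤ T ∧ ∀ t, T ≤ t → ∀ p ∈ verticalHull (C Vbar),
      |S.force p (x t) - S.force p 0| ≤ ε := by
  have hVbar : Vbar ∈ Icc 0 Vbar := ⟨O.nonneg, le_rfl⟩
  have huc := ((O.isCompact_hull hVbar).prod
    (isCompact_ellipsoid O.posDef Vbar)).uniformContinuousOn_of_continuous
    ((continuousOn_force_prod O.standing O.reg).mono (prod_mono_left (subset_univ _)))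
  obtain ⟨δ, hδ, h⟩ := Metric.uniformContinuousOn_iff.1 huc ε hε
  obtain ⟨T, hT⟩ := eventually_atTop.1 (hx0.eventually (Metric.ball_mem_nhds 0 hδ))
  refine ⟨max T 0, le_max_right _ _, fun t ht p hp => ?_⟩
  have h1 := h (p, x t) ⟨hp, hx t ((le_max_right _ _).trans ht)⟩ (p, 0)
    ⟨hp, zero_mem_ellipsoid O.nonneg⟩ (by
      rw [Prod.dist_eq, dist_self]
      exact max_lt hδ (hT t ((le_max_left _ _).trans ht)))
  exact h1.le

/-- The limit of the translates of a trajectory with a vanishing input is a trajectory without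
input. -/
theorem tendsto_translates (O : OvalFamily S P Vbar C a b eu el) {x : ℝ → Fin 4 → ℝ}
    (hx : ∀ t, 0 ≤ t → x t ∈ ellipsoid P Vbar) (hx0 : Tendsto x atTop (𝓝 0)) {p q : ℝ → ℝ × ℝ}
    (hp : ∀ t, 0 ≤ t → p t ∈ verticalHull (C Vbar) ∧
      HasDerivWithinAt p ((p t).2, -S.force (p t) (x t)) (Ici 0) t)
    (hq : ∀ t, 0 ≤ t → q t ∈ verticalHull (C Vbar) ∧
      HasDerivAt q ((q t).2, -S.force (q t) 0) t) {σ : ℕ → ℝ} (hσ : Tendsto σ atTop atTop)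
    (h0 : Tendsto (fun n => p (σ n)) atTop (𝓝 (q 0))) {τ : ℝ} (hτ : 0 ≤ τ) :
    Tendsto (fun n => p (σ n + τ)) atTop (𝓝 (q τ)) := by
  have hVbar : Vbar ∈ Icc 0 Vbar := ⟨O.nonneg, le_rfl⟩
  obtain ⟨R, -, hR⟩ := O.exists_norm_le hVbar
  obtain ⟨L, hL, hlip⟩ := exists_force_lipschitz O.standing O.posDef O.nonneg O.reg R
  set K : NNReal := ⟨L + 1, by positivity⟩ with hK
  have hK0 : (K : ℝ) ≠ 0 := by
    change L + 1 ≠ 0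
    positivity
  have hKpos : (0 : ℝ) < K := lt_of_le_of_ne K.2 hK0.symm
  have hv : LipschitzOnWith K (fun p : ℝ × ℝ => (p.2, -S.force p 0)) (verticalHull (C Vbar)) := by
    refine LipschitzOnWith.of_dist_le_mul fun u hu w hw => ?_
    rw [dist_eq_norm, dist_eq_norm, Prod.norm_def]
    have h1 : ‖u.2 - w.2‖ ≤ ‖u - w‖ := norm_snd_le (u - w)
    have h2 := hlip 0 (zero_mem_ellipsoid O.nonneg) u w (hR u hu) (hR w hw)
    have h3 := norm_nonneg (u - w)
    change max _ _ ≤ (L + 1) * _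
    refine max_le ?_ ?_
    · simp only [Prod.fst_sub]
      nlinarith
    · simp only [Prod.snd_sub, Real.norm_eq_abs]
      rw [neg_sub_neg, abs_sub_comm]
      linarith
  -- The Grönwall factor at time `τ` when the initial error and the error of the field have the same
  -- bound; the bound `η / (B + 1)` then gives a total error below `η`.
  set B : ℝ := Real.exp (K * τ) + (Real.exp (K * τ) - 1) / K with hB
  have hB0 : 0 ≤ B := by
    have : 1 ≤ Real.exp (K * τ) := Real.one_le_exp (by positivity)
    have h1 : 0 ≤ (Real.exp (K * τ) - 1) / K := div_nonneg (by linarith) hKpos.le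
    positivity
  refine Metric.tendsto_nhds.2 fun η hη => ?_
  have hε : 0 < η / (B + 1) := by positivity
  obtain ⟨T, hT0, hT⟩ := O.eventually_force_close hx hx0 hε
  filter_upwards [hσ.eventually_ge_atTop T, Metric.tendsto_nhds.1 h0 _ hε] with n hn hdist
  have hσ0 : 0 ≤ σ n := hT0.trans hn
  have hder : ∀ t, 0 ≤ t → HasDerivWithinAt (fun r => p (σ n + r))
      ((p (σ n + t)).2, -S.force (p (σ n + t)) (x (σ n + t))) (Ici 0) t := by
    intro t ht
    have h1 := (hp (σ n + t) (by linarith)).2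
    have h2 : HasDerivWithinAt (fun r => σ n + r) 1 (Ici 0) t :=
      ((hasDerivAt_id t).const_add (σ n)).hasDerivWithinAt
    have h3 := h1.scomp t h2 fun r hr => add_nonneg hσ0 hr
    simpa [Function.comp_def] using h3
  have h := dist_le_of_approx_trajectories_ODE_of_mem
    (v := fun _ p => (p.2, -S.force p 0)) (s := fun _ => verticalHull (C Vbar)) (a := 0) (b := τ)
    (K := K) (f := fun r => p (σ n + r)) (g := q) (εf := η / (B + 1)) (εg := 0)
    (f' := fun t => ((p (σ n + t)).2, -S.force (p (σ n + t)) (x (σ n + t))))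
    (g' := fun t => ((q t).2, -S.force (q t) 0)) (δ := η / (B + 1))
    (fun _ _ => hv)
    (fun t ht => ((hder t ht.1).continuousWithinAt).mono Icc_subset_Ici_self)
    (fun t ht => (hder t ht.1).mono (Ici_subset_Ici.2 ht.1))
    (fun t ht => by
      rw [dist_eq_norm, Prod.norm_def]
      refine max_le (by simpa using hε.le) ?_
      simp only [Prod.snd_sub, Real.norm_eq_abs]
      rw [neg_sub_neg, abs_sub_comm]
      exact hT _ (by linarith [ht.1]) _ (hp _ (by linarith [ht.1])).1)
    (fun t ht => (hp _ (by linarith [ht.1])).1)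
    (fun t ht => (hq t ht.1).2.continuousAt.continuousWithinAt)
    (fun t ht => (hq t ht.1).2.hasDerivWithinAt)
    (fun t ht => by simp)
    (fun t ht => (hq t ht.1).1)
    (by simpa using hdist.le) τ (right_mem_Icc.2 hτ)
  rw [gronwallBound_of_K_ne_0 hK0] at h
  simp only [add_zero, sub_zero] at h
  calc dist (p (σ n + τ)) (q τ) ≤ η / (B + 1) * B := by
        refine h.trans (le_of_eq ?_)
        rw [hB]
        ring
    _ < η := by
        rw [div_mul_eq_mul_div, div_lt_iff₀ (by positivity)]
        nlinarith

/-- The planar trajectories with a vanishing input converge to the origin. -/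
theorem tendsto_zero (O : OvalFamily S P Vbar C a b eu el) {x : ℝ → Fin 4 → ℝ}
    (hx : ∀ t, 0 ≤ t → x t ∈ ellipsoid P Vbar) (hx0 : Tendsto x atTop (𝓝 0)) {p : ℝ → ℝ × ℝ}
    (hp : ∀ t, 0 ≤ t → p t ∈ verticalHull (C Vbar) ∧
      HasDerivWithinAt p ((p t).2, -S.force (p t) (x t)) (Ici 0) t) :
    Tendsto p atTop (𝓝 0) := by
  have hVbar : Vbar ∈ Icc 0 Vbar := ⟨O.nonneg, le_rfl⟩
  have hsmall : ∀ V, 0 < V → ∃ T, 0 ≤ T ∧ ∀ t, T ≤ t → x t ∈ ellipsoid P V := by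
    intro V hV
    have h1 : Tendsto (fun t => VCC P (x t)) atTop (𝓝 0) := by
      have := (continuous_VCC (P := P)).tendsto 0
      rw [VCC_zero] at this
      exact this.comp hx0
    obtain ⟨T, hT⟩ := eventually_atTop.1 (h1.eventually (gt_mem_nhds hV))
    exact ⟨max T 0, le_max_right _ _, fun t ht => (hT t ((le_max_left _ _).trans ht)).le⟩
  have hinv : ∀ V ∈ Icc 0 Vbar, ∀ s, 0 ≤ s → (∀ t, s ≤ t → x t ∈ ellipsoid P V) →
      p s ∈ verticalHull (C V) → ∀ t, s ≤ t → p t ∈ verticalHull (C V) := by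
    intro V hV s hs hxs hps t hst
    refine O.mem_hull hV (p := p) (x := x) (fun r hr => ?_) (fun r hr => ?_)
      (fun r hr => hxs r hr.1.le) hst hps
    · exact (hp r (hs.trans hr.1)).2.continuousWithinAt.mono
        fun y hy => hs.trans hy.1
    · exact (hp r (hs.trans hr.1.le)).2.hasDerivAt (Ici_mem_nhds (hs.trans_lt hr.1))
  -- The levels whose hulls eventually contain the trajectory; convergence amounts to their infimum
  -- being `0`.
  set I := {V | V ∈ Icc 0 Vbar ∧ ∃ T, 0 ≤ T ∧ ∀ t, T ≤ t → p t ∈ verticalHull (C V)} with hI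
  have hmemI : Vbar ∈ I := ⟨hVbar, 0, le_rfl, fun t ht => (hp t ht).1⟩
  have hbdd : BddBelow I := ⟨0, fun V hV => hV.1.1⟩
  have hinf : sInf I ∈ Icc 0 Vbar := ⟨le_csInf ⟨_, hmemI⟩ fun V hV => hV.1.1, csInf_le hbdd hmemI⟩
  have hup : ∀ V ∈ Ioc (sInf I) Vbar, V ∈ I := by
    intro V hV
    obtain ⟨V', hV', hlt⟩ := exists_lt_of_csInf_lt ⟨_, hmemI⟩ hV.1
    obtain ⟨T, hT0, hT⟩ := hV'.2
    exact ⟨⟨hV'.1.1.trans hlt.le, hV.2⟩, T, hT0,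
      fun t ht => O.hull_mono hV'.1.1 hlt.le hV.2 (hT t ht)⟩
  have hzero : sInf I = 0 := by
    by_contra hne
    have hpos : 0 < sInf I := lt_of_le_of_ne hinf.1 (Ne.symm hne)
    obtain ⟨p₀, hp₀, σ, hσ, hlim⟩ := (O.isCompact_hull hVbar).tendsto_subseq
      (x := fun n : ℕ => p n) fun n => (hp n n.cast_nonneg).1
    obtain ⟨q, hq0, hqc, hq⟩ := O.exists_solution (x := fun _ => 0) continuous_const
      (fun _ => zero_mem_ellipsoid O.nonneg) hp₀
    have hσ' : Tendsto (fun n => (σ n : ℝ)) atTop atTop :=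
      tendsto_natCast_atTop_atTop.comp hσ.tendsto_atTop
    have htr : ∀ τ, 0 ≤ τ → Tendsto (fun n => p (σ n + τ)) atTop (𝓝 (q τ)) := fun τ hτ =>
      O.tendsto_translates hx hx0 hp hq hσ' (by rw [hq0]; exact hlim) hτ
    have hadd : ∀ τ : ℝ, 0 ≤ τ → ∀ T : ℝ, ∀ᶠ n in atTop, T ≤ σ n + τ := fun τ hτ T => by
      filter_upwards [hσ'.eventually_ge_atTop T] with n hn
      linarith
    have hhull : ∀ τ, 0 ≤ τ → q τ ∈ verticalHull (C (sInf I)) := by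
      intro τ hτ
      refine O.mem_hull_of_forall_gt hinf (hq τ hτ).1 fun V hV => ?_
      obtain ⟨hVm, T, hT0, hT⟩ := hup V hV
      refine (O.isClosed_hull hVm).mem_of_tendsto (htr τ hτ) ?_
      filter_upwards [hadd τ hτ T] with n hn using hT _ hn
    -- A limit point off the cycle is interior to a smaller hull. The trajectory enters that hull at
    -- a time when the input is already in its ellipsoid, and it never leaves, contrary to
    -- minimality.
    have hcyc : ∀ τ, 0 ≤ τ → q τ ∈ C (sInf I) := by
      intro τ hτ
      by_contra hqC
      obtain ⟨V, hV, hqV, hqVC⟩ := O.exists_lt_mem_hull ⟨hpos, hinf.2⟩ (hhull τ hτ) hqC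
      have hVm : V ∈ Ioc 0 Vbar := ⟨hV.1, hV.2.le.trans hinf.2⟩
      have hVm' := Ioc_subset_Icc_self hVm
      obtain ⟨T, hT0, hT⟩ := hsmall V hV.1
      have hev := (htr τ hτ).eventually ((O.oval V hVm).hull_mem_nhds hqV hqVC)
      obtain ⟨n, hn, hn'⟩ := (hev.and (hadd τ hτ T)).exists
      have hVI : V ∈ I := ⟨hVm', σ n + τ, hT0.trans hn', hinv V hVm' _ (hT0.trans hn')
        (fun t ht => hT t (hn'.trans ht)) hn⟩
      exact absurd (csInf_le hbdd hVI) (not_le.2 hV.2)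
    exact O.not_isOrbit ⟨hpos, hinf.2⟩ (Y := fun t => (q t).1) (W := fun t => (q t).2)
      ⟨hqc.fst, hqc.snd, fun t ht => (hq t ht).2.fst, fun t ht => (hq t ht).2.snd, hcyc⟩
  refine Metric.tendsto_nhds.2 fun ε hε => ?_
  have h0 : (0 : ℝ) ∈ Icc 0 Vbar := left_mem_Icc.2 O.nonneg
  obtain ⟨V, hVI, hV⟩ : ∃ V ∈ I, ∀ q ∈ C V, ‖q‖ ≤ ε / 2 := by
    rcases eq_or_lt_of_le O.nonneg with h | h
    · refine ⟨Vbar, hmemI, ?_⟩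
      rw [← h, O.zero]
      rintro q rfl
      simp only [Prod.mk_zero_zero, norm_zero]
      positivity
    · have hev := (O.close 0 h0 (ε / 2) (by positivity)).filter_mono
        (nhdsWithin_mono 0 Ioc_subset_Icc_self)
      rw [nhdsWithin_Ioc_eq_nhdsGT h] at hev
      obtain ⟨V, hV, hVm⟩ := (hev.and (Ioc_mem_nhdsGT h)).exists
      refine ⟨V, hup V (by rwa [hzero]), fun q hq => ?_⟩
      obtain ⟨q', hq', hd⟩ := hV.1 q hq
      rw [O.zero, mem_singleton_iff] at hq'
      rw [hq', Prod.mk_zero_zero, dist_zero_right] at hd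
      exact hd.le
  obtain ⟨-, T, -, hT⟩ := hVI
  filter_upwards [eventually_ge_atTop T] with t ht
  rw [dist_zero_right]
  linarith [norm_le_of_mem_verticalHull hV (hT t ht)]

end OvalFamily

end InverterSystem

/-! ### Decay of the input and assembly of the estimate. -/

namespace InverterSystem

section Decay

variable {P A : Matrix (Fin 4) (Fin 4) ℝ} {γ : ℝ}

theorem VCC_nonneg (hP : P.PosDef) (x : Fin 4 → ℝ) : 0 ≤ VCC P x := by
  simpa [VCC] using hP.posSemidef.dotProduct_mulVec_nonneg x

theorem hasDerivAt_VCC {x : ℝ → Fin 4 → ℝ} {v : Fin 4 → ℝ} {t : ℝ} (hx : HasDerivAt x v t) :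
    HasDerivAt (fun t => VCC P (x t)) (v ⬝ᵥ (P *ᵥ x t) + x t ⬝ᵥ (P *ᵥ v)) t := by
  have hx' := hasDerivAt_pi.1 hx
  have h1 : ∀ i, HasDerivAt (fun t => (P *ᵥ x t) i) ((P *ᵥ v) i) t := fun i =>
    HasDerivAt.fun_sum (u := Finset.univ) fun j _ => (hx' j).const_mul (P i j)
  have h2 : HasDerivAt (fun t => VCC P (x t))
      (∑ i, (v i * (P *ᵥ x t) i + x t i * (P *ᵥ v) i)) t :=
    HasDerivAt.fun_sum (u := Finset.univ) fun i _ => (hx' i).mul (h1 i)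
  rwa [Finset.sum_add_distrib] at h2

theorem deriv_VCC_le (hPA : (-(Aᵀ * P + P * A + γ • P)).PosDef) (x : Fin 4 → ℝ) :
    (A *ᵥ x) ⬝ᵥ (P *ᵥ x) + x ⬝ᵥ (P *ᵥ (A *ᵥ x)) ≤ -γ * VCC P x := by
  have h := hPA.posSemidef.dotProduct_mulVec_nonneg x
  have e : (A *ᵥ x) ⬝ᵥ (P *ᵥ x) = x ⬝ᵥ (Aᵀ *ᵥ (P *ᵥ x)) := by
    rw [Matrix.dotProduct_mulVec x Aᵀ, Matrix.vecMul_transpose]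
  simp only [star_trivial, Matrix.neg_mulVec, Matrix.add_mulVec, Matrix.smul_mulVec,
    dotProduct_neg, dotProduct_add, dotProduct_smul, smul_eq_mul, ← Matrix.mulVec_mulVec] at h
  rw [e, VCC]
  linarith

/-- The Lyapunov function decays exponentially. -/
theorem VCC_le_exp (hPA : (-(Aᵀ * P + P * A + γ • P)).PosDef) {x : ℝ → Fin 4 → ℝ} {t : ℝ}
    (ht : 0 ≤ t) (hc : ContinuousOn x (Icc 0 t))
    (hd : ∀ s ∈ Ioo 0 t, HasDerivAt x (A *ᵥ x s) s) :
    VCC P (x t) ≤ Real.exp (-γ * t) * VCC P (x 0) := by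
  have hanti : AntitoneOn (fun s => Real.exp (γ * s) * VCC P (x s)) (Icc 0 t) := by
    refine antitoneOn_of_hasDerivWithinAt_nonpos
      (f' := fun s => Real.exp (γ * s) * γ * VCC P (x s) + Real.exp (γ * s) *
        ((A *ᵥ x s) ⬝ᵥ (P *ᵥ x s) + x s ⬝ᵥ (P *ᵥ (A *ᵥ x s)))) (convex_Icc _ _) ?_ ?_ ?_
    · exact ContinuousOn.mul (by fun_prop) (continuous_VCC.comp_continuousOn hc)
    · intro s hs
      rw [interior_Icc] at hs
      have h1 : HasDerivAt (fun s => Real.exp (γ * s)) (Real.exp (γ * s) * γ) s := by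
        simpa using ((hasDerivAt_id s).const_mul γ).exp
      exact (h1.mul (hasDerivAt_VCC (hd s hs))).hasDerivWithinAt
    · intro s _
      nlinarith [Real.exp_pos (γ * s), deriv_VCC_le hPA (x s)]
  have h := hanti (left_mem_Icc.2 ht) (right_mem_Icc.2 ht) ht
  simp only [mul_zero, Real.exp_zero, one_mul] at h
  calc VCC P (x t) = Real.exp (-γ * t) * (Real.exp (γ * t) * VCC P (x t)) := by
        rw [← mul_assoc, ← Real.exp_add, neg_mul, neg_add_cancel, Real.exp_zero, one_mul]
    _ ≤ _ := by gcongr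

theorem exists_linear_solution (A : Matrix (Fin 4) (Fin 4) ℝ) (x₀ : Fin 4 → ℝ) :
    ∃ x : ℝ → Fin 4 → ℝ, x 0 = x₀ ∧ ∀ t, HasDerivAt x (A *ᵥ x t) t := by
  set L : (Fin 4 → ℝ) →L[ℝ] (Fin 4 → ℝ) := A.mulVecLin.toContinuousLinearMap with hL
  refine ⟨fun t => NormedSpace.exp (t • L) x₀, by simp, fun t => ?_⟩
  have h := (hasDerivAt_exp_smul_const' L t).clm_apply (hasDerivAt_const t x₀)
  simpa [hL] using h

end Decay

variable {S : InverterSystem} {P : Matrix (Fin 4) (Fin 4) ℝ} {γ Vbar : ℝ} {C : ℝ → Set (ℝ × ℝ)}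

/-- The planar components of a state, in the variables `(θ - (kp / ki) ω, ω)`. -/
def planar (S : InverterSystem) (z : State) : ℝ × ℝ := S.ofPhase (z.1, z.2.1)

theorem hasDerivWithinAt_planar (hki : S.ki ≠ 0) {I : Set ℝ} {z : ℝ → State} {t : ℝ}
    (h : HasDerivWithinAt z (S.field (z t)) I t) :
    HasDerivWithinAt (fun t => S.planar (z t))
      ((S.planar (z t)).2, -S.force (S.planar (z t)) (z t).2.2) I t := by
  have h1 : HasDerivWithinAt (fun t => (z t).1) (S.field (z t)).1 I t := h.fst
  have h2 : HasDerivWithinAt (fun t => (z t).2.1) (S.field (z t)).2.1 I t := h.snd.fst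
  refine ((h1.sub (h2.const_mul S.slope)).prodMk h2).congr_deriv ?_
  simp only [planar, force, toPhase_ofPhase, field, Prod.mk.injEq]
  simp only [ofPhase, slope]
  constructor
  · field_simp
    ring
  · ring

theorem hasDerivWithinAt_current {I : Set ℝ} {z : ℝ → State} {t : ℝ}
    (h : HasDerivWithinAt z (S.field (z t)) I t) :
    HasDerivWithinAt (fun t => (z t).2.2) (S.A *ᵥ (z t).2.2) I t := h.snd.snd

theorem VPLL_le_iff {p : ℝ × ℝ} :
    VPLL Vbar C p ≤ (Vbar : EReal) ↔ ∃ V ∈ Icc 0 Vbar, p ∈ C V := by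
  constructor
  · intro h
    by_contra! hne
    have : {V | V ∈ Icc 0 Vbar ∧ p ∈ C V} = ∅ :=
      eq_empty_of_forall_notMem fun V hV => hne V hV.1 hV.2
    rw [VPLL, this, image_empty, sInf_empty, top_le_iff] at h
    exact EReal.coe_ne_top _ h
  · rintro ⟨V, hV, hp⟩
    have hmem : V ∈ {V | V ∈ Icc 0 Vbar ∧ p ∈ C V} := ⟨hV, hp⟩
    exact (sInf_le (mem_image_of_mem _ hmem)).trans (EReal.coe_le_coe_iff.2 hV.2)

namespace OvalFamily

variable {a b : ℝ → ℝ} {eu el : ℝ → ℝ → ℝ}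

/-- Since the cycles fill the largest hull, `VPLL ≤ Vbar` means membership in it; this is where the
foliation enters. -/
theorem mem_invariantSquare_iff (O : OvalFamily S P Vbar (fun V => S.ofPhase '' C V) a b eu el)
    (z : State) : z ∈ invariantSquare P Vbar C ↔
      S.planar z ∈ verticalHull (S.ofPhase '' C Vbar) ∧ z.2.2 ∈ ellipsoid P Vbar := by
  have h := O.mem_hull_iff_exists (p := S.planar z)
  simp only [mem_image_ofPhase, planar, toPhase_ofPhase] at h
  change VPLL Vbar C (z.1, z.2.1) ≤ (Vbar : EReal) ∧ _ ↔ _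
  rw [VPLL_le_iff, ← h]
  rfl

theorem forwardInvariant (O : OvalFamily S P Vbar (fun V => S.ofPhase '' C V) a b eu el)
    (hγ : 0 < γ) (hPA : (-(S.Aᵀ * P + P * S.A + γ • P)).PosDef) :
    S.ForwardInvariant (invariantSquare P Vbar C) := by
  intro τ z hz hz0 t ht
  rw [O.mem_invariantSquare_iff] at hz0 ⊢
  have hx : ∀ s ∈ Icc 0 τ, (z s).2.2 ∈ ellipsoid P Vbar := by
    intro s hs
    have h := VCC_le_exp hPA (x := fun t => (z t).2.2) hs.1
      (fun r hr => (hasDerivWithinAt_current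
        (hz r ⟨hr.1, hr.2.trans hs.2⟩).2).continuousWithinAt.mono (Icc_subset_Icc_right hs.2))
      (fun r hr => (hasDerivWithinAt_current (hz r ⟨hr.1.le, hr.2.le.trans hs.2⟩).2).hasDerivAt
        (Icc_mem_nhds hr.1 (hr.2.trans_le hs.2)))
    have h1 : Real.exp (-γ * s) ≤ 1 := Real.exp_le_one_iff.2 (by nlinarith [hs.1])
    exact h.trans ((mul_le_of_le_one_left (VCC_nonneg O.posDef _) h1).trans hz0.2)
  refine ⟨O.mem_hull (V := Vbar) ⟨O.nonneg, le_rfl⟩ (p := fun t => S.planar (z t))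
    (x := fun t => (z t).2.2) (fun r hr => ?_) (fun r hr => ?_)
    (fun r hr => hx r ⟨hr.1.le, hr.2.le.trans ht.2⟩) ht.1 hz0.1, hx t ht⟩
  · exact (hasDerivWithinAt_planar O.standing.ki_pos.ne'
      (hz r ⟨hr.1, hr.2.trans ht.2⟩).2).continuousWithinAt.mono (Icc_subset_Icc_right ht.2)
  · exact (hasDerivWithinAt_planar O.standing.ki_pos.ne'
      (hz r ⟨hr.1.le, hr.2.le.trans ht.2⟩).2).hasDerivAt (Icc_mem_nhds hr.1 (hr.2.trans_le ht.2))

theorem exists_isSolutionOn (O : OvalFamily S P Vbar (fun V => S.ofPhase '' C V) a b eu el)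
    (hγ : 0 < γ) (hPA : (-(S.Aᵀ * P + P * S.A + γ • P)).PosDef) {z₀ : State}
    (hz₀ : z₀ ∈ invariantSquare P Vbar C) :
    ∃ z : ℝ → State, S.IsSolutionOn (Ici 0) z ∧ z 0 = z₀ := by
  rw [O.mem_invariantSquare_iff] at hz₀
  have hki := O.standing.ki_pos.ne'
  obtain ⟨x, hx0, hx⟩ := exists_linear_solution S.A z₀.2.2
  have hxc : Continuous x := continuous_iff_continuousAt.2 fun t => (hx t).continuousAt
  -- The input is frozen for negative times, as the linear flow may leave the ellipsoid backwards.
  have hxV : ∀ t, x (max 0 t) ∈ ellipsoid P Vbar := by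
    intro t
    have h0 : 0 ≤ max 0 t := le_max_left _ _
    have h := VCC_le_exp hPA h0 hxc.continuousOn fun s _ => hx s
    have h1 : Real.exp (-γ * max 0 t) ≤ 1 := Real.exp_le_one_iff.2 (by nlinarith)
    refine h.trans ((mul_le_of_le_one_left (VCC_nonneg O.posDef _) h1).trans ?_)
    rw [hx0]
    exact hz₀.2
  obtain ⟨p, hp0, -, hp⟩ := O.exists_solution
    (hxc.comp (continuous_const.max continuous_id)) hxV hz₀.1
  refine ⟨fun t => ((S.toPhase (p t)).1, (p t).2, x t), fun t ht => ?_, ?_⟩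
  · have ht0 : max 0 t = t := max_eq_right ht
    have h1 := (hp t ht).2
    simp only [Function.comp_apply, id_eq, ht0] at h1
    refine ⟨O.reg _ (by simpa only [ht0] using hxV t), HasDerivAt.hasDerivWithinAt ?_⟩
    have hY : HasDerivAt (fun t => (p t).1) (p t).2 t := h1.fst
    have hW : HasDerivAt (fun t => (p t).2) (-S.force (p t) (x t)) t := h1.snd
    refine ((hY.add (hW.const_mul S.slope)).prodMk (hW.prodMk (hx t))).congr_deriv ?_
    simp only [field, force, toPhase, slope, Prod.mk.injEq, and_true]
    constructor
    · field_simp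
      ring
    · ring
  · have h : S.toPhase (p 0) = (z₀.1, z₀.2.1) := by rw [hp0, planar, toPhase_ofPhase]
    change (_, (S.toPhase (p 0)).2, x 0) = z₀
    rw [h, hx0]

/-- On a vertical line of the `(y, ω)` plane `θ = y + (kp / ki) ω` increases with `ω`, so `θ` lies
between its values at two points of the cycle. -/
theorem abs_fst_le (O : OvalFamily S P Vbar (fun V => S.ofPhase '' C V) a b eu el) {r : ℝ}
    (hr : ∀ p ∈ C Vbar, |p.1| ≤ r) {z : State} (hz : z ∈ invariantSquare P Vbar C) :
    |z.1| ≤ r := by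
  obtain ⟨⟨w, hw, h⟩, ⟨w', hw', h'⟩⟩ := ((O.mem_invariantSquare_iff z).1 hz).1
  have hs : 0 ≤ S.slope := div_nonneg O.standing.kp_pos.le O.standing.ki_pos.le
  have h1 := abs_le.1 (hr _ (S.mem_image_ofPhase.1 h))
  have h2 := abs_le.1 (hr _ (S.mem_image_ofPhase.1 h'))
  simp only [planar, ofPhase, toPhase] at h1 h2 hw hw'
  rw [abs_le]
  constructor <;> nlinarith

theorem tendsto_solution (O : OvalFamily S P Vbar (fun V => S.ofPhase '' C V) a b eu el)
    (hγ : 0 < γ) (hPA : (-(S.Aᵀ * P + P * S.A + γ • P)).PosDef) {z : ℝ → State}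
    (hz : S.IsSolutionOn (Ici 0) z) (hmem : ∀ t, 0 ≤ t → z t ∈ invariantSquare P Vbar C) :
    Tendsto z atTop (𝓝 0) := by
  have hmem' := fun t ht => (O.mem_invariantSquare_iff (z t)).1 (hmem t ht)
  have hV : Tendsto (fun t => VCC P (z t).2.2) atTop (𝓝 0) := by
    have hexp : Tendsto (fun t => Real.exp (-γ * t) * VCC P (z 0).2.2) atTop (𝓝 0) := by
      have h1 : Tendsto (fun t => Real.exp (-γ * t)) atTop (𝓝 0) :=
        Real.tendsto_exp_atBot.comp (tendsto_id.const_mul_atTop_of_neg (neg_neg_iff_pos.2 hγ))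
      simpa using h1.mul_const (VCC P (z 0).2.2)
    refine squeeze_zero' (Eventually.of_forall fun t => VCC_nonneg O.posDef _) ?_ hexp
    filter_upwards [eventually_ge_atTop 0] with t ht
    exact VCC_le_exp hPA (x := fun t => (z t).2.2) ht
      (fun r hr => (hasDerivWithinAt_current (hz r hr.1).2).continuousWithinAt.mono
        Icc_subset_Ici_self)
      (fun r hr => (hasDerivWithinAt_current (hz r hr.1.le).2).hasDerivAt (Ici_mem_nhds hr.1))
  have hx : Tendsto (fun t => (z t).2.2) atTop (𝓝 0) := by
    obtain ⟨c, hc, h⟩ := exists_mul_norm_sq_le_VCC O.posDef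
    have h1 : Tendsto (fun t => √(VCC P (z t).2.2 / c)) atTop (𝓝 0) := by
      simpa using (hV.div_const c).sqrt
    refine squeeze_zero_norm (fun t => Real.le_sqrt_of_sq_le ?_) h1
    rw [le_div_iff₀ hc]
    linarith [h (z t).2.2]
  have hp := O.tendsto_zero (fun t ht => (hmem' t ht).2) hx (p := fun t => S.planar (z t))
    fun t ht => ⟨(hmem' t ht).1, hasDerivWithinAt_planar O.standing.ki_pos.ne' (hz t ht).2⟩
  have hq : Tendsto (fun t => S.toPhase (S.planar (z t))) atTop (𝓝 0) := by
    have h0 : S.toPhase 0 = 0 := by simp [toPhase]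
    have := (S.contDiff_toPhase.continuous.tendsto 0).comp hp
    rwa [h0] at this
  simp only [planar, toPhase_ofPhase] at hq
  exact hq.fst_nhds.prodMk_nhds (hq.snd_nhds.prodMk_nhds hx)

end OvalFamily

end InverterSystem

end

theorem mainTheorem1
    (S : InverterSystem) (hS : S.StandingAssumptions)
    (P : Matrix (Fin 4) (Fin 4) ℝ) (hP : P.PosDef)
    (γ : ℝ) (hγ : 0 < γ) (hPA : (-(S.Aᵀ * P + P * S.A + γ • P)).PosDef)
    (Vbar : ℝ) (hVbar : 0 ≤ Vbar)
    (hreg : ∀ x : Fin 4 → ℝ, InverterSystem.VCC P x ≤ Vbar → S.ν ⬝ᵥ x ≠ S.μ)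
    (C : ℝ → Set (ℝ × ℝ)) (hC : S.IsCycleFamily P Vbar C)
    (hstrip : ∀ p ∈ enclosedRegion (C Vbar), |p.1| ≤ Real.pi) :
    S.IsLockInEstimation (invariantSquare P Vbar C) := by
  obtain ⟨a, b, eu, el, O⟩ := hC.exists_ovalFamily hS hP hVbar hreg
  have hinv := O.forwardInvariant hγ hPA
  refine ⟨hinv, fun z₀ hz₀ => ⟨O.exists_isSolutionOn hγ hPA hz₀, fun z hz hz0 => ?_⟩⟩
  have hmem : ∀ t, 0 ≤ t → z t ∈ invariantSquare P Vbar C := fun t ht =>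
    hinv t z (fun s hs => ⟨(hz s hs.1).1, (hz s hs.1).2.mono Icc_subset_Ici_self⟩)
      (by rwa [hz0]) t (right_mem_Icc.2 ht)
  exact ⟨fun t ht => O.abs_fst_le (fun p hp => hstrip p (Or.inl hp)) (hmem t ht),
    O.tendsto_solution hγ hPA hz hmem⟩
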